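/- Let $S^3$ be the group of unit quaternions, with the left-invariant frame $e_1(x)=xi$, $e_2(x)=xj$, $e_3(x)=xk$ and the round metric $g_{S^3}$, $\langle e_i,e_j\rangle=\delta_{ij}$. For signs $\varepsilon\in\{\pm1\}^\nu$ let $G=(S^3)^\nu$ carry the product metric $g_\varepsilon=\bigoplus_k\varepsilon_k\,g_{S^3}$. For a closed subgroup $H\subset G$ with Lie algebra $\mathfrak h\subset\mathfrak g$ let $\pi:G\to G/H$ be the projection. Endomorphisms of $\mathfrak g$ are extended to left-invariant endomorphisms of $TG$. A pseudo-Riemannian submersion, with vertical distribution $\mathcal V=\ker\pi_*$ and $\mathcal H=\mathcal V^\perp$, is anti-invariant for an endomorphism $J$ of $TG$ if $J\mathcal V\subset\mathcal H$. It is called anti-invariant almost Hermitian if moreover it is Riemannian, $J^2=-\mathrm{id}$ and $J$ is isometric; Hermitian if in addition $J$ is integrable; para-Hermitian if the metric of $G$ is neutral, $J^2=\mathrm{id}$ and $g(J\cdot,J\cdot)=-g$. It is anti-invariant quaternion (octonian) if it is Riemannian, the quaternions (octonians) act unitally and smoothly on $TG$ (by an algebra action for the quaternions; bilinearly and alternatively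 for the octonians) with $\|x\cdot\xi\|=\|x\|\|\xi\|$, and every purely imaginary $x$ maps $\mathcal V$ into $\mathcal H$. It is anti-invariant para-quaternion if the algebra $\tilde{\mathbb Q}$ of para-quaternions ($e_1^2=-1$, $e_2^2=e_3^2=1$, $e_1e_2=e_3=-e_2e_1$) acts unitally and smoothly on $TG$, with $e_1$ isometric, $e_2,e_3$ para-Hermitian, and every purely imaginary element mapping $\mathcal V$ into $\mathcal H$. Then: (0) For all $\nu$ and $\varepsilon$: $G$ is compact; $g_\varepsilon$ is a bi-invariant pseudo-Riemannian metric with Ricci tensor $2\,(g_{S^3}\oplus\dots\oplus g_{S^3})$; if all $\varepsilon_k$ equal $s$, it is Einstein with $\mathrm{Ric}=2s\,g_\varepsilon$. If $H$ is a closed subgroup and $g_\varepsilon|_{\mathfrak h}$ is non-degenerate, then $G/H$ has a smooth structure and a metric for which $\pi$ is a pseudo-Riemannian submersion. In (1)–(3) $G/H$ carries any such structure and metric, and they exist in each case. (1) Let $G=S^3\times S^3$, $\mathfrak g=\mathrm{Span}\{e_1,e_2,e_3,f_1,f_2,f_3\}$. In each of the following four cases there is a closed connected $H$ with the given Lie algebra;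 for every closed $H$ with this Lie algebra $\pi$ is as stated, and if $H$ is connected, $G/H$ is diffeomorphic to the given manifold. (a) $g_G=g_{S^3}\oplus g_{S^3}$. (i) $\mathfrak h=\mathrm{Span}\{e_2,f_2\}$, $Je_1=f_1$, $Jf_1=-e_1$, $Je_2=e_3$, $Je_3=-e_2$, $Jf_2=f_3$, $Jf_3=-f_2$: $J$ is integrable and $\pi$ is anti-invariant Hermitian onto $S^2\times S^2$. (ii) $\mathfrak h=\mathrm{Span}\{e_1,e_2,e_3\}$, $Je_i=f_i$, $Jf_i=-e_i$: $J$ is not integrable and $\pi$ is anti-invariant almost Hermitian onto $S^3$. (b) $g_G=g_{S^3}\oplus-g_{S^3}$. (i) $\mathfrak h=\mathrm{Span}\{e_1,f_1\}$, $\tilde J$ exchanging $e_1\leftrightarrow f_2$, $f_1\leftrightarrow e_2$, $e_3\leftrightarrow f_3$: $\pi$ is anti-invariant para-Hermitian onto $S^2\times S^2$. (ii) $\mathfrak h=\mathrm{Span}\{e_1,e_2,e_3\}$, $\tilde J$ exchanging $e_i\leftrightarrow f_i$: $\pi$ is anti-invariant para-Hermitian onto $S^3$. (2) Let $G=(S^3)^4$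 and let $H$ be a closed subgroup with $\dim H\le3$. (a) $g_G=g_{S^3}\oplus g_{S^3}\oplus g_{S^3}\oplus g_{S^3}$: there is an isometric real-linear identification of $\mathfrak g$ with $\mathbb Q^3$, $\mathbb Q$ the quaternions, such that $\mathfrak h\subset\mathbb R^3$; for each of them, with the action of $\mathbb Q$ by left multiplication, $\pi$ is anti-invariant quaternion. (b) $g_G=g_\varepsilon$ with two signs $+$ and two signs $-$, and $g_G|_{\mathfrak h}$ non-degenerate: there are $\eta\in\{\pm1\}^3$ and an isometric real-linear identification of $\mathfrak g$ with $\tilde{\mathbb Q}^3$, whose $a$-th factor carries $\eta_a$ times the inner product of $\tilde{\mathbb Q}$ with orthogonal basis $e_0,\dots,e_3$ and squared lengths $(1,1,-1,-1)$, such that $\mathfrak h\subset\mathbb R^3$; for each of them, with the action of $\tilde{\mathbb Q}$ by left multiplication, $\pi$ is anti-invariant para-quaternion. (3) Let $G=(S^3)^8$, $g_G=g_{S^3}\oplus\dots\oplus g_{S^3}$, and let $H$ be a closed subgroup with $\dim H\le7$. For every isometric real-linear identification of $\mathfrak g$ with $\mathbb O^3$, $\mathbb O$ the octonians, such that $\mathfrak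 h\subset\mathbb R^3$, $\pi$ is anti-invariant octonian for the action of $\mathbb O$ by left multiplication; such an identification exists if $\dim H\le3$. For every $H$ with $\dim H\le 7$ there is a left-invariant octonian structure on $G$ for which $\pi$ is anti-invariant octonian. -/

import Mathlib

open Manifold ContDiff Quaternion Bundle

noncomputable section

/-! ## Pseudo-Riemannian manifolds and tensor fields -/

section General

variable {E : Type*} [NormedAddCommGroup E] [NormedSpace ℝ E]
  {H : Type*} [TopologicalSpace H] (I : ModelWithCorners ℝ E H)
  (M : Type*) [TopologicalSpace M] [ChartedSpace H M]
  {E' : Type*} [NormedAddCommGroup E'] [NormedSpace ℝ E']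
  {H' : Type*} [TopologicalSpace H'] {J : ModelWithCorners ℝ E' H'}
  {N : Type*} [TopologicalSpace N] [ChartedSpace H' N]

/-- Fields of bilinear forms on the tangent spaces of `M` (no regularity). -/
abbrev BilinField : Type _ := (x : M) → TangentSpace I x →L[ℝ] TangentSpace I x →L[ℝ] ℝ

/-- Fields of endomorphisms of the tangent spaces of `M` (no regularity). -/
abbrev EndField : Type _ := (x : M) → TangentSpace I x →L[ℝ] TangentSpace I x

/-- Vector fields on `M` (no regularity). -/
abbrev VectField : Type _ := (x : M) → TangentSpace I x

variable {I M}

section Smooth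

variable [IsManifold I ∞ M]

/-- The vector field is smooth. -/
def SmoothVect (X : VectField I M) : Prop :=
  ContMDiff I (I.prod 𝓘(ℝ, E)) ∞ (fun x => TotalSpace.mk' E x (X x))

/-- The field of endomorphisms is smooth. -/
def SmoothEnd (A : EndField I M) : Prop :=
  ContMDiff I (I.prod 𝓘(ℝ, E →L[ℝ] E)) ∞ (fun x => TotalSpace.mk' (E →L[ℝ] E)
    (E := fun x : M => TangentSpace I x →L[ℝ] TangentSpace I x) x (A x))

/-- The field of bilinear forms is smooth. -/
def SmoothBilin (g : BilinField I M) : Prop :=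
  ContMDiff I (I.prod 𝓘(ℝ, E →L[ℝ] E →L[ℝ] ℝ)) ∞
    (fun x => TotalSpace.mk' (E →L[ℝ] E →L[ℝ] ℝ)
      (E := fun x : M => TangentSpace I x →L[ℝ] TangentSpace I x →L[ℝ] ℝ) x (g x))

/-- `g` is a smooth pseudo-Riemannian metric: smooth, symmetric and non-degenerate. -/
structure IsPseudoRiemannianMetric (g : BilinField I M) : Prop where
  smooth : SmoothBilin g
  symm : ∀ x v w, g x v w = g x w v
  nondegenerate : ∀ x v, (∀ w, g x v w = 0) → v = 0

/-- `g` is a smooth Riemannian metric. -/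
structure IsRiemannianMetric (g : BilinField I M) : Prop extends IsPseudoRiemannianMetric g where
  pos : ∀ x v, v ≠ 0 → 0 < g x v v

end Smooth

/-- The bilinear form `g x` has neutral signature `(ℓ, ℓ)` for every `x`. -/
def IsNeutral (g : BilinField I M) : Prop :=
  ∀ x, ∃ P Q : Submodule ℝ (TangentSpace I x),
    IsCompl P Q ∧ Module.finrank ℝ P = Module.finrank ℝ Q ∧
    (∀ v ∈ P, v ≠ 0 → 0 < g x v v) ∧ (∀ v ∈ Q, v ≠ 0 → g x v v < 0) ∧
    (∀ v ∈ P, ∀ w ∈ Q, g x v w = 0)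

/-! ### Levi-Civita connection, Ricci tensor, Einstein metrics -/

section Curvature

variable [IsManifold I ∞ M]

/-- The curvature `R(X,Y)Z = ∇_X ∇_Y Z - ∇_Y ∇_X Z - ∇_[X,Y] Z`.  In Mathlib `cov Z x (X x)` is
`(∇_X Z)(x)`. -/
def curvatureOf (cov : CovariantDerivative I E (TangentSpace I : M → Type _))
    (X Y Z : VectField I M) : VectField I M := fun x =>
  cov (fun y => cov Z y (Y y)) x (X x) - cov (fun y => cov Z y (X y)) x (Y x)
    - cov Z x (VectorField.mlieBracket I X Y x)

/-- `cov` is the Levi-Civita connection of `g`: smooth, torsion free and metric. -/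
structure IsLeviCivita (g : BilinField I M)
    (cov : CovariantDerivative I E (TangentSpace I : M → Type _)) : Prop where
  smooth : CovariantDerivative.ContMDiffCovariantDerivative cov ∞
  torsion_free : ∀ X Y : VectField I M, SmoothVect X → SmoothVect Y → ∀ x,
    cov Y x (X x) - cov X x (Y x) = VectorField.mlieBracket I X Y x
  metric : ∀ Y Z : VectField I M, SmoothVect Y → SmoothVect Z → ∀ x (v : TangentSpace I x),
    mvfderiv I (fun y => g y (Y y) (Z y)) x v = g x (cov Y x v) (Z x) + g x (Y x) (cov Z x v)

/-- `ric` is the Ricci tensor `Ric(Y,Z) = tr (X ↦ R(X,Y)Z)` of the Levi-Civita connection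
of `g`. -/
def HasRicci (g ric : BilinField I M) : Prop :=
  ∃ cov : CovariantDerivative I E (TangentSpace I : M → Type _), IsLeviCivita g cov ∧
    ∀ (Y Z : VectField I M), SmoothVect Y → SmoothVect Z → ∀ x,
      ∃ A : TangentSpace I x →ₗ[ℝ] TangentSpace I x,
        (∀ X : VectField I M, SmoothVect X → A (X x) = curvatureOf cov X Y Z x) ∧
        LinearMap.trace ℝ (TangentSpace I x) A = ric x (Y x) (Z x)

/-- `g` is a pseudo-Riemannian Einstein metric with `Ric = c g`. -/
def IsEinstein (g : BilinField I M) (c : ℝ) : Prop :=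
  IsPseudoRiemannianMetric g ∧ HasRicci g (fun x => c • g x)

end Curvature

/-! ### Pseudo-Riemannian submersions -/

/-- The vertical space `𝓥_x = ker (pr_*)_x`. -/
def verticalSpace (I : ModelWithCorners ℝ E H) (J : ModelWithCorners ℝ E' H') (pr : M → N) (x : M) :
    Submodule ℝ (TangentSpace I x) :=
  LinearMap.ker (mfderiv I J pr x : TangentSpace I x →ₗ[ℝ] TangentSpace J (pr x))

/-- The horizontal space `𝓗_x`, the `g`-orthogonal complement of the vertical space. -/
def horizontalSpace (J : ModelWithCorners ℝ E' H') (g : BilinField I M) (pr : M → N) (x : M) :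
    Submodule ℝ (TangentSpace I x) where
  carrier := {v | ∀ w ∈ verticalSpace I J pr x, g x v w = 0}
  add_mem' {a b} ha hb w hw := by simp [ha w hw, hb w hw]
  zero_mem' w _ := by simp
  smul_mem' c a ha w hw := by simp [ha w hw]

section Submersion

variable [IsManifold I ∞ M] [IsManifold J ∞ N]

/-- `pr : (M, gM) → (N, gN)` is a pseudo-Riemannian submersion. -/
structure IsPseudoRiemannianSubmersion (gM : BilinField I M) (gN : BilinField J N)
    (pr : M → N) : Prop where
  metric_source : IsPseudoRiemannianMetric gM
  metric_target : IsPseudoRiemannianMetric gN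
  smooth : ContMDiff I J ∞ pr
  submersion : ∀ x, Function.Surjective (mfderiv I J pr x)
  vertical_nondegenerate : ∀ x, ∀ v ∈ verticalSpace I J pr x,
    (∀ w ∈ verticalSpace I J pr x, gM x v w = 0) → v = 0
  isometry : ∀ x, ∀ v ∈ horizontalSpace J gM pr x, ∀ w ∈ horizontalSpace J gM pr x,
    gN (pr x) (mfderiv I J pr x v) (mfderiv I J pr x w) = gM x v w

/-- `pr : (M, gM) → (N, gN)` is a Riemannian submersion. -/
structure IsRiemannianSubmersion (gM : BilinField I M) (gN : BilinField J N)
    (pr : M → N) : Prop extends IsPseudoRiemannianSubmersion gM gN pr where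
  riemannian_source : IsRiemannianMetric gM
  riemannian_target : IsRiemannianMetric gN

end Submersion

/-! ### Geometric structures -/

section Structures

variable [IsManifold I ∞ M]

/-- `K` is an almost complex structure with `g(KX,KY) = g(X,Y)`. -/
structure IsAlmostHermitian (g : BilinField I M) (K : EndField I M) : Prop where
  smooth : SmoothEnd K
  sq : ∀ x v, K x (K x v) = -v
  isometry : ∀ x v w, g x (K x v) (K x w) = g x v w

/-- Integrability of an almost complex structure: if the complex vector fields `A + √-1 B` and
`C + √-1 D` are smooth sections of `T^{1,0}`, so is their bracket
`([A,C] - [B,D]) + √-1 ([A,D] + [B,C])`. Here `A + √-1 B` lies in `T^{1,0}`, the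
`√-1`-eigenspace of `K`, if and only if `K A = -B` and `K B = A`. -/
def IsIntegrable (K : EndField I M) : Prop :=
  ∀ A B C D : VectField I M, SmoothVect A → SmoothVect B → SmoothVect C → SmoothVect D →
    (∀ x, K x (A x) = -B x ∧ K x (B x) = A x) →
    (∀ x, K x (C x) = -D x ∧ K x (D x) = C x) →
    ∀ x,
      K x (VectorField.mlieBracket I A C x - VectorField.mlieBracket I B D x)
        = -(VectorField.mlieBracket I A D x + VectorField.mlieBracket I B C x) ∧
      K x (VectorField.mlieBracket I A D x + VectorField.mlieBracket I B C x)
        = VectorField.mlieBracket I A C x - VectorField.mlieBracket I B D x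

/-- `(M, g, K)` is para-Hermitian: `g` has neutral signature, `K² = id` and
`g(KX,KY) = -g(X,Y)`. -/
structure IsParaHermitian (g : BilinField I M) (K : EndField I M) : Prop where
  neutral : IsNeutral g
  smooth : SmoothEnd K
  sq : ∀ x v, K x (K x v) = v
  antiisometry : ∀ x v w, g x (K x v) (K x w) = -g x v w

/-- A flat quaternion structure on `(M, g)`: a smooth unital action of the algebra of quaternions
on `TM` with `‖q · v‖ = ‖q‖ ‖v‖`. -/
structure IsFlatQuaternion (g : BilinField I M) (A : ℍ[ℝ] → EndField I M) : Prop where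
  smooth : ∀ q, SmoothEnd (A q)
  map_add : ∀ p q x v, A (p + q) x v = A p x v + A q x v
  map_smul : ∀ (r : ℝ) q x v, A (r • q) x v = r • A q x v
  map_one : ∀ x v, A 1 x v = v
  map_mul : ∀ p q x v, A (p * q) x v = A p x (A q x v)
  norm : ∀ q x v, g x (A q x v) (A q x v) = ‖q‖ ^ 2 * g x v v

/-- The algebra of para-quaternions: `e₁ = i`, `e₂ = j`, `e₃ = k` with `i² = -1`, `j² = k² = 1`,
`i j = k = -j i`. -/
abbrev ParaQuaternion : Type := ℍ[ℝ,-1,0,1]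

/-- A para-quaternion structure on `(M, g)`: a smooth unital action of the para-quaternions
on `TM` such that `e₁` is almost (pseudo-)Hermitian and `e₂`, `e₃` are para-Hermitian. -/
structure IsParaQuaternion (g : BilinField I M) (A : ParaQuaternion → EndField I M) : Prop where
  smooth : ∀ q, SmoothEnd (A q)
  map_add : ∀ p q x v, A (p + q) x v = A p x v + A q x v
  map_smul : ∀ (r : ℝ) q x v, A (r • q) x v = r • A q x v
  map_one : ∀ x v, A 1 x v = v
  map_mul : ∀ p q x v, A (p * q) x v = A p x (A q x v)
  hermitian : IsAlmostHermitian g (A ⟨0, 1, 0, 0⟩)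
  paraHermitian₂ : IsParaHermitian g (A ⟨0, 0, 1, 0⟩)
  paraHermitian₃ : IsParaHermitian g (A ⟨0, 0, 0, 1⟩)

/-- The octonians `𝕆 = ℍ ⊕ ℍ`, with standard basis `e₀, …, e₇` equal to
`(1,0), (i,0), (j,0), (k,0), (0,1), (0,i), (0,j), (0,k)`. -/
abbrev Octonian : Type := ℍ[ℝ] × ℍ[ℝ]

/-- Left multiplication by an octonian: `(a,b)(c,d) = (a c - d̄ b, d a + b c̄)`. -/
def octMulLeft (p : Octonian) : Octonian →ₗ[ℝ] Octonian where
  toFun q := (p.1 * q.1 - star q.2 * p.2, q.2 * p.1 + p.2 * star q.1)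
  map_add' q r := by ext <;> simp <;> ring
  map_smul' c q := by ext <;> simp <;> ring

/-- The Euclidean inner product of `𝕆 = ℝ⁸`. -/
def octInner (p q : Octonian) : ℝ := inner ℝ p.1 q.1 + inner ℝ p.2 q.2

/-- A flat octonian structure on `(M, g)`: a smooth unital octonian action on `TM` (bilinear, and
alternative, `o · (o · v) = (o o) · v`, since `𝕆` is not associative)
with `‖o · v‖ = ‖o‖ ‖v‖`. -/
structure IsFlatOctonian (g : BilinField I M) (A : Octonian → EndField I M) : Prop where
  smooth : ∀ o, SmoothEnd (A o)
  map_add : ∀ p q x v, A (p + q) x v = A p x v + A q x v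
  map_smul : ∀ (r : ℝ) o x v, A (r • o) x v = r • A o x v
  map_one : ∀ x v, A (1, 0) x v = v
  alternative : ∀ o x v, A o x (A o x v) = A (octMulLeft o o) x v
  norm : ∀ o x v, g x (A o x v) (A o x v) = octInner o o * g x v v

end Structures

/-! ### Anti-invariant submersions -/

section AntiInvariant

variable [IsManifold I ∞ M] [IsManifold J ∞ N]

/-- `K 𝓥 ⊆ 𝓗`. -/
def IsAntiInvariant (J : ModelWithCorners ℝ E' H') (g : BilinField I M) (pr : M → N)
    (K : EndField I M) : Prop :=
  ∀ x, ∀ v ∈ verticalSpace I J pr x, K x v ∈ horizontalSpace J g pr x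

/-- Anti-invariant almost Hermitian Riemannian submersions. -/
structure IsAntiInvariantAlmostHermitianSubmersion (gM : BilinField I M) (gN : BilinField J N)
    (pr : M → N) (K : EndField I M) : Prop where
  submersion : IsRiemannianSubmersion gM gN pr
  hermitian : IsAlmostHermitian gM K
  antiInvariant : IsAntiInvariant J gM pr K

/-- Anti-invariant Hermitian Riemannian submersions (the complex structure is integrable). -/
structure IsAntiInvariantHermitianSubmersion (gM : BilinField I M) (gN : BilinField J N)
    (pr : M → N) (K : EndField I M) : Prop
    extends IsAntiInvariantAlmostHermitianSubmersion gM gN pr K where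
  integrable : IsIntegrable K

/-- Anti-invariant para-Hermitian (pseudo-)Riemannian submersions. -/
structure IsAntiInvariantParaHermitianSubmersion (gM : BilinField I M) (gN : BilinField J N)
    (pr : M → N) (K : EndField I M) : Prop where
  submersion : IsPseudoRiemannianSubmersion gM gN pr
  paraHermitian : IsParaHermitian gM K
  antiInvariant : IsAntiInvariant J gM pr K

/-- Anti-invariant quaternion Riemannian submersions. -/
structure IsAntiInvariantQuaternionSubmersion (gM : BilinField I M) (gN : BilinField J N)
    (pr : M → N) (A : ℍ[ℝ] → EndField I M) : Prop where
  submersion : IsRiemannianSubmersion gM gN pr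
  quaternion : IsFlatQuaternion gM A
  antiInvariant : ∀ q : ℍ[ℝ], q.re = 0 → IsAntiInvariant J gM pr (A q)

/-- Anti-invariant para-quaternion (pseudo-)Riemannian submersions. -/
structure IsAntiInvariantParaQuaternionSubmersion (gM : BilinField I M) (gN : BilinField J N)
    (pr : M → N) (A : ParaQuaternion → EndField I M) : Prop where
  submersion : IsPseudoRiemannianSubmersion gM gN pr
  paraQuaternion : IsParaQuaternion gM A
  antiInvariant : ∀ q : ParaQuaternion, q.re = 0 → IsAntiInvariant J gM pr (A q)

/-- Anti-invariant octonian Riemannian submersions. -/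
structure IsAntiInvariantOctonianSubmersion (gM : BilinField I M) (gN : BilinField J N)
    (pr : M → N) (A : Octonian → EndField I M) : Prop where
  submersion : IsRiemannianSubmersion gM gN pr
  octonian : IsFlatOctonian gM A
  antiInvariant : ∀ o : Octonian, o.1.re = 0 → IsAntiInvariant J gM pr (A o)

end AntiInvariant

end General

/-! ## The Lie group `(S³)^ν` -/

instance finrank_quaternion_fact : Fact (Module.finrank ℝ ℍ[ℝ] = 3 + 1) :=
  ⟨Quaternion.finrank_eq_four⟩

/-- Finite products of manifolds are manifolds. -/
instance isManifold_pi {ι : Type*} [Fintype ι] {E : ι → Type*} [∀ i, NormedAddCommGroup (E i)]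
    [∀ i, NormedSpace ℝ (E i)] {H : ι → Type*} [∀ i, TopologicalSpace (H i)]
    (I : ∀ i, ModelWithCorners ℝ (E i) (H i)) (n : WithTop ℕ∞) (M : ι → Type*)
    [∀ i, TopologicalSpace (M i)] [∀ i, ChartedSpace (H i) (M i)] [∀ i, IsManifold (I i) n (M i)] :
    IsManifold (ModelWithCorners.pi I) n (∀ i, M i) := by
  apply isManifold_of_contDiffOn
  rintro _ _ ⟨e, he, rfl⟩ ⟨e', he', rfl⟩
  rw [contDiffOn_pi]
  intro i
  have h := (contDiffGroupoid n (I i)).compatible (he i trivial) (he' i trivial)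
  rw [contDiffGroupoid, mem_groupoid_of_pregroupoid] at h
  have h1 := h.1
  simp only [contDiffPregroupoid] at h1
  refine h1.comp (f := fun x : (∀ i, E i) => x i)
    (ContinuousLinearMap.proj (R := ℝ) (φ := E) i).contDiff.contDiffOn ?_
  rintro x ⟨hx, y, rfl⟩
  simp only [ModelWithCorners.pi, Set.mem_preimage, OpenPartialHomeomorph.trans_source] at hx ⊢
  exact ⟨⟨hx.1 i trivial, hx.2 i trivial⟩, y i, rfl⟩

/-- `S³`, the group of unit quaternions. -/
abbrev S3 : Type := Metric.sphere (0 : ℍ[ℝ]) 1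

/-- `S²`, the unit sphere of `ℝ³`. -/
abbrev S2 : Type := Metric.sphere (0 : EuclideanSpace ℝ (Fin 3)) 1

/-- The Lie group `(S³)^ν`. -/
abbrev S3Pow (ν : ℕ) : Type := Fin ν → S3

/-- The model of `(S³)^ν` with its product manifold structure. -/
abbrev modelS3Pow (ν : ℕ) :
    ModelWithCorners ℝ (Fin ν → EuclideanSpace ℝ (Fin 3))
      (ModelPi fun _ : Fin ν => EuclideanSpace ℝ (Fin 3)) :=
  ModelWithCorners.pi fun _ : Fin ν => 𝓡 3

/-- The Lie algebra `𝔤` of `(S³)^ν`, in coordinates: `c` stands for the left-invariant vector field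
`∑ c k a e_{k,a}`, where `e_{k,0}, e_{k,1}, e_{k,2}` are the fields `x_k i, x_k j, x_k k` on the
`k`-th factor. -/
abbrev LieAlg (ν : ℕ) : Type := Fin ν → Fin 3 → ℝ

/-- The imaginary quaternion `c₀ i + c₁ j + c₂ k`. -/
def imQuat (c : Fin 3 → ℝ) : ℍ[ℝ] := ⟨0, c 0, c 1, c 2⟩

/-- The exponential map `𝔤 → (S³)^ν`. -/
def expS3Pow {ν : ℕ} (c : LieAlg ν) : S3Pow ν := fun k =>
  ⟨NormedSpace.exp (imQuat (c k)), by
    rw [mem_sphere_zero_iff_norm, Quaternion.norm_exp]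
    simp [imQuat]⟩

/-- The Lie algebra of a closed subgroup `H`, as a subspace of `𝔤`: the `c` with `exp (t c) ∈ H` for
all `t` (for closed `H` this set is a subspace, equal to its span). -/
def lieAlgOf {ν : ℕ} (H : Subgroup (S3Pow ν)) : Submodule ℝ (LieAlg ν) :=
  Submodule.span ℝ {c | ∀ t : ℝ, expS3Pow (t • c) ∈ H}

/-- The left-invariant trivialization `T_x G → 𝔤`: the components of a tangent vector in the
orthonormal left-invariant frame `e_{k,a}(x) = x_k i, x_k j, x_k k`. -/
def coframe {ν : ℕ} (x : S3Pow ν) : TangentSpace (modelS3Pow ν) x →L[ℝ] LieAlg ν :=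
  ContinuousLinearMap.pi fun k => ContinuousLinearMap.pi fun a =>
    (innerSL ℝ ((x k : ℍ[ℝ]) * imQuat (Pi.single a 1))) ∘L
      (mvfderiv (modelS3Pow ν) (fun y : S3Pow ν => (y k : ℍ[ℝ])) x)

theorem hasMFDerivAt_eval {ν : ℕ} (x : S3Pow ν) (k : Fin ν) :
    HasMFDerivAt (modelS3Pow ν) (𝓡 3) (fun y : S3Pow ν => y k) x
      (ContinuousLinearMap.proj (R := ℝ) (φ := fun _ : Fin ν => EuclideanSpace ℝ (Fin 3)) k) := by
  refine ⟨(continuous_apply k).continuousAt, ?_⟩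
  refine (ContinuousLinearMap.hasFDerivWithinAt _).congr' ?_ ?_
  · intro y _
    have : (chartAt (EuclideanSpace ℝ (Fin 3)) (x k)).target = Set.univ := by
      simp [chartAt, ChartedSpace.chartAt]
    exact (chartAt (EuclideanSpace ℝ (Fin 3)) (x k)).right_inv (x := y k) (by rw [this]; trivial)
  · exact ⟨_, rfl⟩

theorem imQuat_re (c : Fin 3 → ℝ) : (imQuat c).re = 0 := rfl
theorem imQuat_imI (c : Fin 3 → ℝ) : (imQuat c).imI = c 0 := rfl
theorem imQuat_imJ (c : Fin 3 → ℝ) : (imQuat c).imJ = c 1 := rfl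
theorem imQuat_imK (c : Fin 3 → ℝ) : (imQuat c).imK = c 2 := rfl

theorem coframe_injective {ν : ℕ} (x : S3Pow ν) : Function.Injective (coframe x) := by
  rw [injective_iff_map_eq_zero]
  intro v hv
  funext k
  have h0 : mvfderiv (modelS3Pow ν) (fun y : S3Pow ν => (y k : ℍ[ℝ])) x v =
     mvfderiv (𝓡 3) ((↑) : S3 → ℍ[ℝ]) (x k) ((v : Fin ν → EuclideanSpace ℝ (Fin 3)) k) := by
    have h1 := ((contMDiff_coe_sphere (E := ℍ[ℝ]) (n := 3) (m := 1)
      (x k)).mdifferentiableAt one_ne_zero).hasMFDerivAt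
    have h2 := (h1.comp x (hasMFDerivAt_eval x k)).mfderiv
    simp only [mvfderiv]
    erw [h2]
    rfl
  apply injective_mvfderiv_subtypeVal_sphere (x k)
  erw [← h0, map_zero]
  have hm : mvfderiv (𝓡 3) ((↑) : S3 → ℍ[ℝ]) (x k)
      ((v : Fin ν → EuclideanSpace ℝ (Fin 3)) k) ∈ (Submodule.span ℝ {((x k : S3) : ℍ[ℝ])})ᗮ := by
    rw [← range_mvfderiv_subtypeVal (n := 3)]
    exact ⟨_, rfl⟩
  rw [← h0, Submodule.mem_orthogonal_singleton_iff_inner_right] at hm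
  have hc : ∀ a, inner ℝ ((x k : ℍ[ℝ]) * imQuat (Pi.single a 1))
      (mvfderiv (modelS3Pow ν) (fun y : S3Pow ν => (y k : ℍ[ℝ])) x v) = 0 :=
    fun a => congrFun (congrFun hv k) a
  generalize mvfderiv (modelS3Pow ν) (fun y : S3Pow ν => (y k : ℍ[ℝ])) x v = w at hm hc
  have hx : ((x k : S3) : ℍ[ℝ]) ≠ 0 := by
    intro h
    have := mem_sphere_zero_iff_norm.1 (x k).2
    rw [h] at this
    simp at this
  have e0 := hc 0
  have e1 := hc 1
  have e2 := hc 2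
  have : star ((x k : S3) : ℍ[ℝ]) * w = 0 := by
    generalize ((x k : S3) : ℍ[ℝ]) = z at *
    simp [Quaternion.inner_def, imQuat_re, imQuat_imI, imQuat_imJ, imQuat_imK] at hm e0 e1 e2
    ext <;> simp <;> linarith
  exact (mul_eq_zero.1 this).resolve_left (by simpa using hx)

/-- The left-invariant trivialization is an isomorphism. -/
theorem coframe_isInvertible {ν : ℕ} (x : S3Pow ν) : (coframe x).IsInvertible := by
  have hf : Module.finrank ℝ (Fin ν → EuclideanSpace ℝ (Fin 3)) =
      Module.finrank ℝ (LieAlg ν) := by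
    rw [Module.finrank_pi_fintype, Module.finrank_pi_fintype]
    simp
  let e := LinearEquiv.ofInjectiveOfFinrankEq
    (show (Fin ν → EuclideanSpace ℝ (Fin 3)) →ₗ[ℝ] LieAlg ν from (coframe x).toLinearMap)
    (coframe_injective x) hf
  exact ⟨(e.toContinuousLinearEquiv :
    (Fin ν → EuclideanSpace ℝ (Fin 3)) ≃L[ℝ] LieAlg ν), rfl⟩

/-- The inner product on `𝔤` with orthogonal basis `e_{k,a}` and `⟨e_{k,a}, e_{k,a}⟩ = ε k`. -/
def prodInner {ν : ℕ} (ε : Fin ν → ℤˣ) (c d : LieAlg ν) : ℝ :=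
  ∑ k, ((ε k : ℤ) : ℝ) * ∑ a, c k a * d k a

/-- The product metric `⊕ ε k g_{S³}` on `(S³)^ν`. -/
def prodMetric {ν : ℕ} (ε : Fin ν → ℤˣ) : BilinField (modelS3Pow ν) (S3Pow ν) := fun x =>
  ∑ k, ((ε k : ℤ) : ℝ) • ∑ a,
    (((ContinuousLinearMap.proj a).comp (ContinuousLinearMap.proj k)).comp
      (coframe x)).smulRight
    (((ContinuousLinearMap.proj a).comp (ContinuousLinearMap.proj k)).comp (coframe x))

/-- The left-invariant endomorphism field of `TG` defined by an endomorphism of `𝔤`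
(`coframe x` is invertible). -/
def leftInvEnd {ν : ℕ} (j : LieAlg ν →ₗ[ℝ] LieAlg ν) : EndField (modelS3Pow ν) (S3Pow ν) :=
  fun x => (coframe x).inverse ∘L (LinearMap.toContinuousLinearMap j) ∘L (coframe x)

/-- Bi-invariance of a metric on `(S³)^ν`: left and right translations are isometries. -/
def IsBiInvariant {ν : ℕ} (g : BilinField (modelS3Pow ν) (S3Pow ν)) : Prop :=
  ∀ (a x : S3Pow ν) (v w : TangentSpace (modelS3Pow ν) x),
    g (a * x) (mfderiv (modelS3Pow ν) (modelS3Pow ν) (fun y => a * y) x v)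
        (mfderiv (modelS3Pow ν) (modelS3Pow ν) (fun y => a * y) x w) = g x v w ∧
    g (x * a) (mfderiv (modelS3Pow ν) (modelS3Pow ν) (fun y => y * a) x v)
        (mfderiv (modelS3Pow ν) (modelS3Pow ν) (fun y => y * a) x w) = g x v w

/-- The restriction of `⊕ ε k g_{S³}` to the Lie algebra of `H` is non-degenerate. -/
def NondegenerateOn {ν : ℕ} (ε : Fin ν → ℤˣ) (H : Subgroup (S3Pow ν)) : Prop :=
  ∀ c ∈ lieAlgOf H, (∀ d ∈ lieAlgOf H, prodInner ε c d = 0) → c = 0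

/-- The coset manifold `G/H` with its metric: a smooth structure on the topological quotient space
`G/H` and a metric for which `G → G/H` is a pseudo-Riemannian submersion (there is at most
one such smooth structure and at most one such metric). -/
structure CosetGeometry {ν : ℕ} (ε : Fin ν → ℤˣ) (H : Subgroup (S3Pow ν)) where
  dim : ℕ
  charted : ChartedSpace (EuclideanSpace ℝ (Fin dim)) (S3Pow ν ⧸ H)
  manifold : IsManifold (𝓡 dim) ∞ (S3Pow ν ⧸ H)
  metric : BilinField (𝓡 dim) (S3Pow ν ⧸ H)
  submersion : IsPseudoRiemannianSubmersion (I := modelS3Pow ν) (J := 𝓡 dim) (prodMetric ε) metric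
    (QuotientGroup.mk : S3Pow ν → S3Pow ν ⧸ H)

attribute [instance] CosetGeometry.charted CosetGeometry.manifold

/-- The projection `G → G/H`. -/
abbrev CosetGeometry.proj {ν : ℕ} {ε : Fin ν → ℤˣ} {H : Subgroup (S3Pow ν)}
    (_Q : CosetGeometry ε H) : S3Pow ν → S3Pow ν ⧸ H := QuotientGroup.mk

/-- `e 0, e 1, e 2` are the vectors `e₁, e₂, e₃` of the first factor of `S³ × S³`. -/
def eVec (a : Fin 3) : LieAlg 2 := Pi.single 0 (Pi.single a 1)

/-- `f 0, f 1, f 2` are the vectors `f₁, f₂, f₃` of the second factor of `S³ × S³`. -/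
def fVec (a : Fin 3) : LieAlg 2 := Pi.single 1 (Pi.single a 1)

/-- The coordinate `c ↦ c k a` on `𝔤`. -/
def coordForm {ν : ℕ} (k : Fin ν) (a : Fin 3) : LieAlg ν →ₗ[ℝ] ℝ where
  toFun c := c k a
  map_add' _ _ := rfl
  map_smul' _ _ := rfl

/-- The endomorphism of the Lie algebra of `S³ × S³` with `e_a ↦ u a` and `f_a ↦ v a`. -/
def endOfImages (u v : Fin 3 → LieAlg 2) : LieAlg 2 →ₗ[ℝ] LieAlg 2 :=
  ∑ a : Fin 3, ((coordForm 0 a).smulRight (u a) + (coordForm 1 a).smulRight (v a))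

/-! ### Identifications of `𝔤` with `ℚ³`, `ℚ̃³` and `𝕆³` -/

/-- Left multiplication by `q` on `ℚ³`, transported to `𝔤` by `φ`. -/
def quatEnd {ν : ℕ} (φ : (Fin 3 → ℍ[ℝ]) ≃ₗ[ℝ] LieAlg ν) (q : ℍ[ℝ]) : LieAlg ν →ₗ[ℝ] LieAlg ν :=
  φ.conj ((LinearMap.mulLeft ℝ q).compLeft (Fin 3))

/-- `φ : ℚ³ ≃ 𝔤` is isometric and `𝔥` consists of real vectors. -/
structure IsQuatIdentification {ν : ℕ} (ε : Fin ν → ℤˣ) (H : Subgroup (S3Pow ν))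
    (φ : (Fin 3 → ℍ[ℝ]) ≃ₗ[ℝ] LieAlg ν) : Prop where
  isometry : ∀ p q, prodInner ε (φ p) (φ q) = ∑ a, inner ℝ (p a) (q a)
  real : ∀ c ∈ lieAlgOf H, ∃ r : Fin 3 → ℝ, c = φ fun a => (r a : ℍ[ℝ])

/-- Left multiplication by `q` on `ℚ̃³`, transported to `𝔤` by `φ`. -/
def paraQuatEnd {ν : ℕ} (φ : (Fin 3 → ParaQuaternion) ≃ₗ[ℝ] LieAlg ν) (q : ParaQuaternion) :
    LieAlg ν →ₗ[ℝ] LieAlg ν :=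
  φ.conj ((LinearMap.mulLeft ℝ q).compLeft (Fin 3))

/-- The inner product of the para-quaternions: `e₀, e₁` have length `1` and `e₂, e₃` have
length `-1`. -/
def paraQuatInner (p q : ParaQuaternion) : ℝ :=
  p.re * q.re + p.imI * q.imI - p.imJ * q.imJ - p.imK * q.imK

/-- `φ : ℚ̃³ ≃ 𝔤` is isometric, where the `a`-th factor of `ℚ̃³` carries `η a` times the standard
inner product, and `𝔥` consists of real vectors. -/
structure IsParaQuatIdentification {ν : ℕ} (ε : Fin ν → ℤˣ) (H : Subgroup (S3Pow ν))
    (η : Fin 3 → ℤˣ) (φ : (Fin 3 → ParaQuaternion) ≃ₗ[ℝ] LieAlg ν) : Prop where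
  isometry : ∀ p q, prodInner ε (φ p) (φ q) = ∑ a, ((η a : ℤ) : ℝ) * paraQuatInner (p a) (q a)
  real : ∀ c ∈ lieAlgOf H, ∃ r : Fin 3 → ℝ, c = φ fun a => (r a : ParaQuaternion)

/-- Left multiplication by `o` on `𝕆³`, transported to `𝔤` by `φ`. -/
def octEnd {ν : ℕ} (φ : (Fin 3 → Octonian) ≃ₗ[ℝ] LieAlg ν) (o : Octonian) :
    LieAlg ν →ₗ[ℝ] LieAlg ν :=
  φ.conj ((octMulLeft o).compLeft (Fin 3))

/-- `φ : 𝕆³ ≃ 𝔤` is isometric and `𝔥` consists of real vectors. -/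
structure IsOctIdentification {ν : ℕ} (ε : Fin ν → ℤˣ) (H : Subgroup (S3Pow ν))
    (φ : (Fin 3 → Octonian) ≃ₗ[ℝ] LieAlg ν) : Prop where
  isometry : ∀ p q, prodInner ε (φ p) (φ q) = ∑ a, octInner (p a) (q a)
  real : ∀ c ∈ lieAlgOf H, ∃ r : Fin 3 → ℝ, c = φ fun a => ((r a : ℍ[ℝ]), 0)

end

/-!
Everything about `(S³)^ν` is read through the left-invariant coframe `coframe : TG → 𝔤`, for which
the metric, the left-invariant endomorphisms and, up to a bracket term, vector fields are constant.

*Ricci curvature.* The Maurer–Cartan equation `coframe_mlieBracket` and the `ad`-invariance of the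
inner product show that `∇ = d + ½ [·, ·]` is a torsion-free metric connection for `g_ε`, whatever
the signs are. So its curvature `R(X, Y)Z = -¼ [[X, Y], Z]` does not depend on `ε`, and neither does
the Ricci tensor, which is computed by a trace over `𝔤` (`trace_curvOp`) and is the one of the
positive definite metric.

*Cosets.* Closed-subgroup theory enters in three forms: the generators of one-parameter subgroups of
`H` form a subspace (`mem_lieAlgOf`), no element of `H` near `1` lies off `exp 𝔥` in a complementary
direction (`exists_forall_exp_mem_eq_zero`), and so `H` has a slice (`nonempty_cosetSlice`), whose
translates are an atlas of `G/H`. If `g_ε` is non-degenerate on `𝔥`, then `𝔤 = 𝔥 ⊕ 𝔥^⊥`, and the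
inner product of the `𝔥^⊥`-components of lifts of tangent vectors of `G/H` does not depend on the
lifts, because `g_ε` is bi-invariant. This gives the metric of `G/H` (`nonempty_cosetGeometry`).
The definition of `CosetGeometry` allows other smooth structures and metrics, but for all of them the
vertical space at every point is `𝔥` in the coframe (`mem_verticalSpace_mk`), and the horizontal
space is `𝔥^⊥`. Hence anti-invariance of a left-invariant endomorphism means that it maps `𝔥` into
`𝔥^⊥` (`CosetGeometry.isAntiInvariant_leftInvEnd`), and integrability is the vanishing of the
Nijenhuis tensor on `𝔤` (`isIntegrable_leftInvEnd_iff`). Only linear algebra on `𝔤` remains.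

*Diffeomorphism types.* A closed connected subgroup is determined by its Lie algebra
(`eq_of_lieAlgOf_eq`), so `H` is either a product of two circles, whose cosets are the fibres of a
product of two Hopf maps, or the first factor of `S³ × S³`, whose cosets are the fibres of a
projection. Two surjective submersions with the same fibres have diffeomorphic targets
(`nonempty_diffeomorph_of_submersions`).

*Identifications.* Imaginary elements of the algebra map `ℝ³` to its orthogonal complement in the
cube of the algebra, and left multiplications are isometric up to the norm, so every identification
that puts `𝔥` into `ℝ³` will do. In the definite case it exists because an isometry between subspaces
of Euclidean spaces of the same dimension extends (`exists_isometric_identification`). In the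
para-quaternionic case one extends a signed orthonormal basis of `𝔥` by one of `𝔥^⊥`; by Sylvester's
law of inertia it has six vectors of each sign (`IsSignedOrthonormal.card_eq_six`), so that it can be
matched with the units of the three factors. For `dim H ≤ 7` left multiplication does not
suffice. Instead `o` acts on one of the three factors `𝕆` as multiplication by the conjugate `ō`;
then imaginary octonions map the diagonal of two factors, of dimension `8`, to its orthogonal
complement, and `𝔥` is moved into this diagonal (`exists_isAntiInvariantOctonian`).
-/


open scoped Topology

noncomputable section

/-! ### Smooth sections and the bracket of vector fields -/

section Forms

variable {E : Type*} [NormedAddCommGroup E] [NormedSpace ℝ E]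
  {H : Type*} [TopologicalSpace H] {I : ModelWithCorners ℝ E H}
  {M : Type*} [TopologicalSpace M] [ChartedSpace H M]
  {F : Type*} [NormedAddCommGroup F] [NormedSpace ℝ F]
  {V₁ : M → Type*} {F₁ : Type*} [NormedAddCommGroup F₁] [NormedSpace ℝ F₁]
  [∀ x, AddCommGroup (V₁ x)] [∀ x, Module ℝ (V₁ x)] [TopologicalSpace (TotalSpace F₁ V₁)]
  [∀ x, TopologicalSpace (V₁ x)] [FiberBundle F₁ V₁] [VectorBundle ℝ F₁ V₁]
  {V₂ : M → Type*} {F₂ : Type*} [NormedAddCommGroup F₂] [NormedSpace ℝ F₂]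
  [∀ x, AddCommGroup (V₂ x)] [∀ x, Module ℝ (V₂ x)] [TopologicalSpace (TotalSpace F₂ V₂)]
  [∀ x, TopologicalSpace (V₂ x)] [FiberBundle F₂ V₂] [VectorBundle ℝ F₂ V₂]
  [∀ x, IsTopologicalAddGroup (V₂ x)] [∀ x, ContinuousSMul ℝ (V₂ x)]

theorem ContMDiffAt.smulRight_section {n : WithTop ℕ∞} {η : ∀ x, V₁ x →L[ℝ] ℝ} {X : ∀ x, V₂ x}
    {x₀ : M}
    (hη : ContMDiffAt I (I.prod 𝓘(ℝ, F₁ →L[ℝ] ℝ)) n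
      (fun x => TotalSpace.mk' (F₁ →L[ℝ] ℝ) (E := fun x : M => V₁ x →L[ℝ] ℝ) x (η x)) x₀)
    (hX : ContMDiffAt I (I.prod 𝓘(ℝ, F₂)) n (fun x => TotalSpace.mk' F₂ x (X x)) x₀) :
    ContMDiffAt I (I.prod 𝓘(ℝ, F₁ →L[ℝ] F₂)) n
      (fun x => TotalSpace.mk' (F₁ →L[ℝ] F₂) (E := fun x : M => V₁ x →L[ℝ] V₂ x) x
        ((η x).smulRight (X x))) x₀ := by
  rw [contMDiffAt_hom_bundle] at hη ⊢
  refine ⟨hη.1, ?_⟩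
  have hX' := (contMDiffAt_totalSpace.1 hX).2
  have h := (ContinuousLinearMap.smulRightL ℝ F₁ F₂).isBoundedBilinearMap.contDiff (n := n)
  have h2 := h.contMDiff.contMDiffAt.comp x₀ (hη.2.prodMk_space hX')
  refine h2.congr_of_eventuallyEq ?_
  filter_upwards [(trivializationAt F₂ V₂ x₀).open_baseSet.mem_nhds
    (FiberBundle.mem_baseSet_trivializationAt' x₀)] with x hx
  ext v
  simp [ContinuousLinearMap.inCoordinates, Trivialization.continuousLinearMapAt_apply,
    Trivialization.linearMapAt_apply, hx]

/-- The differential of a smooth map into a vector space is a smooth vector-valued one-form. -/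
theorem ContMDiffAt.mvfderiv_section [IsManifold I ∞ M] {f : M → F} {x₀ : M}
    (hf : ContMDiffAt I 𝓘(ℝ, F) ∞ f x₀) :
    ContMDiffAt I (I.prod 𝓘(ℝ, E →L[ℝ] F)) ∞
      (fun x => TotalSpace.mk' (E →L[ℝ] F) (E := fun x : M => TangentSpace I x →L[ℝ] F) x
        (mvfderiv I f x)) x₀ := by
  rw [contMDiffAt_hom_bundle]
  refine ⟨contMDiffAt_id, ?_⟩
  have h := hf.mfderiv_const (m := ∞) (by simp)
  refine h.congr_of_eventuallyEq (Filter.Eventually.of_forall fun x => ?_)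
  ext v
  simp [inTangentCoordinates, ContinuousLinearMap.inCoordinates, mvfderiv]
  rfl

end Forms

section Bracket

variable {E : Type*} [NormedAddCommGroup E] [NormedSpace ℝ E]
  {H : Type*} [TopologicalSpace H] {I : ModelWithCorners ℝ E H} [I.Boundaryless]
  {M : Type*} [TopologicalSpace M] [ChartedSpace H M] [IsManifold I ∞ M]
  {F : Type*} [NormedAddCommGroup F] [NormedSpace ℝ F]

theorem ContMDiff.contDiffAt_comp_extChartAt_symm {f : M → F} (hf : ContMDiff I 𝓘(ℝ, F) ∞ f)
    (x : M) : ContDiffAt ℝ ∞ (f ∘ (extChartAt I x).symm) (extChartAt I x x) := by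
  have h2 : ContMDiffAt 𝓘(ℝ, E) I ∞ (extChartAt I x).symm (extChartAt I x x) :=
    (contMDiffOn_extChartAt_symm x).contMDiffAt (extChartAt_target_mem_nhds x)
  exact ((hf _).comp _ h2).contDiffAt

theorem mvfderiv_eq_fderiv_extChartAt {f : M → F} (hf : ContMDiff I 𝓘(ℝ, F) ∞ f) (x : M)
    {y : M} (hy : y ∈ (extChartAt I x).source) (w : TangentSpace I y) :
    mvfderiv I f y w = fderiv ℝ (f ∘ (extChartAt I x).symm) (extChartAt I x y)
      (mfderiv I 𝓘(ℝ, E) (extChartAt I x) y w) := by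
  have h1 : MDifferentiableAt 𝓘(ℝ, E) 𝓘(ℝ, F) (f ∘ (extChartAt I x).symm) (extChartAt I x y) := by
    have h2 : ContMDiffAt 𝓘(ℝ, E) I ∞ (extChartAt I x).symm (extChartAt I x y) :=
      (contMDiffOn_extChartAt_symm x).contMDiffAt
        (extChartAt_target_mem_nhds' ((extChartAt I x).map_source hy))
    exact ((hf _).comp _ h2).mdifferentiableAt (by simp)
  have h3 : MDifferentiableAt I 𝓘(ℝ, E) (extChartAt I x) y :=
    (contMDiffAt_extChartAt' (n := ∞) (by simpa using hy)).mdifferentiableAt (by simp)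
  have h4 : f =ᶠ[nhds y] (f ∘ (extChartAt I x).symm) ∘ extChartAt I x := by
    filter_upwards [extChartAt_source_mem_nhds' hy] with z hz
    simp only [Function.comp, (extChartAt I x).left_inv hz]
  have h5 := h4.mfderiv_eq (I := I) (I' := 𝓘(ℝ, F))
  rw [mfderiv_comp y h1 h3, mfderiv_eq_fderiv] at h5
  have := congrArg (fun A : E →L[ℝ] F => A w) h5
  exact this

/-- `X (Y f) - Y (X f) = [X, Y] f` for vector-valued `f`: read in a chart, the difference of the
two second derivatives vanishes by symmetry and the derivatives of the vector fields give the
bracket. -/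
theorem mvfderiv_mlieBracket [CompleteSpace E] {f : M → F} (hf : ContMDiff I 𝓘(ℝ, F) ∞ f)
    {X Y : VectField I M} (hX : SmoothVect X) (hY : SmoothVect Y) (x : M) :
    mvfderiv I (fun y => mvfderiv I f y (Y y)) x (X x)
      - mvfderiv I (fun y => mvfderiv I f y (X y)) x (Y x)
      = mvfderiv I f x (VectorField.mlieBracket I X Y x) := by
  have i2 : IsManifold I 2 M := IsManifold.of_le (n := ∞) (WithTop.coe_le_coe.2 le_top)
  have i1 : IsManifold I 1 M := IsManifold.of_le (n := ∞) (WithTop.coe_le_coe.2 le_top)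
  set φ := extChartAt I x with hφ
  have hfs := hf.contDiffAt_comp_extChartAt_symm x
  -- the vector field read in the chart at `x`
  have key : ∀ Y : VectField I M, SmoothVect Y →
      ∃ Y' : E → E, DifferentiableAt ℝ Y' (φ x) ∧
        Y' = VectorField.mpullbackWithin 𝓘(ℝ, E) I φ.symm Y (Set.range I) ∧
        (∀ᶠ y in nhds x, mfderiv I 𝓘(ℝ, E) φ y (Y y) = Y' (φ y)) := by
    intro Y hY
    refine ⟨_, ?_, rfl, ?_⟩
    · have := MDifferentiableWithinAt.differentiableWithinAt_mpullbackWithin_vectorField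
        (s := Set.univ) (x := x)
        (((hY x).mdifferentiableAt (by simp)).mdifferentiableWithinAt)
      exact this.differentiableAt (by simp [I.range_eq_univ])
    · have h := VectorField.eventuallyEq_mpullback_mpullbackWithin_extChartAt (I := I)
        (s := Set.univ) (x := x) Y
      rw [nhdsWithin_univ] at h
      filter_upwards [h, extChartAt_source_mem_nhds (I := I) x] with y hy hys
      rw [hy, VectorField.mpullback_apply]
      exact (isInvertible_mfderiv_extChartAt hys).self_apply_inverse _
  -- `X (Y f)` read in the chart at `x`
  have key2 : ∀ X Y : VectField I M, ∀ X' Y' : E → E, DifferentiableAt ℝ Y' (φ x) →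
      (∀ᶠ y in nhds x, mfderiv I 𝓘(ℝ, E) φ y (X y) = X' (φ y)) →
      (∀ᶠ y in nhds x, mfderiv I 𝓘(ℝ, E) φ y (Y y) = Y' (φ y)) →
      mvfderiv I (fun y => mvfderiv I f y (Y y)) x (X x) =
        fderiv ℝ (fderiv ℝ (f ∘ φ.symm)) (φ x) (X' (φ x)) (Y' (φ x)) +
        fderiv ℝ (f ∘ φ.symm) (φ x) (fderiv ℝ Y' (φ x) (X' (φ x))) := by
    intro X Y X' Y' hY' hXX hYY
    have e : (fun y => mvfderiv I f y (Y y)) =ᶠ[nhds x]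
        (fun z => fderiv ℝ (f ∘ φ.symm) z (Y' z)) ∘ φ := by
      filter_upwards [hYY, extChartAt_source_mem_nhds (I := I) x] with y hy hys
      rw [mvfderiv_eq_fderiv_extChartAt hf x hys]
      simp only [Function.comp]
      rw [← hy]
    have d1 : DifferentiableAt ℝ (fderiv ℝ (f ∘ φ.symm)) (φ x) :=
      (hfs.fderiv_right (m := ∞) (by simp)).differentiableAt (by simp)
    have d2 := d1.hasFDerivAt.clm_apply hY'.hasFDerivAt
    have d3 := d2.hasMFDerivAt.comp x
      ((contMDiffAt_extChartAt (I := I) (n := ∞)).mdifferentiableAt (by simp)).hasMFDerivAt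
    have d4 := d3.congr_of_eventuallyEq e
    have hX := hXX.self_of_nhds
    have := d4.mfderiv
    rw [mvfderiv]
    have t := congrArg (fun A : E →L[ℝ] F => A (X x)) this
    refine t.trans ?_
    refine (congrArg (fun u : E => (fderiv ℝ (f ∘ φ.symm) (φ x) ∘L fderiv ℝ Y' (φ x) +
      (fderiv ℝ (fderiv ℝ (f ∘ φ.symm)) (φ x)).flip (Y' (φ x))) u) hX).trans ?_
    simp [add_comm]
  obtain ⟨X', hX', eX, hXX⟩ := key X hX
  obtain ⟨Y', hY', eY, hYY⟩ := key Y hY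
  rw [key2 X Y X' Y' hY' hXX hYY, key2 Y X Y' X' hX' hYY hXX]
  have sym : IsSymmSndFDerivAt ℝ (f ∘ φ.symm) (φ x) := hfs.isSymmSndFDerivAt
    (by rw [minSmoothness_of_isRCLikeNormedField]; exact WithTop.coe_le_coe.2 le_top)
  rw [sym.eq (X' (φ x)) (Y' (φ x)), mvfderiv_eq_fderiv_extChartAt hf x (mem_extChartAt_source x)]
  have e : mfderiv I 𝓘(ℝ, E) φ x (VectorField.mlieBracket I X Y x) =
      VectorField.lieBracket ℝ X' Y' (φ x) := by
    rw [← VectorField.mlieBracketWithin_univ, VectorField.mlieBracketWithin_apply]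
    erw [(isInvertible_mfderiv_extChartAt (mem_extChartAt_source x)).self_apply_inverse]
    rw [← eX, ← eY, Set.preimage_univ, Set.univ_inter, I.range_eq_univ,
      VectorField.lieBracketWithin_univ]
  erw [e]
  rw [VectorField.lieBracket, map_sub]
  abel

end Bracket

/-! ### Local sections of submersions -/

section Submersions

variable {E : Type*} [NormedAddCommGroup E] [NormedSpace ℝ E]
  {H : Type*} [TopologicalSpace H] {I : ModelWithCorners ℝ E H} [I.Boundaryless]
  {M : Type*} [TopologicalSpace M] [ChartedSpace H M] [IsManifold I ∞ M]
  {E' : Type*} [NormedAddCommGroup E'] [NormedSpace ℝ E'] [FiniteDimensional ℝ E']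
  {H' : Type*} [TopologicalSpace H'] {J : ModelWithCorners ℝ E' H'}
  {N : Type*} [TopologicalSpace N] [ChartedSpace H' N]
  {E'' : Type*} [NormedAddCommGroup E''] [NormedSpace ℝ E'']
  {H'' : Type*} [TopologicalSpace H''] {J' : ModelWithCorners ℝ E'' H''}
  {P : Type*} [TopologicalSpace P] [ChartedSpace H'' P]

/-- A smooth map with surjective derivative has a smooth local right inverse: the inverse function
theorem applies to its restriction to an affine complement of the kernel. -/
theorem ContDiffAt.exists_right_inverse {f : E → E'} {z : E} (hf : ContDiffAt ℝ ∞ f z)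
    (hs : Function.Surjective (fderiv ℝ f z)) :
    ∃ g : E' → E, g (f z) = z ∧ ContDiffAt ℝ ∞ g (f z) ∧ ∀ᶠ w in nhds (f z), f (g w) = w := by
  obtain ⟨R, hR⟩ := (fderiv ℝ f z : E →ₗ[ℝ] E').exists_rightInverse_of_surjective
    (LinearMap.range_eq_top.2 hs)
  let A : E' → E := fun w => z + R.toContinuousLinearMap w
  have hA0 : A 0 = z := by simp [A]
  have hA : ContDiff ℝ ∞ A := contDiff_const.add R.toContinuousLinearMap.contDiff
  have hA' : HasFDerivAt A R.toContinuousLinearMap 0 :=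
    R.toContinuousLinearMap.hasFDerivAt.const_add z
  have hfA : ContDiffAt ℝ ∞ (f ∘ A) 0 := ContDiffAt.comp 0 (by rwa [hA0]) hA.contDiffAt
  have hfA' : HasFDerivAt (f ∘ A)
      ((ContinuousLinearEquiv.refl ℝ E' : E' ≃L[ℝ] E') : E' →L[ℝ] E') 0 := by
    have h1 : HasFDerivAt f (fderiv ℝ f z) (A 0) := by
      rw [hA0]; exact (hf.differentiableAt (by simp)).hasFDerivAt
    convert h1.comp 0 hA' using 1
    ext v
    exact (LinearMap.congr_fun hR v).symm
  have e : (f ∘ A) 0 = f z := by simp [hA0]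
  refine ⟨A ∘ hfA.localInverse hfA' (by simp), ?_, ?_, ?_⟩
  · have := hfA.localInverse_apply_image hfA' (by simp)
    rw [e] at this
    simp [this, hA0]
  · have := hfA.to_localInverse hfA' (by simp)
    rw [e] at this
    exact hA.contDiffAt.comp _ this
  · have := (hfA.hasStrictFDerivAt' hfA' (by simp)).eventually_right_inverse
    rw [e] at this
    exact this

/-- A submersion has a smooth local section through every point. -/
theorem ContMDiffAt.exists_localSection {p : M → N} {x : M} (hp : ContMDiffAt I J ∞ p x)
    (hs : Function.Surjective (mfderiv I J p x)) :
    ∃ s : N → M, s (p x) = x ∧ ContMDiffAt J I ∞ s (p x) ∧ ∀ᶠ q in nhds (p x), p (s q) = q := by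
  have h1 := (contMDiffAt_iff.1 hp).2
  rw [I.range_eq_univ, contDiffWithinAt_univ] at h1
  rw [(hp.mdifferentiableAt (by simp)).mfderiv, I.range_eq_univ, fderivWithin_univ] at hs
  obtain ⟨g, hg0, hg, hfg⟩ := h1.exists_right_inverse hs
  have e : (extChartAt J (p x) ∘ p ∘ (extChartAt I x).symm) (extChartAt I x x) =
      extChartAt J (p x) (p x) := by simp
  rw [e] at hg0 hg hfg
  have hsm : ContMDiffAt J I ∞ ((extChartAt I x).symm ∘ g ∘ extChartAt J (p x)) (p x) := by
    refine ContMDiffAt.comp (I' := 𝓘(ℝ, E)) _ ?_ (hg.contMDiffAt.comp _ contMDiffAt_extChartAt)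
    simp only [Function.comp]
    rw [hg0]
    exact (contMDiffOn_extChartAt_symm x).contMDiffAt (extChartAt_target_mem_nhds x)
  have hsx : ((extChartAt I x).symm ∘ g ∘ extChartAt J (p x)) (p x) = x := by
    simp only [Function.comp, hg0]
    exact extChartAt_to_inv x
  refine ⟨_, hsx, hsm, ?_⟩
  have c1 : ContinuousAt (p ∘ (extChartAt I x).symm ∘ g ∘ extChartAt J (p x)) (p x) :=
    ContinuousAt.comp (by rw [hsx]; exact hp.continuousAt) hsm.continuousAt
  have c2 : ∀ᶠ q in nhds (p x),
      (p ∘ (extChartAt I x).symm ∘ g ∘ extChartAt J (p x)) q ∈ (extChartAt J (p x)).source :=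
    c1.eventually_mem (by
      have h : (p ∘ (extChartAt I x).symm ∘ g ∘ extChartAt J (p x)) (p x) = p x := congrArg p hsx
      rw [h]
      exact extChartAt_source_mem_nhds (p x))
  filter_upwards [c2, (continuousAt_extChartAt (I := J) (p x)).eventually hfg,
    extChartAt_source_mem_nhds (I := J) (p x)] with q h2 h3 h4
  exact (extChartAt J (p x)).injOn h2 h4 h3

theorem ContMDiffAt.of_comp_submersion {p : M → N} {f : N → P} {x : M}
    (hp : ContMDiffAt I J ∞ p x) (hs : Function.Surjective (mfderiv I J p x))
    (hf : ContMDiffAt I J' ∞ (f ∘ p) x) : ContMDiffAt J J' ∞ f (p x) := by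
  obtain ⟨s, hsx, hs, hps⟩ := hp.exists_localSection hs
  have h : ContMDiffAt J J' ∞ ((f ∘ p) ∘ s) (p x) :=
    ContMDiffAt.comp (I' := I) _ (by rwa [hsx]) hs
  refine h.congr_of_eventuallyEq ?_
  filter_upwards [hps] with q hq
  simp [hq]

/-- A map on the target of a surjective submersion is smooth as soon as its pull-back is. -/
theorem ContMDiff.of_comp_submersion {p : M → N} {f : N → P} (hp : ContMDiff I J ∞ p)
    (hps : Function.Surjective p) (hs : ∀ x, Function.Surjective (mfderiv I J p x))
    (hf : ContMDiff I J' ∞ (f ∘ p)) : ContMDiff J J' ∞ f := by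
  intro q
  obtain ⟨x, rfl⟩ := hps q
  exact (hp x).of_comp_submersion (hs x) (hf x)

/-- Two surjective submersions with the same fibres have diffeomorphic targets. -/
theorem nonempty_diffeomorph_of_submersions [FiniteDimensional ℝ E'']
    {p : M → N} {p' : M → P}
    (hp : ContMDiff I J ∞ p) (hps : Function.Surjective p)
    (hs : ∀ x, Function.Surjective (mfderiv I J p x))
    (hp' : ContMDiff I J' ∞ p') (hps' : Function.Surjective p')
    (hs' : ∀ x, Function.Surjective (mfderiv I J' p' x))
    (hpp : ∀ x y, p x = p y ↔ p' x = p' y) : Nonempty (Diffeomorph J J' N P ∞) := by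
  have e1 : ∀ x, (p' ∘ Function.surjInv hps) (p x) = p' x := fun x =>
    (hpp _ _).1 (Function.surjInv_eq hps (p x))
  have e2 : ∀ x, (p ∘ Function.surjInv hps') (p' x) = p x := fun x =>
    (hpp _ _).2 (Function.surjInv_eq hps' (p' x))
  have c1 : ContMDiff J J' ∞ (p' ∘ Function.surjInv hps) :=
    hp.of_comp_submersion hps hs (by
      rw [show (p' ∘ Function.surjInv hps) ∘ p = p' from funext e1]; exact hp')
  have c2 : ContMDiff J' J ∞ (p ∘ Function.surjInv hps') :=
    hp'.of_comp_submersion hps' hs' (by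
      rw [show (p ∘ Function.surjInv hps') ∘ p' = p from funext e2]; exact hp)
  exact ⟨{
    toFun := p' ∘ Function.surjInv hps
    invFun := p ∘ Function.surjInv hps'
    left_inv := fun q => by
      obtain ⟨x, rfl⟩ := hps q
      rw [e1, e2]
    right_inv := fun q => by
      obtain ⟨x, rfl⟩ := hps' q
      rw [e2, e1]
    contMDiff_toFun := c1
    contMDiff_invFun := c2 }⟩

end Submersions

/-! ### Smooth maps into `(S³)^ν` and the left-invariant coframe -/

instance boundaryless_modelS3Pow (ν : ℕ) : (modelS3Pow ν).Boundaryless where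
  range_eq_univ := by
    refine Set.eq_univ_of_forall fun y => ⟨y, ?_⟩
    rfl

section PiManifold

variable {ι : Type*} [Fintype ι] {E : ι → Type*} [∀ i, NormedAddCommGroup (E i)]
    [∀ i, NormedSpace ℝ (E i)] {H : ι → Type*} [∀ i, TopologicalSpace (H i)]
    {I : ∀ i, ModelWithCorners ℝ (E i) (H i)} {n : WithTop ℕ∞} {N : ι → Type*}
    [∀ i, TopologicalSpace (N i)] [∀ i, ChartedSpace (H i) (N i)]
    {E' : Type*} [NormedAddCommGroup E'] [NormedSpace ℝ E']
    {H' : Type*} [TopologicalSpace H'] {J : ModelWithCorners ℝ E' H'}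
    {M : Type*} [TopologicalSpace M] [ChartedSpace H' M]

theorem contMDiff_piManifold {f : M → ∀ i, N i} (hf : ∀ i, ContMDiff J (I i) n fun x => f x i) :
    ContMDiff J (ModelWithCorners.pi I) n f := by
  intro x
  rw [contMDiffAt_iff]
  refine ⟨continuousAt_pi.2 fun i => (hf i x).continuousAt, ?_⟩
  rw [contDiffWithinAt_pi]
  intro i
  exact (contMDiffAt_iff.1 (hf i x)).2

end PiManifold

section S3Pow

variable {ν : ℕ}
    {E' : Type*} [NormedAddCommGroup E'] [NormedSpace ℝ E']
    {H' : Type*} [TopologicalSpace H'] {J : ModelWithCorners ℝ E' H'}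
    {M : Type*} [TopologicalSpace M] [ChartedSpace H' M]

theorem contMDiff_eval (k : Fin ν) :
    ContMDiff (modelS3Pow ν) (𝓡 3) ∞ (fun y : S3Pow ν => y k) := by
  intro x
  rw [contMDiffAt_iff]
  refine ⟨(continuous_apply k).continuousAt, ?_⟩
  refine (ContinuousLinearMap.proj (R := ℝ) (φ := fun _ : Fin ν => EuclideanSpace ℝ (Fin 3))
    k).contDiff.contDiffWithinAt.congr_of_mem (f := _) ?_ ?_
  · intro y _
    have : (chartAt (EuclideanSpace ℝ (Fin 3)) (x k)).target = Set.univ := by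
      simp [chartAt, ChartedSpace.chartAt]
    exact (chartAt (EuclideanSpace ℝ (Fin 3)) (x k)).right_inv (x := y k) (by rw [this]; trivial)
  · exact ⟨_, rfl⟩

theorem contMDiff_coe_eval (k : Fin ν) :
    ContMDiff (modelS3Pow ν) 𝓘(ℝ, ℍ[ℝ]) ∞ (fun y : S3Pow ν => (y k : ℍ[ℝ])) :=
  contMDiff_coe_sphere.comp (contMDiff_eval k)

theorem contMDiff_toS3Pow [IsManifold J ∞ M] {f : M → S3Pow ν}
    (hf : ∀ k, ContMDiff J 𝓘(ℝ, ℍ[ℝ]) ∞ fun m => (f m k : ℍ[ℝ])) :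
    ContMDiff J (modelS3Pow ν) ∞ f :=
  contMDiff_piManifold fun k => (hf k).codRestrict_sphere fun m => (f m k).2

theorem contMDiff_mul_S3Pow [IsManifold J ∞ M] {f g : M → S3Pow ν}
    (hf : ContMDiff J (modelS3Pow ν) ∞ f) (hg : ContMDiff J (modelS3Pow ν) ∞ g) :
    ContMDiff J (modelS3Pow ν) ∞ (fun m => f m * g m) := by
  refine contMDiff_toS3Pow fun k => ?_
  have h1 := (contMDiff_coe_eval k).comp hf
  have h2 := (contMDiff_coe_eval k).comp hg
  have h := (contDiff_mul (𝕜 := ℝ) (𝔸 := ℍ[ℝ]) (n := ∞)).contMDiff.comp (h1.prodMk_space h2)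
  exact h

/-- The derivative of the `k`-th coordinate `x ↦ x k` in the quaternions. -/
abbrev dcoe (x : S3Pow ν) (k : Fin ν) : TangentSpace (modelS3Pow ν) x →L[ℝ] ℍ[ℝ] :=
  mvfderiv (modelS3Pow ν) (fun y : S3Pow ν => (y k : ℍ[ℝ])) x

theorem coframe_apply (x : S3Pow ν) (v : TangentSpace (modelS3Pow ν) x) (k : Fin ν) (a : Fin 3) :
    coframe x v k a = inner ℝ ((x k : ℍ[ℝ]) * imQuat (Pi.single a 1)) (dcoe x k v) := rfl

theorem star_mul_self_S3 (z : S3) : star (z : ℍ[ℝ]) * z = 1 := by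
  have hx : ‖(z : ℍ[ℝ])‖ = 1 := mem_sphere_zero_iff_norm.1 z.2
  rw [Quaternion.star_mul_self, Quaternion.normSq_eq_norm_mul_self, hx]; simp

theorem self_mul_star_S3 (z : S3) : (z : ℍ[ℝ]) * star (z : ℍ[ℝ]) = 1 := by
  have hx : ‖(z : ℍ[ℝ])‖ = 1 := mem_sphere_zero_iff_norm.1 z.2
  rw [Quaternion.self_mul_star, Quaternion.normSq_eq_norm_mul_self, hx]; simp

/-- The velocity of a curve in the unit sphere is orthogonal to its position. -/
theorem inner_dcoe (x : S3Pow ν) (v : TangentSpace (modelS3Pow ν) x) (k : Fin ν) :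
    inner ℝ (x k : ℍ[ℝ]) (dcoe x k v) = 0 := by
  have h0 : dcoe x k v =
     mvfderiv (𝓡 3) ((↑) : S3 → ℍ[ℝ]) (x k) ((v : Fin ν → EuclideanSpace ℝ (Fin 3)) k) := by
    have h1 := ((contMDiff_coe_sphere (E := ℍ[ℝ]) (n := 3) (m := 1)
      (x k)).mdifferentiableAt one_ne_zero).hasMFDerivAt
    have h2 := (h1.comp x (hasMFDerivAt_eval x k)).mfderiv
    simp only [dcoe, mvfderiv]
    erw [h2]
    rfl
  have hm : mvfderiv (𝓡 3) ((↑) : S3 → ℍ[ℝ]) (x k)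
      ((v : Fin ν → EuclideanSpace ℝ (Fin 3)) k) ∈ (Submodule.span ℝ {((x k : S3) : ℍ[ℝ])})ᗮ := by
    rw [← range_mvfderiv_subtypeVal (n := 3)]
    exact ⟨_, rfl⟩
  rwa [← h0, Submodule.mem_orthogonal_singleton_iff_inner_right] at hm

/-- A vector tangent to `S³` at `z` is `z` times an imaginary quaternion, the components of which
are its components in the left-invariant frame. -/
theorem eq_mul_imQuat {z : S3} {w : ℍ[ℝ]} (h : inner ℝ (z : ℍ[ℝ]) w = 0) :
    w = z * imQuat fun a => inner ℝ ((z : ℍ[ℝ]) * imQuat (Pi.single a 1)) w := by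
  have h1 : imQuat (fun a => inner ℝ ((z : ℍ[ℝ]) * imQuat (Pi.single a 1)) w) =
      star (z : ℍ[ℝ]) * w := by
    generalize (z : ℍ[ℝ]) = z at *
    simp [Quaternion.inner_def] at h
    ext <;> simp [Quaternion.inner_def, imQuat_re, imQuat_imI, imQuat_imJ, imQuat_imK] <;> linarith
  rw [h1, ← mul_assoc, self_mul_star_S3, one_mul]

theorem dcoe_eq (x : S3Pow ν) (v : TangentSpace (modelS3Pow ν) x) (k : Fin ν) :
    dcoe x k v = x k * imQuat (coframe x v k) :=
  eq_mul_imQuat (inner_dcoe x v k)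

theorem inner_mul_imQuat (z : S3) (c d : Fin 3 → ℝ) :
    inner ℝ ((z : ℍ[ℝ]) * imQuat c) (z * imQuat d) = ∑ a, c a * d a := by
  have h : inner ℝ ((z : ℍ[ℝ]) * imQuat c) (z * imQuat d) =
      (star (z : ℍ[ℝ]) * z).re * ∑ a, c a * d a := by
    simp [Quaternion.inner_def, imQuat_re, imQuat_imI, imQuat_imJ, imQuat_imK, Fin.sum_univ_three]
    ring
  rw [h, star_mul_self_S3]; simp

theorem inner_mul_imQuat_single (z : S3) (c : Fin 3 → ℝ) (a : Fin 3) :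
    inner ℝ ((z : ℍ[ℝ]) * imQuat (Pi.single a 1)) (z * imQuat c) = c a := by
  rw [inner_mul_imQuat]; simp [Pi.single_apply]

theorem imQuat_injective : Function.Injective imQuat := by
  intro c d h
  funext a
  fin_cases a
  · exact congrArg QuaternionAlgebra.imI h
  · exact congrArg QuaternionAlgebra.imJ h
  · exact congrArg QuaternionAlgebra.imK h

theorem coframe_eq_iff (x : S3Pow ν) (v : TangentSpace (modelS3Pow ν) x) (c : LieAlg ν) :
    coframe x v = c ↔ ∀ k, dcoe x k v = x k * imQuat (c k) := by
  refine ⟨fun h k => by rw [dcoe_eq, h], fun h => ?_⟩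
  funext k a
  rw [coframe_apply, h, inner_mul_imQuat_single]

theorem prodMetric_apply (ε : Fin ν → ℤˣ) (x : S3Pow ν) (v w : TangentSpace (modelS3Pow ν) x) :
    prodMetric ε x v w = prodInner ε (coframe x v) (coframe x w) := by
  simp [prodMetric, prodInner]

theorem prodMetric_eq_dcoe (ε : Fin ν → ℤˣ) (x : S3Pow ν) (v w : TangentSpace (modelS3Pow ν) x) :
    prodMetric ε x v w = ∑ k, ((ε k : ℤ) : ℝ) * inner ℝ (dcoe x k v) (dcoe x k w) := by
  rw [prodMetric_apply, prodInner]
  simp only [dcoe_eq, inner_mul_imQuat]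

/-- The value of the derivative of a map into `(S³)^ν`, seen in the quaternions. -/
theorem dcoe_mfderiv {f : M → S3Pow ν} {m : M} (hf : MDifferentiableAt J (modelS3Pow ν) f m)
    (v : TangentSpace J m) (k : Fin ν) :
    dcoe (f m) k (mfderiv J (modelS3Pow ν) f m v) = mvfderiv J (fun y => (f y k : ℍ[ℝ])) m v := by
  have h1 := ((contMDiff_coe_eval k (f m)).mdifferentiableAt (by simp)).hasMFDerivAt
  have h2 := (h1.comp m hf.hasMFDerivAt).mfderiv
  exact (congrArg (fun A : E' →L[ℝ] ℍ[ℝ] => A v) h2).symm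

end S3Pow

/-! ### Smoothness in a moving frame -/

section Frames

variable {E : Type*} [NormedAddCommGroup E] [NormedSpace ℝ E]
  {H : Type*} [TopologicalSpace H] {I : ModelWithCorners ℝ E H}
  {M : Type*} [TopologicalSpace M] [ChartedSpace H M]
  {F : Type*} [NormedAddCommGroup F] [NormedSpace ℝ F]
  {F' : Type*} [NormedAddCommGroup F'] [NormedSpace ℝ F']
  {V₁ : M → Type*} {F₁ : Type*} [NormedAddCommGroup F₁] [NormedSpace ℝ F₁]
  [∀ x, AddCommGroup (V₁ x)] [∀ x, Module ℝ (V₁ x)] [TopologicalSpace (TotalSpace F₁ V₁)]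
  [∀ x, TopologicalSpace (V₁ x)] [FiberBundle F₁ V₁] [VectorBundle ℝ F₁ V₁]
  {V₂ : M → Type*} {F₂ : Type*} [NormedAddCommGroup F₂] [NormedSpace ℝ F₂]
  [∀ x, AddCommGroup (V₂ x)] [∀ x, Module ℝ (V₂ x)] [TopologicalSpace (TotalSpace F₂ V₂)]
  [∀ x, TopologicalSpace (V₂ x)] [FiberBundle F₂ V₂] [VectorBundle ℝ F₂ V₂]
  {n : WithTop ℕ∞} {x₀ : M}

/-- A one-form with values in a vector space is smooth if and only if it is smooth in a
trivialization of the bundle on which it is defined. -/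
theorem contMDiffAt_homTrivial {η : ∀ x, V₁ x →L[ℝ] F} :
    ContMDiffAt I (I.prod 𝓘(ℝ, F₁ →L[ℝ] F)) n
      (fun x => TotalSpace.mk' (F₁ →L[ℝ] F) (E := fun x : M => V₁ x →L[ℝ] F) x (η x)) x₀ ↔
    ContMDiffAt I 𝓘(ℝ, F₁ →L[ℝ] F) n
      (fun x => η x ∘L (trivializationAt F₁ V₁ x₀).symmL ℝ x) x₀ := by
  rw [contMDiffAt_hom_bundle]
  have e : (fun x => ContinuousLinearMap.inCoordinates F₁ V₁ F (fun _ : M => F) x₀ x x₀ x (η x)) =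
      fun x => η x ∘L (trivializationAt F₁ V₁ x₀).symmL ℝ x := by
    funext x
    ext v
    simp [ContinuousLinearMap.inCoordinates]
  refine ⟨fun h => ?_, fun h => ⟨contMDiffAt_id, ?_⟩⟩
  · rw [← e]; exact h.2
  · rw [← e] at h; exact h

theorem ContMDiffAt.clm_comp_section {η : ∀ x, V₁ x →L[ℝ] F} {Φ : M → F →L[ℝ] F'}
    (hη : ContMDiffAt I (I.prod 𝓘(ℝ, F₁ →L[ℝ] F)) n
      (fun x => TotalSpace.mk' (F₁ →L[ℝ] F) (E := fun x : M => V₁ x →L[ℝ] F) x (η x)) x₀)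
    (hΦ : ContMDiffAt I 𝓘(ℝ, F →L[ℝ] F') n Φ x₀) :
    ContMDiffAt I (I.prod 𝓘(ℝ, F₁ →L[ℝ] F')) n
      (fun x => TotalSpace.mk' (F₁ →L[ℝ] F') (E := fun x : M => V₁ x →L[ℝ] F') x (Φ x ∘L η x))
      x₀ := by
  rw [contMDiffAt_homTrivial] at hη ⊢
  exact hΦ.clm_comp hη

variable [CompleteSpace F₂]

/-- The frame dual to a smooth coframe is smooth, read in a trivialization. -/
theorem contMDiffAt_inverse_symmL {θ : ∀ x, V₂ x →L[ℝ] F} (hi : ∀ x, (θ x).IsInvertible)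
    (hθ : ContMDiffAt I (I.prod 𝓘(ℝ, F₂ →L[ℝ] F)) n
      (fun x => TotalSpace.mk' (F₂ →L[ℝ] F) (E := fun x : M => V₂ x →L[ℝ] F) x (θ x)) x₀) :
    ContMDiffAt I 𝓘(ℝ, F →L[ℝ] F₂) n
      (fun x => (trivializationAt F₂ V₂ x₀).continuousLinearMapAt ℝ x ∘L (θ x).inverse) x₀ := by
  rw [contMDiffAt_homTrivial] at hθ
  have hb := (trivializationAt F₂ V₂ x₀).open_baseSet.mem_nhds
    (FiberBundle.mem_baseSet_trivializationAt' x₀)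
  have key : ∀ x ∈ (trivializationAt F₂ V₂ x₀).baseSet,
      ∃ e : F₂ ≃L[ℝ] F, (e : F₂ →L[ℝ] F) = θ x ∘L (trivializationAt F₂ V₂ x₀).symmL ℝ x ∧
        (e.symm : F →L[ℝ] F₂) =
          (trivializationAt F₂ V₂ x₀).continuousLinearMapAt ℝ x ∘L (θ x).inverse := by
    intro x hx
    obtain ⟨u, hu⟩ := hi x
    refine ⟨((trivializationAt F₂ V₂ x₀).continuousLinearEquivAt ℝ x hx).symm.trans u, ?_, ?_⟩
    · ext v
      simp only [← hu, ContinuousLinearMap.comp_apply]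
      rw [← Trivialization.symm_continuousLinearEquivAt_eq _ hx]
      rfl
    · ext v; rw [← hu, ContinuousLinearMap.inverse_equiv]
      simp [Trivialization.continuousLinearEquivAt_apply,
        Trivialization.continuousLinearMapAt_apply, Trivialization.linearMapAt_apply, hx]
  obtain ⟨e₀, he₀, -⟩ := key x₀ (FiberBundle.mem_baseSet_trivializationAt' x₀)
  have h1 : ContDiffAt ℝ n ContinuousLinearMap.inverse
      (θ x₀ ∘L (trivializationAt F₂ V₂ x₀).symmL ℝ x₀) := by
    rw [← he₀]; exact contDiffAt_map_inverse e₀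
  refine (h1.contMDiffAt.comp x₀ hθ).congr_of_eventuallyEq ?_
  filter_upwards [hb] with x hx
  obtain ⟨e, he, he'⟩ := key x hx
  simp only [Function.comp]
  rw [← he, ← he', ContinuousLinearMap.inverse_equiv]

/-- Vectors with smooth components in a smooth moving coframe `θ` form a smooth section. -/
theorem ContMDiffAt.inverse_coframe_apply {θ : ∀ x, V₂ x →L[ℝ] F} (hi : ∀ x, (θ x).IsInvertible)
    (hθ : ContMDiffAt I (I.prod 𝓘(ℝ, F₂ →L[ℝ] F)) n
      (fun x => TotalSpace.mk' (F₂ →L[ℝ] F) (E := fun x : M => V₂ x →L[ℝ] F) x (θ x)) x₀)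
    {c : M → F} (hc : ContMDiffAt I 𝓘(ℝ, F) n c x₀) :
    ContMDiffAt I (I.prod 𝓘(ℝ, F₂)) n
      (fun x => TotalSpace.mk' F₂ x ((θ x).inverse (c x))) x₀ := by
  refine contMDiffAt_totalSpace.2 ⟨contMDiffAt_id, ?_⟩
  refine ((contMDiffAt_inverse_symmL hi hθ).clm_apply hc).congr_of_eventuallyEq ?_
  filter_upwards [(trivializationAt F₂ V₂ x₀).open_baseSet.mem_nhds
    (FiberBundle.mem_baseSet_trivializationAt' x₀)] with x hx
  simp [Trivialization.continuousLinearMapAt_apply, Trivialization.linearMapAt_apply, hx]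

/-- A homomorphism of vector bundles with smooth components in a smooth moving coframe `θ` is
smooth. -/
theorem ContMDiffAt.inverse_coframe_comp
    [∀ x, IsTopologicalAddGroup (V₂ x)] [∀ x, ContinuousSMul ℝ (V₂ x)]
    {θ : ∀ x, V₂ x →L[ℝ] F} (hi : ∀ x, (θ x).IsInvertible)
    (hθ : ContMDiffAt I (I.prod 𝓘(ℝ, F₂ →L[ℝ] F)) n
      (fun x => TotalSpace.mk' (F₂ →L[ℝ] F) (E := fun x : M => V₂ x →L[ℝ] F) x (θ x)) x₀)
    {η : ∀ x, V₁ x →L[ℝ] F}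
    (hη : ContMDiffAt I (I.prod 𝓘(ℝ, F₁ →L[ℝ] F)) n
      (fun x => TotalSpace.mk' (F₁ →L[ℝ] F) (E := fun x : M => V₁ x →L[ℝ] F) x (η x)) x₀) :
    ContMDiffAt I (I.prod 𝓘(ℝ, F₁ →L[ℝ] F₂)) n
      (fun x => TotalSpace.mk' (F₁ →L[ℝ] F₂) (E := fun x : M => V₁ x →L[ℝ] V₂ x) x
        ((θ x).inverse ∘L η x)) x₀ := by
  rw [contMDiffAt_hom_bundle]
  refine ⟨contMDiffAt_id, ?_⟩
  rw [contMDiffAt_homTrivial] at hη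
  refine ((contMDiffAt_inverse_symmL hi hθ).clm_comp hη).congr_of_eventuallyEq ?_
  filter_upwards with x
  rfl

end Frames

section PullbackForm

variable {E : Type*} [NormedAddCommGroup E] [NormedSpace ℝ E]
  {H : Type*} [TopologicalSpace H] {I : ModelWithCorners ℝ E H}
  {M : Type*} [TopologicalSpace M] [ChartedSpace H M] [IsManifold I ∞ M] {x₀ : M}

set_option synthInstance.maxHeartbeats 400000 in
/-- The inner product of `𝔤` pulled back by a smooth `𝔤`-valued one-form is a smooth field of
bilinear forms. -/
theorem contMDiffAt_prodInner_comp {ν : ℕ} (ε : Fin ν → ℤˣ)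
    {θ : ∀ x : M, TangentSpace I x →L[ℝ] LieAlg ν}
    (hθ : ContMDiffAt I (I.prod 𝓘(ℝ, E →L[ℝ] LieAlg ν)) ∞
      (fun x => TotalSpace.mk' (E →L[ℝ] LieAlg ν)
        (E := fun x : M => TangentSpace I x →L[ℝ] LieAlg ν) x (θ x)) x₀) :
    ContMDiffAt I (I.prod 𝓘(ℝ, E →L[ℝ] E →L[ℝ] ℝ)) ∞
      (fun x => TotalSpace.mk' (E →L[ℝ] E →L[ℝ] ℝ)
        (E := fun x : M => TangentSpace I x →L[ℝ] TangentSpace I x →L[ℝ] ℝ) x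
        (∑ k, ((ε k : ℤ) : ℝ) • ∑ a,
          (((ContinuousLinearMap.proj a).comp (ContinuousLinearMap.proj k)).comp
            (θ x)).smulRight
          (((ContinuousLinearMap.proj a).comp (ContinuousLinearMap.proj k)).comp (θ x)))) x₀ := by
  have h : ∀ (k : Fin ν) (a : Fin 3), ContMDiffAt I (I.prod 𝓘(ℝ, E →L[ℝ] E →L[ℝ] ℝ)) ∞
      (fun x => TotalSpace.mk' (E →L[ℝ] E →L[ℝ] ℝ)
        (E := fun x : M => TangentSpace I x →L[ℝ] TangentSpace I x →L[ℝ] ℝ) x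
        ((((ContinuousLinearMap.proj a).comp (ContinuousLinearMap.proj k)).comp
            (θ x)).smulRight
          (((ContinuousLinearMap.proj a).comp (ContinuousLinearMap.proj k)).comp (θ x)))) x₀ := by
    intro k a
    let L : LieAlg ν →L[ℝ] ℝ := (ContinuousLinearMap.proj (R := ℝ) (φ := fun _ : Fin 3 => ℝ) a).comp
      (ContinuousLinearMap.proj (R := ℝ) (φ := fun _ : Fin ν => Fin 3 → ℝ) k)
    have hc : ContMDiffAt I 𝓘(ℝ, LieAlg ν →L[ℝ] ℝ) ∞ (fun _ : M => L) x₀ := contMDiffAt_const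
    have h := hθ.clm_comp_section hc
    exact h.smulRight_section h
  have h2 := ContMDiffAt.sum_section (I := I) (s := Finset.univ) fun (k : Fin ν) _ =>
    ContMDiffAt.const_smul_section (a := ((ε k : ℤ) : ℝ)) <|
      ContMDiffAt.sum_section (s := Finset.univ) fun a _ => h k a
  exact h2

end PullbackForm

section LeftInvariant

variable {ν : ℕ}

/-- The derivative of a smooth map into `(S³)^ν`, expressed in the left-invariant frame, depends
smoothly on the point. -/
theorem ContMDiffAt.coframe_mfderiv {E : Type*} [NormedAddCommGroup E] [NormedSpace ℝ E]
    {H : Type*} [TopologicalSpace H] {I : ModelWithCorners ℝ E H}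
    {M : Type*} [TopologicalSpace M] [ChartedSpace H M] [IsManifold I ∞ M] {s : M → S3Pow ν}
    {x : M} (hs : ContMDiffAt I (modelS3Pow ν) ∞ s x) :
    ContMDiffAt I (I.prod 𝓘(ℝ, E →L[ℝ] LieAlg ν)) ∞
      (fun y => TotalSpace.mk' (E →L[ℝ] LieAlg ν)
        (E := fun y : M => TangentSpace I y →L[ℝ] LieAlg ν) y
        (coframe (s y) ∘L mfderiv I (modelS3Pow ν) s y)) x := by
  have hι : ContMDiffAt I 𝓘(ℝ, Fin ν → ℍ[ℝ]) ∞
      (fun (y : M) (k : Fin ν) => (s y k : ℍ[ℝ])) x :=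
    contMDiffAt_pi_space.2 fun k => (contMDiff_coe_eval k _).comp x hs
  let Φ : (Fin ν → ℍ[ℝ]) → (Fin ν → ℍ[ℝ]) →L[ℝ] LieAlg ν := fun X =>
    ContinuousLinearMap.pi fun k => ContinuousLinearMap.pi fun a =>
      innerSL ℝ (X k * imQuat (Pi.single a 1)) ∘L ContinuousLinearMap.proj k
  have hΦ : ContDiff ℝ ∞ Φ := by
    rw [contDiff_clm_apply_iff]
    intro w
    refine contDiff_pi.2 fun k => contDiff_pi.2 fun a => ?_
    have h : ContDiff ℝ ∞ fun X : Fin ν → ℍ[ℝ] => X k * imQuat (Pi.single a 1) :=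
      (contDiff_apply ℝ ℍ[ℝ] k).mul contDiff_const
    exact h.inner ℝ contDiff_const
  have h := hι.mvfderiv_section.clm_comp_section (hΦ.contMDiff.contMDiffAt.comp x hι)
  refine h.congr_of_eventuallyEq ?_
  filter_upwards [(contMDiffAt_iff_contMDiffAt_nhds (n := 1) (by simp)).1
    (hs.of_le (by norm_cast))] with y hy
  refine congrArg (TotalSpace.mk' _ y) (ContinuousLinearMap.ext fun v => ?_)
  have hd : MDifferentiableAt I (modelS3Pow ν) s y := hy.mdifferentiableAt (by simp)
  funext k a
  have e : mvfderiv I (fun (y : M) (k : Fin ν) => (s y k : ℍ[ℝ])) y v k =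
      dcoe (s y) k (mfderiv I (modelS3Pow ν) s y v) := by
    have h0 : MDifferentiableAt I 𝓘(ℝ, Fin ν → ℍ[ℝ])
        (fun (y : M) (k : Fin ν) => (s y k : ℍ[ℝ])) y :=
      (contMDiffAt_pi_space.2 fun k =>
        ((contMDiff_coe_eval k _).of_le (by norm_cast)).comp y hy).mdifferentiableAt
        (n := 1) (by simp)
    have h2 := (((ContinuousLinearMap.proj (R := ℝ) (φ := fun _ : Fin ν => ℍ[ℝ])
      k).hasMFDerivAt).comp y h0.hasMFDerivAt).mfderiv
    exact (congrArg (fun A : E →L[ℝ] ℍ[ℝ] => A v) h2).symm.trans (dcoe_mfderiv hd v k).symm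
  simp only [Function.comp, Φ, ContinuousLinearMap.comp_apply, ContinuousLinearMap.coe_pi',
    ContinuousLinearMap.proj_apply, e]
  rfl

theorem contMDiff_coframe : ContMDiff (modelS3Pow ν)
    ((modelS3Pow ν).prod 𝓘(ℝ, (Fin ν → EuclideanSpace ℝ (Fin 3)) →L[ℝ] LieAlg ν)) ∞
    (fun x => TotalSpace.mk' ((Fin ν → EuclideanSpace ℝ (Fin 3)) →L[ℝ] LieAlg ν)
      (E := fun x : S3Pow ν => TangentSpace (modelS3Pow ν) x →L[ℝ] LieAlg ν) x (coframe x)) := by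
  intro x
  refine (contMDiffAt_id (x := x)).coframe_mfderiv.congr_of_eventuallyEq
    (Filter.Eventually.of_forall fun y => ?_)
  refine congrArg (TotalSpace.mk' _ y) ?_
  rw [mfderiv_id]
  rfl

theorem coframe_inverse_apply (x : S3Pow ν) (c : LieAlg ν) :
    coframe x ((coframe x).inverse c) = c :=
  (coframe_isInvertible x).self_apply_inverse c

theorem inverse_coframe_apply (x : S3Pow ν) (v : TangentSpace (modelS3Pow ν) x) :
    (coframe x).inverse (coframe x v) = v :=
  (coframe_isInvertible x).inverse_apply_self v

theorem leftInvEnd_apply (j : LieAlg ν →ₗ[ℝ] LieAlg ν) (x : S3Pow ν)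
    (v : TangentSpace (modelS3Pow ν) x) :
    leftInvEnd j x v = (coframe x).inverse (j (coframe x v)) := rfl

theorem coframe_leftInvEnd (j : LieAlg ν →ₗ[ℝ] LieAlg ν) (x : S3Pow ν)
    (v : TangentSpace (modelS3Pow ν) x) : coframe x (leftInvEnd j x v) = j (coframe x v) := by
  rw [leftInvEnd_apply, coframe_inverse_apply]

theorem smoothVect_inverse_coframe {c : S3Pow ν → LieAlg ν}
    (hc : ContMDiff (modelS3Pow ν) 𝓘(ℝ, LieAlg ν) ∞ c) :
    SmoothVect (I := modelS3Pow ν) fun x => (coframe x).inverse (c x) := fun x =>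
  (contMDiff_coframe x).inverse_coframe_apply coframe_isInvertible (hc x)

theorem SmoothVect.coframe {X : VectField (modelS3Pow ν) (S3Pow ν)} (hX : SmoothVect X) :
    ContMDiff (modelS3Pow ν) 𝓘(ℝ, LieAlg ν) ∞ fun x => coframe x (X x) := by
  intro x
  have := ContMDiffAt.clm_bundle_apply (F₂ := LieAlg ν) (E₂ := fun _ : S3Pow ν => LieAlg ν)
    (contMDiff_coframe x) (hX x)
  exact (contMDiffAt_totalSpace.1 this).2

theorem smoothEnd_leftInvEnd (j : LieAlg ν →ₗ[ℝ] LieAlg ν) : SmoothEnd (leftInvEnd j) := fun x =>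
  (contMDiff_coframe x).inverse_coframe_comp coframe_isInvertible
    ((contMDiff_coframe x).clm_comp_section (Φ := fun _ => LinearMap.toContinuousLinearMap j)
      contMDiffAt_const)

theorem smoothBilin_prodMetric (ε : Fin ν → ℤˣ) : SmoothBilin (prodMetric ε) := fun x =>
  contMDiffAt_prodInner_comp ε (contMDiff_coframe x)

end LeftInvariant

/-! ### The Maurer–Cartan equation -/

section Calculus

variable {E : Type*} [NormedAddCommGroup E] [NormedSpace ℝ E]
  {H : Type*} [TopologicalSpace H] {I : ModelWithCorners ℝ E H}
  {M : Type*} [TopologicalSpace M] [ChartedSpace H M]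
  {F F' F'' : Type*} [NormedAddCommGroup F] [NormedSpace ℝ F]
  [NormedAddCommGroup F'] [NormedSpace ℝ F'] [NormedAddCommGroup F''] [NormedSpace ℝ F'']

theorem mvfderiv_clm_comp (L : F →L[ℝ] F') {f : M → F} {x : M}
    (hf : MDifferentiableAt I 𝓘(ℝ, F) f x) (v : TangentSpace I x) :
    mvfderiv I (fun y => L (f y)) x v = L (mvfderiv I f x v) := by
  have h2 := L.hasFDerivAt.hasMFDerivAt.comp x hf.hasMFDerivAt
  exact congrArg (fun A : E →L[ℝ] F' => A v) h2.mfderiv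

theorem mvfderiv_bilin (B : F →L[ℝ] F' →L[ℝ] F'') {f : M → F} {g : M → F'} {x : M}
    (hf : MDifferentiableAt I 𝓘(ℝ, F) f x) (hg : MDifferentiableAt I 𝓘(ℝ, F') g x)
    (v : TangentSpace I x) :
    mvfderiv I (fun y => B (f y) (g y)) x v =
      B (mvfderiv I f x v) (g x) + B (f x) (mvfderiv I g x v) := by
  have hp := hf.prodMk_space hg
  have h1 := (B.isBoundedBilinearMap.hasFDerivAt (f x, g x)).hasMFDerivAt
  have h2 := h1.comp x hp.hasMFDerivAt
  have h3 := congrArg (fun A : E →L[ℝ] F'' => A v) h2.mfderiv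
  have e1 := mvfderiv_clm_comp (ContinuousLinearMap.fst ℝ F F') hp v
  have e2 := mvfderiv_clm_comp (ContinuousLinearMap.snd ℝ F F') hp v
  refine h3.trans ?_
  change B (f x) (ContinuousLinearMap.snd ℝ F F' (mvfderiv I (fun y => (f y, g y)) x v)) +
    B (ContinuousLinearMap.fst ℝ F F' (mvfderiv I (fun y => (f y, g y)) x v)) (g x) = _
  rw [← e1, ← e2, add_comm]
  rfl

theorem ContMDiff.mvfderiv_vect [IsManifold I ∞ M] {f : M → F} (hf : ContMDiff I 𝓘(ℝ, F) ∞ f)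
    {X : VectField I M} (hX : SmoothVect X) :
    ContMDiff I 𝓘(ℝ, F) ∞ fun x => mvfderiv I f x (X x) := by
  intro x
  have := ContMDiffAt.clm_bundle_apply (F₂ := F) (E₂ := fun _ : M => F)
    (hf x).mvfderiv_section (hX x)
  exact (contMDiffAt_totalSpace.1 this).2

end Calculus

section LieBracket

variable {ν : ℕ}

/-- The Lie bracket of the Lie algebra of `(S³)^ν`, twice the cross product on each factor. -/
def lieBr (c d : LieAlg ν) : LieAlg ν := fun k =>
  ![2 * (c k 1 * d k 2 - c k 2 * d k 1), 2 * (c k 2 * d k 0 - c k 0 * d k 2),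
    2 * (c k 0 * d k 1 - c k 1 * d k 0)]

theorem imQuat_lieBr (c d : LieAlg ν) (k : Fin ν) :
    imQuat (lieBr c d k) = imQuat (c k) * imQuat (d k) - imQuat (d k) * imQuat (c k) := by
  ext <;> simp [imQuat_re, imQuat_imI, imQuat_imJ, imQuat_imK, lieBr] <;> ring

/-- The Lie bracket as a continuous bilinear map. -/
def lieBrL : LieAlg ν →L[ℝ] LieAlg ν →L[ℝ] LieAlg ν :=
  LinearMap.toContinuousBilinearMap (LinearMap.mk₂ ℝ lieBr
    (fun a b c => by ext k i; fin_cases i <;> simp [lieBr] <;> ring)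
    (fun r a c => by ext k i; fin_cases i <;> simp [lieBr] <;> ring)
    (fun a b c => by ext k i; fin_cases i <;> simp [lieBr] <;> ring)
    (fun r a c => by ext k i; fin_cases i <;> simp [lieBr] <;> ring))

theorem lieBrL_apply (c d : LieAlg ν) : lieBrL c d = lieBr c d := rfl

/-- `imQuat` as a continuous linear map. -/
def imQuatL : (Fin 3 → ℝ) →L[ℝ] ℍ[ℝ] := LinearMap.toContinuousLinearMap
  { toFun := imQuat
    map_add' := fun c d => by
      ext <;> simp [imQuat_re, imQuat_imI, imQuat_imJ, imQuat_imK]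
    map_smul' := fun r d => by
      ext <;> simp [imQuat_re, imQuat_imI, imQuat_imJ, imQuat_imK] }

theorem imQuatL_apply (c : Fin 3 → ℝ) : imQuatL c = imQuat c := rfl

/-- The inner product of the Lie algebra as a continuous bilinear map. -/
def prodInnerL (ε : Fin ν → ℤˣ) : LieAlg ν →L[ℝ] LieAlg ν →L[ℝ] ℝ :=
  LinearMap.toContinuousBilinearMap (LinearMap.mk₂ ℝ (prodInner ε)
    (fun a b c => by
      simp only [prodInner, Pi.add_apply, add_mul, mul_add, Finset.sum_add_distrib])
    (fun r a c => by
      simp only [prodInner, Pi.smul_apply, smul_eq_mul, Finset.mul_sum]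
      exact Finset.sum_congr rfl fun k _ => Finset.sum_congr rfl fun a _ => by ring)
    (fun a b c => by
      simp only [prodInner, Pi.add_apply, mul_add, Finset.sum_add_distrib])
    (fun r a c => by
      simp only [prodInner, Pi.smul_apply, smul_eq_mul, Finset.mul_sum]
      exact Finset.sum_congr rfl fun k _ => Finset.sum_congr rfl fun a _ => by ring))

theorem prodInnerL_apply (ε : Fin ν → ℤˣ) (c d : LieAlg ν) : prodInnerL ε c d = prodInner ε c d :=
  rfl

/-- The inner products of `𝔤` are `ad`-invariant. -/
theorem prodInner_lieBr (ε : Fin ν → ℤˣ) (a b c : LieAlg ν) :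
    prodInner ε (lieBr a b) c + prodInner ε b (lieBr a c) = 0 := by
  rw [prodInner, prodInner, ← Finset.sum_add_distrib]
  refine Finset.sum_eq_zero fun k _ => ?_
  simp [Fin.sum_univ_three, lieBr]
  ring

/-- The Maurer–Cartan equation, obtained by applying `mvfderiv_mlieBracket` to the inclusion of each
factor into the quaternions. -/
theorem coframe_mlieBracket {X Y : VectField (modelS3Pow ν) (S3Pow ν)} (hX : SmoothVect X)
    (hY : SmoothVect Y) (x : S3Pow ν) :
    coframe x (VectorField.mlieBracket (modelS3Pow ν) X Y x) =
      mvfderiv (modelS3Pow ν) (fun y => coframe y (Y y)) x (X x)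
        - mvfderiv (modelS3Pow ν) (fun y => coframe y (X y)) x (Y x)
        + lieBr (coframe x (X x)) (coframe x (Y x)) := by
  rw [coframe_eq_iff]
  intro k
  rw [dcoe, ← mvfderiv_mlieBracket (contMDiff_coe_eval k) hX hY x]
  have key : ∀ {X Y : VectField (modelS3Pow ν) (S3Pow ν)}, SmoothVect X → SmoothVect Y →
      mvfderiv (modelS3Pow ν) (fun y => dcoe y k (Y y)) x (X x) =
        (x k * imQuat (coframe x (X x) k)) * imQuat (coframe x (Y x) k) +
        x k * imQuatL (mvfderiv (modelS3Pow ν) (fun y => coframe y (Y y)) x (X x) k) := by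
    intro X Y hX hY
    have e : (fun y : S3Pow ν => dcoe y k (Y y)) = fun y =>
        ContinuousLinearMap.mul ℝ ℍ[ℝ] (y k : ℍ[ℝ])
        ((imQuatL ∘L ContinuousLinearMap.proj (R := ℝ) (φ := fun _ : Fin ν => Fin 3 → ℝ) k)
          (coframe y (Y y))) := by
      funext y
      rw [dcoe_eq]; rfl
    have hd := (hY.coframe x).mdifferentiableAt (by simp)
    have hd' := (contMDiff_coe_eval k x).mdifferentiableAt (n := ∞) (by simp)
    have hd2 : MDifferentiableAt (modelS3Pow ν) 𝓘(ℝ, ℍ[ℝ]) (fun y : S3Pow ν =>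
        (imQuatL ∘L ContinuousLinearMap.proj (R := ℝ) (φ := fun _ : Fin ν => Fin 3 → ℝ) k)
          (coframe y (Y y))) x :=
      ((ContinuousLinearMap.contMDiff _).contMDiffAt.mdifferentiableAt (n := ∞) (by simp)).comp x hd
    rw [e, mvfderiv_bilin _ hd' hd2, mvfderiv_clm_comp _ hd]
    change dcoe x k (X x) * _ + _ = _
    rw [dcoe_eq]
    rfl
  rw [key hX hY, key hY hX]
  have e2 : ∀ a b c : LieAlg ν,
      imQuat ((a - b + c) k) = imQuatL (a k) - imQuatL (b k) + imQuat (c k) := by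
    intro a b c
    rw [← imQuatL_apply, ← imQuatL_apply, ← map_sub, ← map_add]
    rfl
  rw [e2, imQuat_lieBr]
  noncomm_ring

end LieBracket

/-! ### The metrics `⊕ ε k g_{S³}` and their Ricci tensor -/

section Metric

variable {ν : ℕ}

theorem units_mul_self (s : ℤˣ) : ((s : ℤ) : ℝ) * ((s : ℤ) : ℝ) = 1 := by
  rcases Int.units_eq_one_or s with rfl | rfl <;> simp

theorem prodInner_comm (ε : Fin ν → ℤˣ) (c d : LieAlg ν) : prodInner ε c d = prodInner ε d c := by
  simp only [prodInner, mul_comm]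

theorem prodInner_one_pos {c : LieAlg ν} (hc : c ≠ 0) : 0 < prodInner (fun _ => 1) c c := by
  obtain ⟨k, hk⟩ := Function.ne_iff.1 hc
  obtain ⟨a, ha⟩ := Function.ne_iff.1 hk
  have h : ∀ k, 0 ≤ ∑ a, c k a * c k a := fun k => Finset.sum_nonneg fun a _ => mul_self_nonneg _
  simp only [prodInner, Units.val_one, Int.cast_one, one_mul]
  refine Finset.sum_pos' (fun k _ => h k) ⟨k, Finset.mem_univ k, ?_⟩
  exact Finset.sum_pos' (fun a _ => mul_self_nonneg _) ⟨a, Finset.mem_univ a,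
    mul_self_pos.2 ha⟩

theorem prodInner_nondegenerate (ε : Fin ν → ℤˣ) {c : LieAlg ν}
    (h : ∀ d, prodInner ε c d = 0) : c = 0 := by
  by_contra hc
  have := prodInner_one_pos hc
  have h1 := h fun k a => ((ε k : ℤ) : ℝ) * c k a
  simp only [prodInner, Units.val_one, Int.cast_one, one_mul, Finset.mul_sum] at h1 this
  refine this.ne' ?_
  rw [← h1]
  refine Finset.sum_congr rfl fun k _ => Finset.sum_congr rfl fun a _ => ?_
  linear_combination (- c k a * c k a) * units_mul_self (ε k)

theorem isPseudoRiemannianMetric_prodMetric (ε : Fin ν → ℤˣ) :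
    IsPseudoRiemannianMetric (prodMetric ε) where
  smooth := smoothBilin_prodMetric ε
  symm x v w := by rw [prodMetric_apply, prodMetric_apply, prodInner_comm]
  nondegenerate x v h := by
    refine coframe_injective x ?_
    rw [map_zero]
    refine prodInner_nondegenerate ε fun d => ?_
    rw [← coframe_inverse_apply x d, ← prodMetric_apply]
    exact h _

theorem isRiemannianMetric_prodMetric :
    IsRiemannianMetric (prodMetric (ν := ν) fun _ => 1) where
  toIsPseudoRiemannianMetric := isPseudoRiemannianMetric_prodMetric _
  pos x v hv := by
    rw [prodMetric_apply]
    refine prodInner_one_pos fun h => hv (coframe_injective x ?_)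
    rw [h, map_zero]

theorem contMDiff_mul_left_S3Pow (a : S3Pow ν) :
    ContMDiff (modelS3Pow ν) (modelS3Pow ν) ∞ fun y : S3Pow ν => a * y :=
  contMDiff_mul_S3Pow contMDiff_const contMDiff_id

theorem contMDiff_mul_right_S3Pow (a : S3Pow ν) :
    ContMDiff (modelS3Pow ν) (modelS3Pow ν) ∞ fun y : S3Pow ν => y * a :=
  contMDiff_mul_S3Pow contMDiff_id contMDiff_const

theorem dcoe_mul_left (a x : S3Pow ν) (v : TangentSpace (modelS3Pow ν) x) (k : Fin ν) :
    dcoe (a * x) k (mfderiv (modelS3Pow ν) (modelS3Pow ν) (fun y => a * y) x v) =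
      (a k : ℍ[ℝ]) * dcoe x k v := by
  rw [dcoe_mfderiv (f := fun y => a * y)
    ((contMDiff_mul_left_S3Pow a x).mdifferentiableAt (by simp))]
  exact mvfderiv_clm_comp (ContinuousLinearMap.mul ℝ ℍ[ℝ] (a k : ℍ[ℝ]))
    ((contMDiff_coe_eval k x).mdifferentiableAt (by simp)) v

theorem dcoe_mul_right (a x : S3Pow ν) (v : TangentSpace (modelS3Pow ν) x) (k : Fin ν) :
    dcoe (x * a) k (mfderiv (modelS3Pow ν) (modelS3Pow ν) (fun y => y * a) x v) =
      dcoe x k v * (a k : ℍ[ℝ]) := by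
  rw [dcoe_mfderiv (f := fun y => y * a)
    ((contMDiff_mul_right_S3Pow a x).mdifferentiableAt (by simp))]
  exact mvfderiv_clm_comp ((ContinuousLinearMap.mul ℝ ℍ[ℝ]).flip (a k : ℍ[ℝ]))
    ((contMDiff_coe_eval k x).mdifferentiableAt (by simp)) v

theorem coframe_mul_left (a x : S3Pow ν) (v : TangentSpace (modelS3Pow ν) x) :
    coframe (a * x) (mfderiv (modelS3Pow ν) (modelS3Pow ν) (fun y => a * y) x v) =
      coframe x v := by
  rw [coframe_eq_iff]
  intro k
  rw [dcoe_mul_left, dcoe_eq, ← mul_assoc]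
  rfl

theorem prodMetric_mul_right (ε : Fin ν → ℤˣ) (a x : S3Pow ν)
    (v w : TangentSpace (modelS3Pow ν) x) :
    prodMetric ε (x * a) (mfderiv (modelS3Pow ν) (modelS3Pow ν) (fun y => y * a) x v)
      (mfderiv (modelS3Pow ν) (modelS3Pow ν) (fun y => y * a) x w) = prodMetric ε x v w := by
  rw [prodMetric_eq_dcoe, prodMetric_eq_dcoe]
  refine Finset.sum_congr rfl fun k _ => ?_
  rw [dcoe_mul_right, dcoe_mul_right]
  congr 1
  have h : ∀ p q z : ℍ[ℝ], inner ℝ (p * z) (q * z) = (z * star z).re * inner ℝ p q := by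
    intro p q z
    simp [Quaternion.inner_def]
    ring
  rw [h, self_mul_star_S3]
  simp

theorem isBiInvariant_prodMetric (ε : Fin ν → ℤˣ) : IsBiInvariant (prodMetric ε) := by
  refine fun a x v w => ⟨?_, prodMetric_mul_right ε a x v w⟩
  rw [prodMetric_apply, prodMetric_apply, coframe_mul_left, coframe_mul_left]

end Metric

section Connection

variable {ν : ℕ}

theorem mdifferentiableAt_coframe {σ : VectField (modelS3Pow ν) (S3Pow ν)} {x : S3Pow ν}
    (h : MDifferentiableAt (modelS3Pow ν)
      ((modelS3Pow ν).prod 𝓘(ℝ, Fin ν → EuclideanSpace ℝ (Fin 3)))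
      (fun x => TotalSpace.mk' (Fin ν → EuclideanSpace ℝ (Fin 3)) x (σ x)) x) :
    MDifferentiableAt (modelS3Pow ν) 𝓘(ℝ, LieAlg ν) (fun y => coframe y (σ y)) x := by
  have := MDifferentiableAt.clm_bundle_apply (F₂ := LieAlg ν) (E₂ := fun _ : S3Pow ν => LieAlg ν)
    ((contMDiff_coframe x).mdifferentiableAt (by simp)) h
  exact ((mdifferentiableAt_totalSpace _ _).1 this).2

/-- The operator `∇_v Y = dY(v) + [v, Y] / 2` in the left-invariant trivialization. -/
def lcFun (ν : ℕ) (Y : VectField (modelS3Pow ν) (S3Pow ν)) (x : S3Pow ν) :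
    TangentSpace (modelS3Pow ν) x →L[ℝ] TangentSpace (modelS3Pow ν) x :=
  (coframe x).inverse ∘L
    (mvfderiv (modelS3Pow ν) (fun y => coframe y (Y y)) x +
      ((1 / 2 : ℝ) • lieBrL.flip (coframe x (Y x))) ∘L coframe x)

theorem coframe_lcFun (Y : VectField (modelS3Pow ν) (S3Pow ν)) (x : S3Pow ν)
    (v : TangentSpace (modelS3Pow ν) x) :
    coframe x (lcFun ν Y x v) = mvfderiv (modelS3Pow ν) (fun y => coframe y (Y y)) x v +
      (1 / 2 : ℝ) • lieBrL (coframe x v) (coframe x (Y x)) :=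
  coframe_inverse_apply x _

/-- The Levi-Civita connection of the bi-invariant metrics. -/
def lcConnection (ν : ℕ) : CovariantDerivative (modelS3Pow ν)
    (Fin ν → EuclideanSpace ℝ (Fin 3)) (TangentSpace (modelS3Pow ν) : S3Pow ν → Type _) where
  toFun := lcFun ν
  isCovariantDerivativeOnUniv := by
    constructor
    · intro σ σ' x hσ hσ' _
      refine ContinuousLinearMap.ext fun v => coframe_injective x ?_
      have e : (fun y => coframe y ((σ + σ') y)) =
          (fun y => coframe y (σ y)) + fun y => coframe y (σ' y) := by
        funext y; exact map_add _ _ _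
      rw [add_apply, map_add, coframe_lcFun, coframe_lcFun, coframe_lcFun, e,
        mvfderiv_add (mdifferentiableAt_coframe hσ) (mdifferentiableAt_coframe hσ'), add_apply,
        Pi.add_apply, map_add, map_add]
      module
    · intro σ g x hσ hg _
      refine ContinuousLinearMap.ext fun v => coframe_injective x ?_
      have e : (fun y => coframe y ((g • σ) y)) = g • fun y => coframe y (σ y) := by
        funext y; exact (coframe y).map_smul (g y) (σ y)
      rw [add_apply, map_add, coframe_lcFun, e, mvfderiv_smul hg (mdifferentiableAt_coframe hσ),
        smul_apply, map_smul, coframe_lcFun, ContinuousLinearMap.smulRight_apply, map_smul,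
        Pi.smul_apply', map_smul, map_smul]
      simp only [add_apply, smul_apply, ContinuousLinearMap.smulRight_apply]
      module

theorem coframe_lcConnection (Y : VectField (modelS3Pow ν) (S3Pow ν)) (x : S3Pow ν)
    (v : TangentSpace (modelS3Pow ν) x) :
    coframe x (lcConnection ν Y x v) = mvfderiv (modelS3Pow ν) (fun y => coframe y (Y y)) x v +
      (1 / 2 : ℝ) • lieBr (coframe x v) (coframe x (Y x)) :=
  coframe_inverse_apply x _

theorem isLeviCivita_lcConnection (ε : Fin ν → ℤˣ) :
    IsLeviCivita (prodMetric ε) (lcConnection ν) where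
  smooth := by
    refine ⟨⟨?_⟩⟩
    intro Y hY x _
    have hY : SmoothVect Y := by
      have : (∞ : WithTop ℕ∞) + 1 = ∞ := by simp
      rw [this, contMDiffOn_univ] at hY
      exact hY
    refine ContMDiffAt.contMDiffWithinAt ?_
    refine (contMDiff_coframe x).inverse_coframe_comp coframe_isInvertible ?_
    refine ContMDiffAt.add_section (hY.coframe x).mvfderiv_section ?_
    have hc : ContMDiffAt (modelS3Pow ν) 𝓘(ℝ, LieAlg ν →L[ℝ] LieAlg ν) ∞
        (fun y => ((1 / 2 : ℝ) • lieBrL.flip) (coframe y (Y y))) x :=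
      contMDiffAt_const.clm_apply (hY.coframe x)
    exact (contMDiff_coframe x).clm_comp_section hc
  torsion_free := by
    intro X Y hX hY x
    apply coframe_injective x
    rw [map_sub, coframe_lcConnection, coframe_lcConnection, coframe_mlieBracket hX hY]
    have : lieBr (coframe x (Y x)) (coframe x (X x)) =
        -lieBr (coframe x (X x)) (coframe x (Y x)) := by
      ext k a; fin_cases a <;> simp [lieBr] <;> ring
    rw [this]
    module
  metric := by
    intro Y Z hY hZ x v
    have e : (fun y => prodMetric ε y (Y y) (Z y)) =
        fun y => prodInnerL ε (coframe y (Y y)) (coframe y (Z y)) := by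
      funext y; rw [prodMetric_apply]; rfl
    rw [e, mvfderiv_bilin _ ((hY.coframe x).mdifferentiableAt (by simp))
      ((hZ.coframe x).mdifferentiableAt (by simp)), prodMetric_apply, prodMetric_apply,
      coframe_lcConnection, coframe_lcConnection, ← prodInnerL_apply, ← prodInnerL_apply,
      map_add, map_add, map_smul, map_smul, add_apply,
      smul_apply]
    simp only [prodInnerL_apply]
    have := prodInner_lieBr ε (coframe x v) (coframe x (Y x)) (coframe x (Z x))
    simp only [smul_eq_mul]
    linear_combination (-1/2 : ℝ) * this

/-- The operator `c ↦ -[[c, a], b] / 4`: the curvature `X ↦ R(X, Y)Z` where `Y`, `Z` have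
components `a`, `b`. -/
def curvOp (a b : LieAlg ν) : LieAlg ν →ₗ[ℝ] LieAlg ν :=
  (-(1 / 4 : ℝ)) • ((lieBrL.flip b) ∘L (lieBrL.flip a)).toLinearMap

theorem curvOp_apply (a b c : LieAlg ν) : curvOp a b c = (-(1 / 4 : ℝ)) • lieBr (lieBr c a) b := rfl

/-- This trace is minus a quarter of the Killing form. It involves no `ε`: all the metrics have
the same connection, hence the same Ricci tensor. -/
theorem trace_curvOp (a b : LieAlg ν) :
    LinearMap.trace ℝ (LieAlg ν) (curvOp a b) = 2 * prodInner (fun _ => 1) a b := by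
  rw [LinearMap.trace_eq_matrix_trace ℝ (Pi.basis fun _ : Fin ν => Pi.basisFun ℝ (Fin 3)),
    Matrix.trace, Fintype.sum_sigma, prodInner, Finset.mul_sum]
  refine Finset.sum_congr rfl fun k _ => ?_
  simp [LinearMap.toMatrix_apply, Fin.sum_univ_three, curvOp_apply, lieBr, Pi.basis_apply]
  ring

/-- The curvature in the left-invariant trivialization. Here `a`, `b`, `c` are the components of
`X`, `Y`, `Z`, `p` and `q` the derivatives of `b` along `X` and of `a` along `Y`, `w` and `u`
those of `c` along `X` and `Y`, and `m`, `n` the second derivatives of `c`. All derivatives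
cancel, and the rest follows from the Jacobi identity. -/
theorem curvOp_eq (a b c p q u w m n : LieAlg ν) :
    (m + (1 / 2 : ℝ) • (lieBr p c + lieBr b w)
        + (1 / 2 : ℝ) • lieBr a (u + (1 / 2 : ℝ) • lieBr b c))
      - (n + (1 / 2 : ℝ) • (lieBr q c + lieBr a u)
        + (1 / 2 : ℝ) • lieBr b (w + (1 / 2 : ℝ) • lieBr a c))
      - (m - n + (1 / 2 : ℝ) • lieBr (p - q + lieBr a b) c) = curvOp b c a := by
  ext k i
  fin_cases i <;> simp [lieBr, curvOp_apply] <;> ring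

theorem coframe_curvatureOf {X Y Z : VectField (modelS3Pow ν) (S3Pow ν)} (hX : SmoothVect X)
    (hY : SmoothVect Y) (hZ : SmoothVect Z) (x : S3Pow ν) :
    coframe x (curvatureOf (lcConnection ν) X Y Z x) =
      curvOp (coframe x (Y x)) (coframe x (Z x)) (coframe x (X x)) := by
  -- the derivative of `∇_Y Z` along `X`
  have dd : ∀ {X Y : VectField (modelS3Pow ν) (S3Pow ν)}, SmoothVect X → SmoothVect Y →
      mvfderiv (modelS3Pow ν) (fun y => coframe y (lcConnection ν Z y (Y y))) x (X x) =
      mvfderiv (modelS3Pow ν)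
        (fun y => mvfderiv (modelS3Pow ν) (fun y => coframe y (Z y)) y (Y y)) x (X x)
      + (1 / 2 : ℝ) •
        (lieBr (mvfderiv (modelS3Pow ν) (fun y => coframe y (Y y)) x (X x)) (coframe x (Z x))
        + lieBr (coframe x (Y x))
          (mvfderiv (modelS3Pow ν) (fun y => coframe y (Z y)) x (X x))) := by
    intro X Y hX hY
    have dY := ((hY.coframe x).mdifferentiableAt (n := ∞) (by simp))
    have dZ := ((hZ.coframe x).mdifferentiableAt (n := ∞) (by simp))
    have e : (fun y => coframe y (lcConnection ν Z y (Y y))) =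
        (fun y => mvfderiv (modelS3Pow ν) (fun y => coframe y (Z y)) y (Y y)) +
          (fun y => ((1 / 2 : ℝ) • lieBrL) (coframe y (Y y)) (coframe y (Z y))) := by
      funext y; rw [coframe_lcConnection]; rfl
    have d1 := ((hZ.coframe.mvfderiv_vect hY) x).mdifferentiableAt (n := ∞) (by simp)
    have d2 : MDifferentiableAt (modelS3Pow ν) 𝓘(ℝ, LieAlg ν)
        (fun y => ((1 / 2 : ℝ) • lieBrL) (coframe y (Y y)) (coframe y (Z y))) x :=
      ((contMDiffAt_const.clm_apply (hY.coframe x)).clm_apply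
        (hZ.coframe x)).mdifferentiableAt (n := ∞) (by simp)
    rw [e, mvfderiv_add d1 d2, add_apply, mvfderiv_bilin _ dY dZ]
    simp only [smul_apply, lieBrL_apply]
    module
  have hL := mvfderiv_mlieBracket hZ.coframe hX hY x
  rw [curvatureOf, map_sub, map_sub]
  simp only [coframe_lcConnection _ x]
  rw [dd hX hY, dd hY hX, coframe_mlieBracket hX hY, ← hL]
  exact curvOp_eq _ _ _ _ _ _ _ _ _

theorem hasRicci_prodMetric (ε : Fin ν → ℤˣ) :
    HasRicci (prodMetric ε) (fun x => (2 : ℝ) • prodMetric (fun _ => 1) x) := by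
  refine ⟨lcConnection ν, isLeviCivita_lcConnection ε, fun Y Z hY hZ x => ?_⟩
  obtain ⟨e, he⟩ := coframe_isInvertible x
  refine ⟨e.symm.toLinearEquiv.conj (curvOp (coframe x (Y x)) (coframe x (Z x))), ?_, ?_⟩
  · intro X hX
    apply coframe_injective x
    rw [coframe_curvatureOf hX hY hZ, ← he]
    simp [LinearEquiv.conj_apply]
  · rw [LinearMap.trace_conj', trace_curvOp, ← prodMetric_apply]
    rfl

theorem isEinstein_prodMetric {ε : Fin ν → ℤˣ} {s : ℤˣ} (h : ∀ k, ε k = s) :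
    IsEinstein (prodMetric ε) (2 * ((s : ℤ) : ℝ)) := by
  refine ⟨isPseudoRiemannianMetric_prodMetric ε, ?_⟩
  have e : (fun x => (2 * ((s : ℤ) : ℝ)) • prodMetric ε x) =
      fun x => (2 : ℝ) • prodMetric (ν := ν) (fun _ => 1) x := by
    funext x
    ext v w
    change (2 * ((s : ℤ) : ℝ)) • prodMetric ε x v w = (2 : ℝ) • prodMetric (fun _ => 1) x v w
    rw [prodMetric_apply, prodMetric_apply]
    simp only [prodInner, h, ← Finset.mul_sum, smul_eq_mul, Units.val_one, Int.cast_one, one_mul]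
    linear_combination (2 * ∑ k, ∑ a, coframe x v k a * coframe x w k a) * units_mul_self s
  rw [e]
  exact hasRicci_prodMetric ε

end Connection

/-! ### The exponential map and closed subgroups -/

section Exponential

variable {ν : ℕ}

/-- The inclusion of `(S³)^ν` into `ℍ^ν`. -/
def toQuat (x : S3Pow ν) : Fin ν → ℍ[ℝ] := fun k => x k

theorem dist_eq_norm_toQuat (x y : S3Pow ν) : dist x y = ‖toQuat x - toQuat y‖ := by
  rw [← dist_eq_norm]; rfl

theorem dist_mul_mul_S3Pow (a b c d : S3Pow ν) : dist (a * b) (c * d) ≤ dist a c + dist b d := by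
  refine (dist_pi_le_iff (by positivity)).2 fun k => ?_
  refine le_trans ?_ (add_le_add (dist_le_pi_dist a c k) (dist_le_pi_dist b d k))
  rw [Subtype.dist_eq, Subtype.dist_eq, Subtype.dist_eq, dist_eq_norm, dist_eq_norm, dist_eq_norm]
  have hb : ‖(b k : ℍ[ℝ])‖ = 1 := mem_sphere_zero_iff_norm.1 (b k).2
  have hc : ‖(c k : ℍ[ℝ])‖ = 1 := mem_sphere_zero_iff_norm.1 (c k).2
  have e : (((a * b) k : S3) : ℍ[ℝ]) - ((c * d) k : S3) =
      ((a k : ℍ[ℝ]) - c k) * b k + c k * ((b k : ℍ[ℝ]) - d k) := by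
    change (a k : ℍ[ℝ]) * b k - c k * d k = _
    noncomm_ring
  rw [e]
  refine (norm_add_le _ _).trans_eq ?_
  rw [norm_mul, norm_mul, hb, hc, mul_one, one_mul]

theorem dist_pow_pow_S3Pow (a b : S3Pow ν) (n : ℕ) : dist (a ^ n) (b ^ n) ≤ n * dist a b := by
  induction n with
  | zero => simp
  | succ n ih =>
    rw [pow_succ, pow_succ]
    refine (dist_mul_mul_S3Pow _ _ _ _).trans ?_
    push_cast
    linarith

theorem expS3Pow_zero : expS3Pow (0 : LieAlg ν) = 1 := by
  funext k
  apply Subtype.ext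
  change NormedSpace.exp (imQuatL 0) = 1
  rw [map_zero, NormedSpace.exp_zero]

theorem expS3Pow_add_smul (s t : ℝ) (c : LieAlg ν) :
    expS3Pow ((s + t) • c) = expS3Pow (s • c) * expS3Pow (t • c) := by
  funext k
  apply Subtype.ext
  change NormedSpace.exp (imQuatL ((s + t) • c k)) =
    NormedSpace.exp (imQuatL (s • c k)) * NormedSpace.exp (imQuatL (t • c k))
  let _ : NormedAlgebra ℚ ℍ[ℝ] := NormedAlgebra.restrictScalars ℚ ℝ ℍ[ℝ]
  rw [add_smul, map_add, NormedSpace.exp_add_of_commute]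
  rw [map_smul, map_smul]
  exact ((Commute.refl _).smul_left _).smul_right _

theorem expS3Pow_neg (c : LieAlg ν) : expS3Pow (-c) = (expS3Pow c)⁻¹ := by
  have h := expS3Pow_add_smul (-1) 1 c
  rw [neg_add_cancel, zero_smul, expS3Pow_zero, one_smul, neg_one_smul] at h
  exact eq_inv_of_mul_eq_one_left h.symm

theorem expS3Pow_nsmul (n : ℕ) (c : LieAlg ν) : expS3Pow ((n : ℝ) • c) = expS3Pow c ^ n := by
  induction n with
  | zero => simp [expS3Pow_zero]
  | succ n ih =>
    rw [pow_succ, ← ih, Nat.cast_succ, expS3Pow_add_smul, one_smul]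

theorem contDiff_exp_quaternion : ContDiff ℝ ∞ (NormedSpace.exp : ℍ[ℝ] → ℍ[ℝ]) :=
  contDiff_iff_contDiffAt.2 fun x => (NormedSpace.exp_analytic (𝕂 := ℝ) x).contDiffAt

theorem contDiff_toQuat_expS3Pow : ContDiff ℝ ∞ fun c : LieAlg ν => toQuat (expS3Pow c) :=
  contDiff_pi.2 fun k => contDiff_exp_quaternion.comp
    (imQuatL.contDiff.comp (contDiff_apply ℝ (Fin 3 → ℝ) k))

theorem contMDiff_expS3Pow : ContMDiff 𝓘(ℝ, LieAlg ν) (modelS3Pow ν) ∞ (expS3Pow (ν := ν)) :=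
  contMDiff_toS3Pow fun k => (contDiff_pi.1 contDiff_toQuat_expS3Pow k).contMDiff

theorem hasDerivAt_toQuat_exp (c : LieAlg ν) :
    HasDerivAt (fun t : ℝ => toQuat (expS3Pow (t • c))) (fun k => imQuat (c k)) 0 := by
  refine hasDerivAt_pi.2 fun k => ?_
  have h := hasDerivAt_exp_smul_const (𝕂 := ℝ) (imQuat (c k)) (0 : ℝ)
  simp only [zero_smul, NormedSpace.exp_zero, one_mul] at h
  refine h.congr_of_eventuallyEq (Filter.Eventually.of_forall fun t => ?_)
  change NormedSpace.exp (imQuatL (t • c k)) = _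
  rw [map_smul]; rfl

end Exponential

section ClosedSubgroup

variable {ν : ℕ} {H : Subgroup (S3Pow ν)}

/-- If elements `h n` of a closed subgroup approach `1` tangentially to `c`, then the
one-parameter subgroup of `c` lies in the subgroup. -/
theorem exp_mem_of_tendsto (hH : IsClosed (H : Set (S3Pow ν))) {h : ℕ → S3Pow ν} {t : ℕ → ℝ}
    {c : LieAlg ν} (hh : ∀ n, h n ∈ H) (ht : ∀ n, 0 < t n) (ht0 : Filter.Tendsto t .atTop (𝓝 0))
    (hd : Filter.Tendsto (fun n => dist (h n) (expS3Pow (t n • c)) / t n) .atTop (𝓝 0)) (s : ℝ) :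
    expS3Pow (s • c) ∈ H := by
  have main : ∀ s : ℝ, 0 ≤ s → expS3Pow (s • c) ∈ H := by
    intro s hs
    -- the powers `h n ^ k n` approximate `exp (s c)`
    let k : ℕ → ℕ := fun n => ⌊s / t n⌋₊
    have hk1 : ∀ n, k n * t n ≤ s := fun n => by
      have := Nat.floor_le (div_nonneg hs (ht n).le)
      calc (k n : ℝ) * t n ≤ s / t n * t n := mul_le_mul_of_nonneg_right this (ht n).le
        _ = s := div_mul_cancel₀ _ (ht n).ne'
    have hk2 : ∀ n, s - t n ≤ k n * t n := fun n => by
      have := (Nat.lt_floor_add_one (s / t n)).le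
      have h2 : s ≤ (k n + 1) * t n := by
        calc s = s / t n * t n := (div_mul_cancel₀ _ (ht n).ne').symm
          _ ≤ _ := mul_le_mul_of_nonneg_right this (ht n).le
      linarith
    have hkt : Filter.Tendsto (fun n => k n * t n) .atTop (𝓝 s) := by
      refine tendsto_of_tendsto_of_tendsto_of_le_of_le ?_ tendsto_const_nhds hk2 hk1
      simpa using tendsto_const_nhds.sub ht0
    have he : Filter.Tendsto (fun n => expS3Pow ((k n * t n) • c)) .atTop (𝓝 (expS3Pow (s • c))) :=
      ((contMDiff_expS3Pow.continuous.tendsto _).comp (hkt.smul_const c))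
    have hdist : Filter.Tendsto (fun n => dist (h n ^ k n) (expS3Pow ((k n * t n) • c)))
        .atTop (𝓝 0) := by
      refine squeeze_zero (fun _ => dist_nonneg)
        (g := fun n => s * (dist (h n) (expS3Pow (t n • c)) / t n)) ?_ ?_
      · intro n
        rw [mul_smul, expS3Pow_nsmul]
        refine (dist_pow_pow_S3Pow _ _ _).trans ?_
        rw [← mul_div_assoc, le_div_iff₀ (ht n)]
        calc (k n : ℝ) * dist (h n) (expS3Pow (t n • c)) * t n
            = (k n * t n) * dist (h n) (expS3Pow (t n • c)) := by ring
          _ ≤ s * _ := mul_le_mul_of_nonneg_right (hk1 n) dist_nonneg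
      · simpa using hd.const_mul s
    refine hH.mem_of_tendsto ((tendsto_iff_of_dist hdist).2 he) ?_
    exact Filter.Eventually.of_forall fun n => H.pow_mem (hh n) _
  rcases le_total 0 s with hs | hs
  · exact main s hs
  · have := H.inv_mem (main (-s) (by linarith))
    rwa [← expS3Pow_neg, neg_smul, neg_neg] at this

/-- The initial velocity of a curve in a closed subgroup generates a one-parameter subgroup of
it. -/
theorem exp_mem_of_hasDerivAt (hH : IsClosed (H : Set (S3Pow ν))) {f : ℝ → S3Pow ν} {c : LieAlg ν}
    (hf : ∀ t, f t ∈ H) (hf0 : f 0 = 1)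
    (hd : HasDerivAt (fun t => toQuat (f t)) (fun k => imQuat (c k)) 0) (s : ℝ) :
    expS3Pow (s • c) ∈ H := by
  have h1 := hd.sub (hasDerivAt_toQuat_exp c)
  rw [sub_self, hasDerivAt_iff_tendsto_slope_zero] at h1
  have ht : Filter.Tendsto (fun n : ℕ => 1 / ((n : ℝ) + 1)) .atTop (𝓝 0) :=
    tendsto_one_div_add_atTop_nhds_zero_nat
  have htp : ∀ n : ℕ, 0 < 1 / ((n : ℝ) + 1) := fun n => by positivity
  refine exp_mem_of_tendsto hH (h := fun n => f (1 / (n + 1))) (fun n => hf _) htp ht ?_ s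
  have ht' : Filter.Tendsto (fun n : ℕ => 1 / ((n : ℝ) + 1)) .atTop (𝓝[≠] 0) :=
    tendsto_nhdsWithin_iff.2 ⟨ht, Filter.Eventually.of_forall fun n => (htp n).ne'⟩
  have h2 := (h1.comp ht').norm
  rw [norm_zero] at h2
  refine h2.congr fun n => ?_
  rw [dist_eq_norm_toQuat]
  simp only [Function.comp, zero_add, Pi.sub_apply, hf0, zero_smul, expS3Pow_zero, sub_self,
    sub_zero, norm_smul, norm_inv, Real.norm_of_nonneg (htp n).le]
  exact (div_eq_inv_mul _ _).symm

/-- For closed `H` the vectors generating one-parameter subgroups of `H` already form a subspace: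
the curve `exp (t c) exp (t d)` in `H` has initial velocity `c + d`. -/
theorem mem_lieAlgOf (hH : IsClosed (H : Set (S3Pow ν))) (c : LieAlg ν) :
    c ∈ lieAlgOf H ↔ ∀ t : ℝ, expS3Pow (t • c) ∈ H := by
  refine ⟨fun hc => ?_, fun hc => Submodule.subset_span hc⟩
  refine Submodule.span_induction (p := fun c _ => ∀ t : ℝ, expS3Pow (t • c) ∈ H)
    (fun c hc => hc) (fun t => ?_) (fun c d _ _ hc hd => ?_) (fun r c _ hc t => ?_) hc
  · rw [smul_zero, expS3Pow_zero]; exact H.one_mem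
  · refine exp_mem_of_hasDerivAt hH (f := fun t => expS3Pow (t • c) * expS3Pow (t • d))
      (fun t => H.mul_mem (hc t) (hd t)) (by simp [expS3Pow_zero]) ?_
    have h := (hasDerivAt_toQuat_exp c).mul (hasDerivAt_toQuat_exp d)
    have e : (fun k => imQuat ((c + d) k)) =
        (fun k => imQuat (c k)) * toQuat (expS3Pow ((0 : ℝ) • d)) +
        toQuat (expS3Pow ((0 : ℝ) • c)) * fun k => imQuat (d k) := by
      funext k
      simp only [zero_smul, expS3Pow_zero, Pi.add_apply, Pi.mul_apply]
      change imQuatL (c k + d k) = imQuatL (c k) * 1 + 1 * imQuatL (d k)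
      rw [map_add, mul_one, one_mul]
    rw [e]
    exact h
  · rw [smul_smul]; exact hc _

/-- A closed subgroup meets the exponential of a complement of its Lie algebra only at `1`, near
`1`. -/
theorem exists_forall_exp_mem_eq_zero (hH : IsClosed (H : Set (S3Pow ν)))
    {m : Submodule ℝ (LieAlg ν)} (hm : Disjoint m (lieAlgOf H)) :
    ∃ δ > 0, ∀ a ∈ m, ‖a‖ < δ → expS3Pow a ∈ H → a = 0 := by
  by_contra! hcon
  -- a limit `u` of directions of shorter and shorter counterexamples lies in both subspaces
  have hpos : ∀ n : ℕ, (0 : ℝ) < 1 / ((n : ℝ) + 1) := fun n => by positivity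
  choose a ham han haH ha0 using fun n : ℕ => hcon (1 / ((n : ℝ) + 1)) (hpos n)
  have ha0' : ∀ n, ‖a n‖ ≠ 0 := fun n => norm_ne_zero_iff.2 (ha0 n)
  have hu : ∀ n, ‖a n‖⁻¹ • a n ∈ Metric.sphere (0 : LieAlg ν) 1 := fun n => by
    rw [mem_sphere_zero_iff_norm, norm_smul, norm_inv, norm_norm, inv_mul_cancel₀ (ha0' n)]
  obtain ⟨u, hu1, φ, hφ, hlim⟩ := (isCompact_sphere (0 : LieAlg ν) 1).tendsto_subseq hu
  have hta : Filter.Tendsto (fun n => ‖a n‖) .atTop (𝓝 0) :=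
    squeeze_zero (fun _ => norm_nonneg _) (fun n => (han n).le)
      tendsto_one_div_add_atTop_nhds_zero_nat
  have ht0 : Filter.Tendsto (fun n => ‖a (φ n)‖) .atTop (𝓝 0) := hta.comp hφ.tendsto_atTop
  have hum : u ∈ m := by
    have hc : IsClosed (m : Set (LieAlg ν)) := m.closed_of_finiteDimensional
    exact hc.mem_of_tendsto hlim (Filter.Eventually.of_forall fun n => m.smul_mem _ (ham _))
  obtain ⟨K, s, hs, hK⟩ := (contDiff_toQuat_expS3Pow (ν := ν)).contDiffAt (x := 0)
    |>.of_le (m := 1) (mod_cast le_top) |>.exists_lipschitzOnWith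
  have huH : u ∈ lieAlgOf H := by
    rw [mem_lieAlgOf hH]
    refine exp_mem_of_tendsto hH (h := fun n => expS3Pow (a (φ n))) (fun n => haH _)
      (fun n => (norm_nonneg _).lt_of_ne' (ha0' (φ n))) ht0 ?_
    have hb1 : ∀ᶠ n in .atTop, a (φ n) ∈ s :=
      (tendsto_zero_iff_norm_tendsto_zero.2 ht0).eventually_mem hs
    have hb2 : ∀ᶠ n in .atTop, ‖a (φ n)‖ • u ∈ s := by
      have : Filter.Tendsto (fun n => ‖a (φ n)‖ • u) .atTop (𝓝 0) := by
        simpa using ht0.smul_const u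
      exact this.eventually_mem hs
    have hlim' : Filter.Tendsto (fun n => (K : ℝ) * ‖‖a (φ n)‖⁻¹ • a (φ n) - u‖) .atTop (𝓝 0) := by
      have := (tendsto_iff_norm_sub_tendsto_zero.1 hlim).const_mul (K : ℝ)
      simpa using this
    refine squeeze_zero' (Filter.Eventually.of_forall fun n => by positivity) ?_ hlim'
    filter_upwards [hb1, hb2] with n h1 h2
    rw [div_le_iff₀ ((norm_nonneg _).lt_of_ne' (ha0' (φ n))), dist_eq_norm_toQuat, ← dist_eq_norm]
    refine (hK.dist_le_mul _ h1 _ h2).trans_eq ?_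
    rw [dist_eq_norm, mul_assoc]
    congr 1
    have e : a (φ n) - ‖a (φ n)‖ • u = ‖a (φ n)‖ • (‖a (φ n)‖⁻¹ • a (φ n) - u) := by
      rw [smul_sub, smul_smul, mul_inv_cancel₀ (ha0' _), one_smul]
    rw [e, norm_smul, norm_norm, mul_comm]
  have := Submodule.disjoint_def.1 hm u hum huH
  rw [mem_sphere_zero_iff_norm, this, norm_zero] at hu1
  exact zero_ne_one hu1

end ClosedSubgroup

/-! ### Slices for closed subgroups -/

section InverseFunction

variable {E : Type*} [NormedAddCommGroup E] [NormedSpace ℝ E]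
  {H : Type*} [TopologicalSpace H] {I : ModelWithCorners ℝ E H}
  {M : Type*} [TopologicalSpace M] [ChartedSpace H M] [IsManifold I ∞ M]
  {F : Type*} [NormedAddCommGroup F] [NormedSpace ℝ F] [CompleteSpace F]

/-- The inverse function theorem for a map from a vector space to a manifold. -/
theorem ContMDiff.exists_localInverse {f : F → M} (hf : ContMDiff 𝓘(ℝ, F) I ∞ f) {a : F}
    (ha : (mfderiv 𝓘(ℝ, F) I f a : F →L[ℝ] E).IsInvertible) :
    ∃ S : Set F, IsOpen S ∧ a ∈ S ∧ Set.InjOn f S ∧ (∀ V ⊆ S, IsOpen V → IsOpen (f '' V)) ∧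
      ∃ Ψ : M → F, (∀ c ∈ S, Ψ (f c) = c) ∧ ∀ c ∈ S, ContMDiffAt I 𝓘(ℝ, F) ∞ Ψ (f c) := by
  set φ := extChartAt I (f a) with hφ
  set g : F → E := φ ∘ f with hg
  set U : Set F := f ⁻¹' φ.source with hU
  have hUo : IsOpen U := (isOpen_extChartAt_source (f a)).preimage hf.continuous
  have haU : a ∈ U := mem_extChartAt_source (f a)
  have hgU : ∀ c ∈ U, ContDiffAt ℝ ∞ g c := fun c hc =>
    ((contMDiffAt_extChartAt' (by simpa [hU, hφ] using hc)).comp c (hf c)).contDiffAt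
  have hgo : ContDiffOn ℝ ∞ g U := fun c hc => (hgU c hc).contDiffWithinAt
  have hga : (fderiv ℝ g a).IsInvertible := by
    have h1 := (contMDiffAt_extChartAt (I := I) (n := ∞) (x := f a)).mdifferentiableAt (by simp)
    have h2 := mfderiv_comp a h1 ((hf a).mdifferentiableAt (by simp))
    rw [← mfderiv_eq_fderiv, hg]
    rw [h2]
    exact (isInvertible_mfderiv_extChartAt (mem_extChartAt_source (f a))).comp ha
  obtain ⟨e, he⟩ := hga
  have hga' : HasFDerivAt g (e : F →L[ℝ] E) a := by
    rw [he]; exact ((hgU a haU).differentiableAt (by simp)).hasFDerivAt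
  set e₁ := (hgU a haU).toOpenPartialHomeomorph g hga' (by simp) with he₁
  have he₁g : ∀ c, e₁ c = g c := fun c => rfl
  refine ⟨e₁.source ∩ (U ∩ fderiv ℝ g ⁻¹' Set.range ((↑) : (F ≃L[ℝ] E) → F →L[ℝ] E)),
    e₁.open_source.inter ((hgo.continuousOn_fderiv_of_isOpen hUo
      (by simp)).isOpen_inter_preimage hUo ContinuousLinearEquiv.isOpen),
    ⟨(hgU a haU).mem_toOpenPartialHomeomorph_source hga' (by simp), haU, ⟨e, he⟩⟩, ?_, ?_,
    e₁.symm ∘ φ, ?_, ?_⟩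
  · intro c hc d hd hcd
    exact e₁.injOn hc.1 hd.1 (congrArg φ hcd)
  · intro V hV hVo
    have h1 : IsOpen (e₁ '' V) := e₁.isOpen_image_of_subset_source hVo fun c hc => (hV hc).1
    have h2 := (continuousOn_extChartAt (I := I) (f a)).isOpen_inter_preimage
      (isOpen_extChartAt_source (f a)) h1
    convert h2 using 1
    ext y
    constructor
    · rintro ⟨c, hc, rfl⟩
      exact ⟨(hV hc).2.1, c, hc, rfl⟩
    · rintro ⟨hy, c, hc, hcy⟩
      exact ⟨c, hc, φ.injOn (hV hc).2.1 hy hcy⟩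
  · intro c hc
    exact e₁.left_inv hc.1
  · rintro c ⟨hc, hcU, ⟨e', he'⟩⟩
    have hcs : e₁.symm (g c) = c := e₁.left_inv hc
    have h1 : ContDiffAt ℝ ∞ e₁.symm (g c) := by
      refine e₁.contDiffAt_symm (f₀' := e') (e₁.map_source hc) ?_ ?_
      · rw [hcs, he']
        exact ((hgU c hcU).differentiableAt (by simp)).hasFDerivAt
      · rw [hcs]; exact hgU c hcU
    exact h1.contMDiffAt.comp (f c) (contMDiffAt_extChartAt' (by simpa [hU, hφ] using hcU))

end InverseFunction

section Slice

variable {ν : ℕ}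

theorem coframe_mfderiv_of_hasFDerivAt {F : Type*} [NormedAddCommGroup F] [NormedSpace ℝ F]
    {f : F → S3Pow ν} {a : F} (hf : MDifferentiableAt 𝓘(ℝ, F) (modelS3Pow ν) f a)
    {D : F →L[ℝ] Fin ν → ℍ[ℝ]} (hD : HasFDerivAt (fun y => toQuat (f y)) D a) {v : F}
    {c : LieAlg ν} (h : ∀ k, D v k = f a k * imQuat (c k)) :
    coframe (f a) (mfderiv 𝓘(ℝ, F) (modelS3Pow ν) f a v) = c := by
  rw [coframe_eq_iff]
  intro k
  refine (dcoe_mfderiv hf v k).trans ?_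
  rw [← h]
  have h1 := (hasFDerivAt_pi'.1 hD k).hasMFDerivAt.mfderiv
  exact congrArg (fun A : F →L[ℝ] ℍ[ℝ] => A v) h1

theorem hasFDerivAt_toQuat_exp : HasFDerivAt (fun c : LieAlg ν => toQuat (expS3Pow c))
    (ContinuousLinearMap.pi fun k => imQuatL ∘L ContinuousLinearMap.proj k) 0 := by
  refine hasFDerivAt_pi.2 fun k => ?_
  have h : HasFDerivAt (NormedSpace.exp : ℍ[ℝ] → ℍ[ℝ]) (1 : ℍ[ℝ] →L[ℝ] ℍ[ℝ])
      ((imQuatL ∘L ContinuousLinearMap.proj (R := ℝ) (φ := fun _ : Fin ν => Fin 3 → ℝ) k) 0) := by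
    rw [map_zero]; exact hasFDerivAt_exp_zero
  exact h.comp 0 (ContinuousLinearMap.hasFDerivAt _)

theorem coframe_mul_exp (x : S3Pow ν) (c : LieAlg ν) :
    coframe (x * expS3Pow 0) (mfderiv 𝓘(ℝ, LieAlg ν) (modelS3Pow ν)
      (fun c => x * expS3Pow c) 0 c) = c := by
  refine coframe_mfderiv_of_hasFDerivAt (f := fun c => x * expS3Pow c)
    ((contMDiff_mul_S3Pow contMDiff_const contMDiff_expS3Pow 0).mdifferentiableAt
    (n := ∞) (by simp)) (hasFDerivAt_toQuat_exp.const_mul (toQuat x)) fun k => ?_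
  simp only [expS3Pow_zero, mul_one]
  rfl

/-- A slice for a subgroup `H` of `(S³)^ν`: a chart `κ` of the coset space at `H`, with values in
a space isomorphic to `𝔤/𝔥`, whose inverse lifts to a smooth map `σ` into `(S³)^ν`. It is recorded
that near `1` the elements of `H` are exponentials of elements of its Lie algebra. -/
structure CosetSlice (H : Subgroup (S3Pow ν)) where
  dim : ℕ
  pr : LieAlg ν →L[ℝ] EuclideanSpace ℝ (Fin dim)
  ker_pr : ∀ c, pr c = 0 ↔ c ∈ lieAlgOf H
  κ : OpenPartialHomeomorph (S3Pow ν ⧸ H) (EuclideanSpace ℝ (Fin dim))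
  σ : EuclideanSpace ℝ (Fin dim) → S3Pow ν
  smooth_σ : ContMDiff (𝓡 dim) (modelS3Pow ν) ∞ σ
  mem_source : ((1 : S3Pow ν) : S3Pow ν ⧸ H) ∈ κ.source
  symm_eq : ∀ a ∈ κ.target, κ.symm a = (σ a : S3Pow ν ⧸ H)
  smooth_κ : ∀ x : S3Pow ν, (x : S3Pow ν ⧸ H) ∈ κ.source →
    ContMDiffAt (modelS3Pow ν) (𝓡 dim) ∞ (fun y : S3Pow ν => κ (y : S3Pow ν ⧸ H)) x
  mfderiv_κ : ∀ v : TangentSpace (modelS3Pow ν) (1 : S3Pow ν),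
    mfderiv (modelS3Pow ν) (𝓡 dim) (fun y : S3Pow ν => κ (y : S3Pow ν ⧸ H)) 1 v =
      pr (coframe 1 v)
  eventually_mem : ∀ᶠ x in 𝓝 (1 : S3Pow ν), x ∈ H → ∃ c ∈ lieAlgOf H, x = expS3Pow c

set_option maxHeartbeats 1000000 in
/-- A closed subgroup has a slice. For a complement `𝔪` of `𝔥` the map `Φ (a + b) = exp a exp b`,
`a ∈ 𝔪`, `b ∈ 𝔥`, is a local diffeomorphism at `0`, and closedness of `H` makes `a ↦ (exp a) H`
injective near `0`. -/
theorem nonempty_cosetSlice {H : Subgroup (S3Pow ν)} (hH : IsClosed (H : Set (S3Pow ν))) :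
    Nonempty (CosetSlice H) := by
  obtain ⟨m, hm⟩ := (lieAlgOf H).exists_isCompl
  have hdim : Module.finrank ℝ m =
      Module.finrank ℝ (EuclideanSpace ℝ (Fin (Module.finrank ℝ m))) := by simp
  set d := Module.finrank ℝ m
  let u : m ≃ₗ[ℝ] EuclideanSpace ℝ (Fin d) := LinearEquiv.ofFinrankEq _ _ hdim
  let L : EuclideanSpace ℝ (Fin d) →L[ℝ] LieAlg ν :=
    LinearMap.toContinuousLinearMap (m.subtype ∘ₗ u.symm.toLinearMap)
  let pr : LieAlg ν →L[ℝ] EuclideanSpace ℝ (Fin d) :=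
    LinearMap.toContinuousLinearMap (u.toLinearMap ∘ₗ m.projectionOnto (lieAlgOf H) hm.symm)
  have hprL : ∀ a, pr (L a) = a := fun a => by
    simp [pr, L]
  have hLm : ∀ a, L a ∈ m := fun a => by simp [L]
  have hker : ∀ c, pr c = 0 ↔ c ∈ lieAlgOf H := fun c => by
    simp [pr]
  have hrem : ∀ c, c - L (pr c) ∈ lieAlgOf H := fun c => by
    rw [← hker, map_sub, hprL, sub_self]
  let Φ : LieAlg ν → S3Pow ν := fun c => expS3Pow (L (pr c)) * expS3Pow (c - L (pr c))
  have hΦL : ∀ a, Φ (L a) = expS3Pow (L a) := fun a => by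
    simp [Φ, hprL, expS3Pow_zero]
  have hΦ0 : Φ 0 = 1 := by simp [Φ, expS3Pow_zero]
  have hΦs : ContMDiff 𝓘(ℝ, LieAlg ν) (modelS3Pow ν) ∞ Φ :=
    contMDiff_mul_S3Pow (contMDiff_expS3Pow.comp (L ∘L pr).contMDiff)
      (contMDiff_expS3Pow.comp (ContinuousLinearMap.id ℝ _ - L ∘L pr).contMDiff)
  have hΦmk : ∀ c, (Φ c : S3Pow ν ⧸ H) = expS3Pow (L (pr c)) := fun c => by
    refine (QuotientGroup.mk_mul_of_mem _ ?_)
    have := (mem_lieAlgOf hH _).1 (hrem c) 1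
    rwa [one_smul] at this
  have hΦd : ∀ v : LieAlg ν, coframe (Φ 0) (mfderiv 𝓘(ℝ, LieAlg ν) (modelS3Pow ν) Φ 0 v) = v := by
    intro v
    have h0 : ∀ A : LieAlg ν →L[ℝ] LieAlg ν,
        HasFDerivAt (fun c : LieAlg ν => toQuat (expS3Pow (A c)))
        ((ContinuousLinearMap.pi fun k => imQuatL ∘L ContinuousLinearMap.proj k) ∘L A) 0 := by
      intro A
      have h : HasFDerivAt (fun c : LieAlg ν => toQuat (expS3Pow c))
          (ContinuousLinearMap.pi fun k => imQuatL ∘L ContinuousLinearMap.proj k) (A 0) := by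
        rw [map_zero]; exact hasFDerivAt_toQuat_exp
      exact h.comp 0 A.hasFDerivAt
    have hm := (h0 (L ∘L pr)).mul' (h0 (ContinuousLinearMap.id ℝ (LieAlg ν) - L ∘L pr))
    have hm' : HasFDerivAt (fun y => toQuat (Φ y)) _ 0 := hm
    refine coframe_mfderiv_of_hasFDerivAt ((hΦs 0).mdifferentiableAt (by simp)) hm' fun k => ?_
    have e1 : ∀ A : LieAlg ν →L[ℝ] LieAlg ν, toQuat (expS3Pow (A 0)) = 1 := fun A => by
      rw [map_zero, expS3Pow_zero]; rfl
    rw [hΦ0, e1, e1]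
    simp only [one_smul, MulOpposite.op_one]
    change imQuatL ((v - L (pr v)) k) + imQuatL (L (pr v) k) = (1 : ℍ[ℝ]) * imQuatL (v k)
    rw [one_mul, ← map_add]
    simp
  have hΦi : (mfderiv 𝓘(ℝ, LieAlg ν) (modelS3Pow ν) Φ 0 :
      LieAlg ν →L[ℝ] (Fin ν → EuclideanSpace ℝ (Fin 3))).IsInvertible := by
    obtain ⟨e, he⟩ := coframe_isInvertible (Φ 0)
    refine ⟨e.symm, ?_⟩
    ext1 v
    apply e.injective
    exact (e.apply_symm_apply v).trans ((hΦd v).symm.trans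
      (congrArg (fun A : TangentSpace (modelS3Pow ν) (Φ 0) →L[ℝ] LieAlg ν =>
        A (mfderiv 𝓘(ℝ, LieAlg ν) (modelS3Pow ν) Φ 0 v)) he.symm))
  -- radii for which `Φ` is injective and `exp` of the complement meets `H` only in `1`
  obtain ⟨S, hSo, h0S, hSi, hSV, Ψ, hΨ, hΨs⟩ := hΦs.exists_localInverse hΦi
  obtain ⟨δ, hδ, hδH⟩ := exists_forall_exp_mem_eq_zero hH hm.symm.disjoint
  obtain ⟨ρ, hρ, hρS⟩ : ∃ ρ > 0, ∀ c : LieAlg ν, ‖c‖ < 2 * ρ → c ∈ S ∧ ‖L (pr c)‖ < δ := by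
    have h1 : ∀ᶠ c in 𝓝 (0 : LieAlg ν), c ∈ S ∧ ‖L (pr c)‖ < δ := by
      refine Filter.Eventually.and (hSo.mem_nhds h0S) ?_
      have : ContinuousAt (fun c : LieAlg ν => ‖L (pr c)‖) 0 := by fun_prop
      exact this.eventually_lt continuousAt_const (by simpa using hδ)
    obtain ⟨r, hr, hr'⟩ := Metric.eventually_nhds_iff.1 h1
    exact ⟨r / 2, by positivity, fun c hc => hr' (by rw [dist_zero_right]; linarith)⟩
  have hT : IsOpen (Φ '' Metric.ball 0 ρ) := hSV _ (fun c hc => (hρS c (by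
    rw [mem_ball_zero_iff] at hc; linarith)).1) Metric.isOpen_ball
  have hmemH : ∀ c, ‖c‖ < ρ → Φ c ∈ H → L (pr c) = 0 := fun c hc hcH => by
    have hc' := (mem_lieAlgOf hH _).1 (hrem c) 1
    rw [one_smul] at hc'
    exact hδH _ (hLm _) (hρS c (by linarith)).2 ((H.mul_mem_cancel_right hc').1 hcH)
  have hexp : ∀ᶠ x in 𝓝 (1 : S3Pow ν), x ∈ H → ∃ c ∈ lieAlgOf H, x = expS3Pow c := by
    filter_upwards [hT.mem_nhds ⟨0, Metric.mem_ball_self hρ, hΦ0⟩]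
    rintro x ⟨c, hc, rfl⟩ hx
    have h0 := hmemH c (mem_ball_zero_iff.1 hc) hx
    have h1 := hrem c
    rw [h0, sub_zero] at h1
    exact ⟨c, h1, by simp [Φ, h0, expS3Pow_zero]⟩
  obtain ⟨r, hr, hrT⟩ : ∃ r > 0, ∀ a a' : EuclideanSpace ℝ (Fin d), ‖a‖ < r → ‖a'‖ < r →
      ‖L a‖ < ρ ∧ (expS3Pow (L a'))⁻¹ * expS3Pow (L a) ∈ Φ '' Metric.ball 0 ρ := by
    have hc1 : Continuous (fun p : EuclideanSpace ℝ (Fin d) × EuclideanSpace ℝ (Fin d) =>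
        (expS3Pow (L p.2))⁻¹ * expS3Pow (L p.1)) := by
      have := (contMDiff_expS3Pow (ν := ν)).continuous
      fun_prop
    have h1 : ∀ᶠ p : EuclideanSpace ℝ (Fin d) × EuclideanSpace ℝ (Fin d) in 𝓝 0, ‖L p.1‖ < ρ ∧
        (expS3Pow (L p.2))⁻¹ * expS3Pow (L p.1) ∈ Φ '' Metric.ball 0 ρ := by
      refine Filter.Eventually.and ?_ (hc1.continuousAt.eventually_mem (hT.mem_nhds ?_))
      · have : ContinuousAt (fun p : EuclideanSpace ℝ (Fin d) × EuclideanSpace ℝ (Fin d) =>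
          ‖L p.1‖) 0 := by fun_prop
        exact this.eventually_lt continuousAt_const (by simpa using hρ)
      · refine ⟨0, Metric.mem_ball_self hρ, ?_⟩
        simp [hΦ0, expS3Pow_zero]
    obtain ⟨r, hr, hr'⟩ := Metric.eventually_nhds_iff.1 h1
    refine ⟨r, hr, fun a a' ha ha' => hr' (y := (a, a')) ?_⟩
    rw [dist_zero_right]
    exact max_lt ha ha'
  let q : EuclideanSpace ℝ (Fin d) → S3Pow ν ⧸ H := fun a => (expS3Pow (L a) : S3Pow ν ⧸ H)
  have hq : Continuous q :=
    QuotientGroup.continuous_mk.comp (contMDiff_expS3Pow.continuous.comp L.continuous)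
  -- if `exp a' h = exp a` with `h ∈ H` then `h = exp c` with `c ∈ 𝔥` small, so that `Φ (a' +
  -- c) = Φ a`
  have hqi : Set.InjOn q (Metric.ball 0 r) := by
    intro a ha a' ha' haa
    rw [mem_ball_zero_iff] at ha ha'
    obtain ⟨-, c, hc, hch⟩ := hrT a a' ha ha'
    have hmem : (expS3Pow (L a'))⁻¹ * expS3Pow (L a) ∈ H := QuotientGroup.eq.1 haa.symm
    rw [mem_ball_zero_iff] at hc
    have hPc : L (pr c) = 0 := hmemH c hc (by rwa [hch])
    have hprc : pr c = 0 := by rw [← hprL (pr c), hPc, map_zero]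
    have hLa' := (hrT a' a' ha' ha').1
    have hLa := (hrT a a ha ha).1
    have e1 : Φ (L a' + c) = Φ (L a) := by
      rw [hΦL]
      have : Φ (L a' + c) = expS3Pow (L a') * Φ c := by
        simp [Φ, hprL, hprc, expS3Pow_zero]
      rw [this, hch, mul_inv_cancel_left]
    have e2 := hSi (hρS _ (by
      calc ‖L a' + c‖ ≤ ‖L a'‖ + ‖c‖ := norm_add_le _ _
        _ < 2 * ρ := by linarith)).1 (hρS _ (by linarith)).1 e1
    have e3 := congrArg pr e2
    rw [map_add, hprL, hprL, hprc, add_zero] at e3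
    exact e3.symm
  have hVS : ∀ V : Set (EuclideanSpace ℝ (Fin d)), IsOpen V →
      IsOpen (Φ '' (Metric.ball 0 (2 * ρ) ∩ pr ⁻¹' V)) := fun V hV =>
    hSV _ (fun c hc => (hρS c (mem_ball_zero_iff.1 hc.1)).1)
      (Metric.isOpen_ball.inter (hV.preimage pr.continuous))
  have hqo : ∀ V ⊆ Metric.ball 0 r, IsOpen V → IsOpen (q '' V) := by
    intro V hV hVo
    have h1 := QuotientGroup.isOpenMap_coe (N := H) _ (hVS V hVo)
    convert h1 using 1
    ext y
    constructor
    · rintro ⟨a, ha, rfl⟩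
      have ha' := (hrT a a (mem_ball_zero_iff.1 (hV ha)) (mem_ball_zero_iff.1 (hV ha))).1
      exact ⟨Φ (L a), ⟨L a, ⟨mem_ball_zero_iff.2 (by linarith), by simpa [hprL] using ha⟩, rfl⟩,
        by rw [hΦL]⟩
    · rintro ⟨_, ⟨c, ⟨-, hc⟩, rfl⟩, rfl⟩
      exact ⟨pr c, hc, (hΦmk c).symm⟩
  let e : OpenPartialHomeomorph (EuclideanSpace ℝ (Fin d)) (S3Pow ν ⧸ H) :=
    OpenPartialHomeomorph.ofContinuousOpenRestrict (hqi.toPartialEquiv q (Metric.ball 0 r))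
      hq.continuousOn (by
        intro V hV
        have h1 : Set.domRestrict (Metric.ball 0 r) q '' V = q '' (Subtype.val '' V) := by
          rw [Set.image_image]; rfl
        change IsOpen (Set.domRestrict (Metric.ball 0 r) q '' V)
        rw [h1]
        exact hqo _ (by rintro _ ⟨a, -, rfl⟩; exact a.2)
          (Metric.isOpen_ball.isOpenMap_subtype_val _ hV))
      Metric.isOpen_ball
  have heq : ∀ a, e a = q a := fun _ => rfl
  have hes : e.source = Metric.ball 0 r := rfl
  have hκ : ∀ c : LieAlg ν, ‖pr c‖ < r → e.symm (Φ c : S3Pow ν ⧸ H) = pr c := fun c hc => by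
    rw [hΦmk]
    exact e.left_inv (mem_ball_zero_iff.2 hc)
  have h1mem : ((1 : S3Pow ν) : S3Pow ν ⧸ H) ∈ e.target := by
    have := e.map_source (x := 0) (by rw [hes]; exact Metric.mem_ball_self hr)
    change ((expS3Pow (L 0) : S3Pow ν) : S3Pow ν ⧸ H) ∈ _ at this
    rwa [map_zero, expS3Pow_zero] at this
  have hsmooth : ∀ x : S3Pow ν, (x : S3Pow ν ⧸ H) ∈ e.target →
      ContMDiffAt (modelS3Pow ν) (𝓡 d) ∞ (fun y : S3Pow ν => e.symm (y : S3Pow ν ⧸ H)) x := by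
    intro x hx
    obtain ⟨a, ha, hax⟩ : ∃ a ∈ Metric.ball 0 r, q a = x :=
      ⟨e.symm x, e.map_target hx, e.right_inv hx⟩
    have ha' := mem_ball_zero_iff.1 ha
    -- near `x` the chart is `y ↦ pr (Φ⁻¹ (y h⁻¹))`
    set h := (expS3Pow (L a))⁻¹ * x with hh
    have hhH : h ∈ H := QuotientGroup.eq.1 hax
    have hxh : x * h⁻¹ = Φ (L a) := by rw [hh, hΦL]; group
    have hLaS := (hρS (L a) (by linarith [(hrT a a ha' ha').1])).1
    have hN := hVS _ (Metric.isOpen_ball (x := (0 : EuclideanSpace ℝ (Fin d))) (ε := r))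
    have hsm : ContMDiffAt (modelS3Pow ν) (𝓡 d) ∞ (fun y => pr (Ψ (y * h⁻¹))) x := by
      have h1 := hΨs _ hLaS
      rw [← hxh] at h1
      exact pr.contMDiff.contMDiffAt.comp x (h1.comp x (contMDiff_mul_right_S3Pow h⁻¹ x))
    refine hsm.congr_of_eventuallyEq ?_
    have hcont : ContinuousAt (fun y : S3Pow ν => y * h⁻¹) x := by fun_prop
    have : ∀ᶠ y in 𝓝 x, y * h⁻¹ ∈ Φ '' (Metric.ball 0 (2 * ρ) ∩ pr ⁻¹' Metric.ball 0 r) := by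
      refine hcont.eventually_mem (hN.mem_nhds ?_)
      rw [hxh]
      exact ⟨L a, ⟨mem_ball_zero_iff.2 (by linarith [(hrT a a ha' ha').1]),
        by simpa [hprL] using ha'⟩, rfl⟩
    filter_upwards [this] with y hy
    obtain ⟨c, ⟨hc1, hc2⟩, hcy⟩ := hy
    have e1 : (y : S3Pow ν ⧸ H) = Φ c := by
      rw [hcy]; exact (QuotientGroup.mk_mul_of_mem _ (H.inv_mem hhH)).symm
    rw [e1, hκ c (by simpa using hc2), ← hcy, hΨ c (hρS c (mem_ball_zero_iff.1 hc1)).1]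
  refine ⟨⟨d, pr, hker, e.symm, fun a => expS3Pow (L a), contMDiff_expS3Pow.comp L.contMDiff,
    h1mem, fun a _ => rfl, hsmooth, fun v => ?_, hexp⟩⟩
  have hκs : MDifferentiableAt (modelS3Pow ν) (𝓡 d)
      (fun y : S3Pow ν => e.symm (y : S3Pow ν ⧸ H)) 1 :=
    (hsmooth 1 h1mem).mdifferentiableAt (by simp)
  have hch := mfderiv_comp_apply_of_eq (0 : LieAlg ν) hκs
    ((hΦs 0).mdifferentiableAt (by simp)) hΦ0 (coframe 1 v)
  have hv : mfderiv 𝓘(ℝ, LieAlg ν) (modelS3Pow ν) Φ 0 (coframe 1 v) = v := by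
    have h1 := hΦd (coframe 1 v)
    rw [hΦ0] at h1
    exact coframe_injective 1 h1
  have hev : (fun y : S3Pow ν => e.symm (y : S3Pow ν ⧸ H)) ∘ Φ =ᶠ[𝓝 0] pr := by
    have : ∀ᶠ c in 𝓝 (0 : LieAlg ν), ‖pr c‖ < r := by
      have : ContinuousAt (fun c : LieAlg ν => ‖pr c‖) 0 := by fun_prop
      exact this.eventually_lt continuousAt_const (by simpa using hr)
    filter_upwards [this] with c hc using hκ c hc
  rw [hev.mfderiv_eq] at hch
  refine (congrArg _ hv.symm).trans (hch.symm.trans ?_)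
  have h2 : mfderiv 𝓘(ℝ, LieAlg ν) (𝓡 d) pr 0 = pr := by
    rw [mfderiv_eq_fderiv]; exact pr.fderiv
  exact congrArg (fun A : LieAlg ν →L[ℝ] EuclideanSpace ℝ (Fin d) => A (coframe 1 v)) h2

end Slice

/-! ### The smooth structure of `G/H` -/

section QuotientManifold

variable {ν : ℕ} {H : Subgroup (S3Pow ν)}

namespace CosetSlice

variable (S : CosetSlice H)

/-- The translate of the chart `κ` to the coset `x H`. -/
def chart (x : S3Pow ν) : OpenPartialHomeomorph (S3Pow ν ⧸ H) (EuclideanSpace ℝ (Fin S.dim)) :=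
  (Homeomorph.smul x⁻¹).toOpenPartialHomeomorph ≫ₕ S.κ

theorem mk_mem_chart_source (x y : S3Pow ν) :
    (y : S3Pow ν ⧸ H) ∈ (S.chart x).source ↔ ((x⁻¹ * y : S3Pow ν) : S3Pow ν ⧸ H) ∈ S.κ.source := by
  rw [chart, OpenPartialHomeomorph.trans_source, Homeomorph.toOpenPartialHomeomorph_source,
    Set.univ_inter]
  exact Iff.rfl

theorem chart_mk (x y : S3Pow ν) :
    S.chart x (y : S3Pow ν ⧸ H) = S.κ ((x⁻¹ * y : S3Pow ν) : S3Pow ν ⧸ H) := rfl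

theorem chart_target (x : S3Pow ν) : (S.chart x).target = S.κ.target := by
  rw [chart, OpenPartialHomeomorph.trans_target, Homeomorph.toOpenPartialHomeomorph_target,
    Set.preimage_univ, Set.inter_univ]

theorem chart_symm_apply (x : S3Pow ν) {a : EuclideanSpace ℝ (Fin S.dim)} (ha : a ∈ S.κ.target) :
    (S.chart x).symm a = ((x * S.σ a : S3Pow ν) : S3Pow ν ⧸ H) := by
  have h1 : S.κ.symm a = ((x⁻¹ * (x * S.σ a) : S3Pow ν) : S3Pow ν ⧸ H) := by
    rw [inv_mul_cancel_left]; exact S.symm_eq a ha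
  have h2 : S.chart x ((x * S.σ a : S3Pow ν) : S3Pow ν ⧸ H) = a := by
    rw [chart_mk, ← h1, S.κ.right_inv ha]
  have h3 : ((x * S.σ a : S3Pow ν) : S3Pow ν ⧸ H) ∈ (S.chart x).source := by
    rw [mk_mem_chart_source, ← h1]; exact S.κ.map_target ha
  have h4 := (S.chart x).left_inv h3
  rwa [h2] at h4

theorem contMDiffAt_chart_mk (x y : S3Pow ν) (hy : (y : S3Pow ν ⧸ H) ∈ (S.chart x).source) :
    ContMDiffAt (modelS3Pow ν) (𝓡 S.dim) ∞ (fun z : S3Pow ν => S.chart x (z : S3Pow ν ⧸ H)) y :=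
  (S.smooth_κ _ ((S.mk_mem_chart_source x y).1 hy)).comp y (contMDiff_mul_left_S3Pow x⁻¹ y)

theorem mem_chart_source (x : S3Pow ν) : (x : S3Pow ν ⧸ H) ∈ (S.chart x).source := by
  rw [mk_mem_chart_source, inv_mul_cancel]; exact S.mem_source

/-- The manifold structure of the coset space defined by a slice. -/
@[reducible] def chartedSpace : ChartedSpace (EuclideanSpace ℝ (Fin S.dim)) (S3Pow ν ⧸ H) where
  atlas := Set.range S.chart
  chartAt q := S.chart q.out
  mem_chart_source q := by
    have := S.mem_chart_source q.out
    rwa [QuotientGroup.out_eq'] at this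
  chart_mem_atlas q := ⟨_, rfl⟩

theorem isManifold :
    letI := S.chartedSpace
    IsManifold (𝓡 S.dim) ∞ (S3Pow ν ⧸ H) := by
  let := S.chartedSpace
  refine isManifold_of_contDiffOn _ _ _ ?_
  rintro _ _ ⟨x, rfl⟩ ⟨y, rfl⟩ a ⟨ha, -⟩
  have ha1 : a ∈ S.κ.target := by
    rw [← S.chart_target x]; exact ha.1
  have ha2 : ((x * S.σ a : S3Pow ν) : S3Pow ν ⧸ H) ∈ (S.chart y).source := by
    rw [← S.chart_symm_apply x ha1]; exact ha.2
  have h1 : ContMDiffAt (𝓡 S.dim) (𝓡 S.dim) ∞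
      (fun b => S.chart y ((x * S.σ b : S3Pow ν) : S3Pow ν ⧸ H)) a :=
    ContMDiffAt.comp (I' := modelS3Pow ν) (f := fun b => x * S.σ b) a
      (S.contMDiffAt_chart_mk y _ ha2) ((contMDiff_mul_left_S3Pow x).comp S.smooth_σ a)
  refine (h1.contDiffAt.congr_of_eventuallyEq ?_).contDiffWithinAt
  filter_upwards [S.κ.open_target.mem_nhds ha1] with b hb
  change S.chart y ((S.chart x).symm b) = _
  rw [S.chart_symm_apply x hb]

theorem chart_mem_maximalAtlas (x : S3Pow ν) :
    letI := S.chartedSpace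
    S.chart x ∈ IsManifold.maximalAtlas (𝓡 S.dim) ∞ (S3Pow ν ⧸ H) := by
  let := S.chartedSpace
  have := S.isManifold
  exact IsManifold.subset_maximalAtlas ⟨x, rfl⟩

theorem contMDiff_mk :
    letI := S.chartedSpace
    ContMDiff (modelS3Pow ν) (𝓡 S.dim) ∞ (QuotientGroup.mk : S3Pow ν → S3Pow ν ⧸ H) := by
  let := S.chartedSpace
  intro x
  have := S.isManifold
  have h1 := contMDiffAt_symm_of_mem_maximalAtlas (I := 𝓡 S.dim) (n := ∞)
    (S.chart_mem_maximalAtlas x) ((S.chart x).map_source (S.mem_chart_source x))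
  refine (ContMDiffAt.comp (I' := 𝓡 S.dim) (g := (S.chart x).symm) x h1
    (S.contMDiffAt_chart_mk x x (S.mem_chart_source x))).congr_of_eventuallyEq ?_
  have h2 := QuotientGroup.continuous_mk.continuousAt.eventually_mem
    ((S.chart x).open_source.mem_nhds (S.mem_chart_source x))
  filter_upwards [h2] with y hy
  exact ((S.chart x).left_inv hy).symm

theorem surjective_mfderiv_mk (x : S3Pow ν) :
    letI := S.chartedSpace
    Function.Surjective (mfderiv (modelS3Pow ν) (𝓡 S.dim)
      (QuotientGroup.mk : S3Pow ν → S3Pow ν ⧸ H) x) := by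
  let := S.chartedSpace
  have := S.isManifold
  -- the lift `σ` may take the coset `H` to some `h ∈ H` other than `1`
  set h : S3Pow ν := S.σ (S.κ ((1 : S3Pow ν) : S3Pow ν ⧸ H)) with hh
  have hmem : h ∈ H := by
    have h1 := S.symm_eq _ (S.κ.map_source S.mem_source)
    rw [S.κ.left_inv S.mem_source] at h1
    have h2 := QuotientGroup.eq.1 h1
    rwa [inv_one, one_mul] at h2
  let s : S3Pow ν ⧸ H → S3Pow ν := fun q => x * S.σ (S.chart x q) * h⁻¹
  have hsx : s x = x := by
    simp only [s, chart_mk, inv_mul_cancel, ← hh, mul_inv_cancel_right]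
  have hs : ContMDiffAt (𝓡 S.dim) (modelS3Pow ν) ∞ s (x : S3Pow ν ⧸ H) :=
    ((contMDiff_mul_right_S3Pow h⁻¹).comp
      ((contMDiff_mul_left_S3Pow x).comp S.smooth_σ)).contMDiffAt.comp _
      (contMDiffAt_of_mem_maximalAtlas (S.chart_mem_maximalAtlas x) (S.mem_chart_source x))
  have hps : (QuotientGroup.mk ∘ s : S3Pow ν ⧸ H → S3Pow ν ⧸ H) =ᶠ[𝓝 (x : S3Pow ν ⧸ H)] id := by
    filter_upwards [(S.chart x).open_source.mem_nhds (S.mem_chart_source x)] with q hq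
    have h1 := (S.chart x).left_inv hq
    rw [S.chart_symm_apply x (by rw [← S.chart_target x]; exact (S.chart x).map_source hq)] at h1
    change ((x * S.σ (S.chart x q) * h⁻¹ : S3Pow ν) : S3Pow ν ⧸ H) = q
    rw [QuotientGroup.mk_mul_of_mem _ (H.inv_mem hmem), h1]
  intro w
  have h1 := mfderiv_comp_apply_of_eq (x : S3Pow ν ⧸ H)
    ((S.contMDiff_mk x).mdifferentiableAt (by simp)) (hs.mdifferentiableAt (by simp)) hsx w
  rw [hps.mfderiv_eq, mfderiv_id] at h1
  exact ⟨_, h1.symm⟩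

end CosetSlice

/-- For every smooth structure on the coset space for which the projection is a submersion, the
vertical vectors are those whose left-invariant components lie in the Lie algebra of `H`. -/
theorem mem_verticalSpace_mk {E' : Type*} [NormedAddCommGroup E'] [NormedSpace ℝ E']
    {H' : Type*} [TopologicalSpace H'] {J : ModelWithCorners ℝ E' H'} [J.Boundaryless]
    [CompleteSpace E'] [FiniteDimensional ℝ E']
    [ChartedSpace H' (S3Pow ν ⧸ H)] [IsManifold J ∞ (S3Pow ν ⧸ H)]
    (hH : IsClosed (H : Set (S3Pow ν)))
    (hmk : ContMDiff (modelS3Pow ν) J ∞ (QuotientGroup.mk : S3Pow ν → S3Pow ν ⧸ H))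
    (hsurj : ∀ x, Function.Surjective
      (mfderiv (modelS3Pow ν) J (QuotientGroup.mk : S3Pow ν → S3Pow ν ⧸ H) x))
    (x : S3Pow ν) (v : TangentSpace (modelS3Pow ν) x) :
    v ∈ verticalSpace (modelS3Pow ν) J (QuotientGroup.mk : S3Pow ν → S3Pow ν ⧸ H) x ↔
      coframe x v ∈ lieAlgOf H := by
  constructor
  · intro hv
    -- the chart of a slice is smooth on `G/H`, so `v` is also in the kernel of its differential
    obtain ⟨S⟩ := nonempty_cosetSlice hH
    have h1 := S.contMDiffAt_chart_mk x x (S.mem_chart_source x)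
    have h2 := (hmk x).of_comp_submersion (hsurj x) (f := S.chart x) h1
    have h3 := mfderiv_comp_apply x (h2.mdifferentiableAt (by simp))
      ((hmk x).mdifferentiableAt (by simp)) v
    have hv' : mfderiv (modelS3Pow ν) J (QuotientGroup.mk : S3Pow ν → S3Pow ν ⧸ H) x v = 0 := hv
    rw [hv', map_zero] at h3
    have h4 := mfderiv_comp_apply_of_eq x (f := fun y : S3Pow ν => x⁻¹ * y)
      ((S.smooth_κ 1 S.mem_source).mdifferentiableAt (by simp))
      ((contMDiff_mul_left_S3Pow x⁻¹ x).mdifferentiableAt (by simp)) (inv_mul_cancel x) v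
    have h5 := S.mfderiv_κ (mfderiv (modelS3Pow ν) (modelS3Pow ν) (fun y => x⁻¹ * y) x v)
    have h6 := coframe_mul_left x⁻¹ x v
    rw [inv_mul_cancel] at h6
    rw [← S.ker_pr]
    exact (congrArg S.pr h6.symm).trans (h5.symm.trans (h4.symm.trans h3))
  · intro hv
    -- the curve `x exp (t c)` stays in one coset
    set c : LieAlg ν := coframe x v with hc
    let ℓ : ℝ →L[ℝ] LieAlg ν := ContinuousLinearMap.toSpanSingleton ℝ c
    let f : LieAlg ν → S3Pow ν := fun c => x * expS3Pow c
    have hf : ContMDiff 𝓘(ℝ, LieAlg ν) (modelS3Pow ν) ∞ f :=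
      contMDiff_mul_S3Pow contMDiff_const contMDiff_expS3Pow
    have hfx : f 0 = x := by simp [f, expS3Pow_zero]
    have hv' : mfderiv 𝓘(ℝ, LieAlg ν) (modelS3Pow ν) f 0 c = v := by
      have h1 := coframe_mul_exp x c
      rw [expS3Pow_zero, mul_one] at h1
      exact coframe_injective x h1
    have hconst : (fun t : ℝ => ((f (ℓ t) : S3Pow ν) : S3Pow ν ⧸ H)) =
        fun _ => (x : S3Pow ν ⧸ H) := by
      funext t
      exact QuotientGroup.mk_mul_of_mem _ ((mem_lieAlgOf hH c).1 hv t)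
    have h1 := mfderiv_comp_apply_of_eq (I := 𝓘(ℝ, ℝ)) (f := fun t => f (ℓ t)) (0 : ℝ)
      ((hmk x).mdifferentiableAt (by simp))
      ((hf.comp ℓ.contMDiff 0).mdifferentiableAt (by simp)) (by simp [hfx]) (1 : ℝ)
    have h2 := mfderiv_comp_apply_of_eq (I := 𝓘(ℝ, ℝ)) (I' := 𝓘(ℝ, LieAlg ν)) (f := ℓ) (0 : ℝ)
      ((hf 0).mdifferentiableAt (by simp)) (ℓ.contMDiff.mdifferentiable (n := ∞) (by simp) 0)
      (map_zero ℓ) (1 : ℝ)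
    have h3 : mfderiv 𝓘(ℝ, ℝ) 𝓘(ℝ, LieAlg ν) ℓ 0 (1 : ℝ) = c := by
      rw [mfderiv_eq_fderiv, ℓ.fderiv]; exact one_smul ℝ c
    have h4 : mfderiv 𝓘(ℝ, ℝ) (modelS3Pow ν) (fun t => f (ℓ t)) 0 (1 : ℝ) = v :=
      h2.trans ((congrArg _ h3).trans hv')
    have h5 : mfderiv 𝓘(ℝ, ℝ) J (fun t : ℝ => ((f (ℓ t) : S3Pow ν) : S3Pow ν ⧸ H)) 0 (1 : ℝ) =
        (0 : E') := by
      rw [hconst, mfderiv_const]; rfl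
    exact (congrArg _ h4.symm).trans (h1.symm.trans h5)

end QuotientManifold

/-! ### The metric of `G/H` -/

section QuotientMetric

variable {ν : ℕ} {H : Subgroup (S3Pow ν)}

/-- The `ε`-orthogonal complement of the Lie algebra of `H`. -/
def perpAlg (ε : Fin ν → ℤˣ) (H : Subgroup (S3Pow ν)) : Submodule ℝ (LieAlg ν) where
  carrier := {c | ∀ d ∈ lieAlgOf H, prodInner ε c d = 0}
  add_mem' {a b} ha hb d hd := by
    rw [← prodInnerL_apply, map_add, add_apply, prodInnerL_apply, prodInnerL_apply, ha d hd,
      hb d hd, add_zero]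
  zero_mem' d _ := by rw [← prodInnerL_apply, map_zero, zero_apply]
  smul_mem' r c hc d hd := by
    rw [← prodInnerL_apply, map_smul, smul_apply, prodInnerL_apply, hc d hd, smul_zero]

theorem isCompl_perpAlg {ε : Fin ν → ℤˣ} (h : NondegenerateOn ε H) :
    IsCompl (perpAlg ε H) (lieAlgOf H) := by
  let B : LinearMap.BilinForm ℝ (LieAlg ν) := LinearMap.mk₂ ℝ (prodInner ε)
    (fun a b c => by rw [← prodInnerL_apply, map_add]; rfl)
    (fun r a c => by rw [← prodInnerL_apply, map_smul]; rfl)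
    (fun a b c => by rw [← prodInnerL_apply, map_add]; rfl)
    (fun r a c => by rw [← prodInnerL_apply, map_smul]; rfl)
  have hBs : B.IsSymm := ⟨fun a b => prodInner_comm ε a b⟩
  have hB : B.IsRefl := hBs.isRefl
  have h1 : (B.restrict (lieAlgOf H)).Nondegenerate := by
    refine (LinearMap.IsRefl.nondegenerate_iff_separatingLeft (hBs.restrict _).isRefl).2 ?_
    intro c hc
    exact Subtype.ext (h c c.2 fun d hd => hc ⟨d, hd⟩)
  have h2 := (LinearMap.BilinForm.restrict_nondegenerate_iff_isCompl_orthogonal hB).1 h1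
  have h3 : B.orthogonal (lieAlgOf H) = perpAlg ε H := by
    ext c
    refine forall₂_congr fun d hd => ?_
    change prodInner ε d c = 0 ↔ _
    rw [prodInner_comm]
  rw [h3] at h2
  exact h2.symm

/-- The projection of `𝔤` onto the complement of the Lie algebra of `H`. -/
def perpProj {ε : Fin ν → ℤˣ} (h : NondegenerateOn ε H) : LieAlg ν →L[ℝ] LieAlg ν :=
  LinearMap.toContinuousLinearMap
    ((perpAlg ε H).subtype ∘ₗ Submodule.projectionOnto _ _ (isCompl_perpAlg h))

theorem perpProj_mem {ε : Fin ν → ℤˣ} (h : NondegenerateOn ε H) (c : LieAlg ν) :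
    perpProj h c ∈ perpAlg ε H := Subtype.prop _

theorem perpProj_of_mem {ε : Fin ν → ℤˣ} (h : NondegenerateOn ε H) {c : LieAlg ν}
    (hc : c ∈ perpAlg ε H) : perpProj h c = c :=
  congrArg Subtype.val (Submodule.projectionOnto_apply_left (isCompl_perpAlg h) ⟨c, hc⟩)

theorem perpProj_eq_zero {ε : Fin ν → ℤˣ} (h : NondegenerateOn ε H) {c : LieAlg ν} :
    perpProj h c = 0 ↔ c ∈ lieAlgOf H := by
  rw [← Submodule.projectionOnto_apply_eq_zero_iff (isCompl_perpAlg h), ← Submodule.coe_eq_zero]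
  rfl

theorem perpProj_eq {ε : Fin ν → ℤˣ} (h : NondegenerateOn ε H) {c d : LieAlg ν}
    (hd : d ∈ perpAlg ε H) (hcd : c - d ∈ lieAlgOf H) : perpProj h c = d := by
  rw [← perpProj_eq_zero h, map_sub, perpProj_of_mem h hd, sub_eq_zero] at hcd
  exact hcd

theorem sub_perpProj_mem {ε : Fin ν → ℤˣ} (h : NondegenerateOn ε H) (c : LieAlg ν) :
    c - perpProj h c ∈ lieAlgOf H := by
  rw [← perpProj_eq_zero h, map_sub, perpProj_of_mem h (perpProj_mem h c), sub_self]

theorem eq_zero_of_mem_perpAlg {ε : Fin ν → ℤˣ} (h : NondegenerateOn ε H)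
    (c : LieAlg ν) (hc : c ∈ perpAlg ε H) (hd : ∀ d ∈ perpAlg ε H, prodInner ε c d = 0) :
    c = 0 := by
  refine prodInner_nondegenerate ε fun d => ?_
  rw [← add_sub_cancel (perpProj h d) d, ← prodInnerL_apply, map_add, prodInnerL_apply,
    prodInnerL_apply, hd _ (perpProj_mem h d), hc _ (sub_perpProj_mem h d), add_zero]

variable {E' : Type*} [NormedAddCommGroup E'] [NormedSpace ℝ E']
    {H' : Type*} [TopologicalSpace H'] {J : ModelWithCorners ℝ E' H'}
    [ChartedSpace H' (S3Pow ν ⧸ H)]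

/-- Right translation by an element of `H` does not change the projection. -/
theorem mfderiv_mk_mul_right
    (hmk : ContMDiff (modelS3Pow ν) J ∞ (QuotientGroup.mk : S3Pow ν → S3Pow ν ⧸ H))
    {a : S3Pow ν} (ha : a ∈ H) (x : S3Pow ν) (v : TangentSpace (modelS3Pow ν) x) :
    (mfderiv (modelS3Pow ν) J (QuotientGroup.mk : S3Pow ν → S3Pow ν ⧸ H) (x * a)
      (mfderiv (modelS3Pow ν) (modelS3Pow ν) (fun y => y * a) x v) : E') =
    mfderiv (modelS3Pow ν) J (QuotientGroup.mk : S3Pow ν → S3Pow ν ⧸ H) x v := by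
  have h1 := mfderiv_comp_apply x (f := fun y => y * a)
    ((hmk (x * a)).mdifferentiableAt (by simp))
    ((contMDiff_mul_right_S3Pow a x).mdifferentiableAt (by simp)) v
  have h2 : (QuotientGroup.mk : S3Pow ν → S3Pow ν ⧸ H) ∘ (fun y => y * a) = QuotientGroup.mk :=
    funext fun y => QuotientGroup.mk_mul_of_mem y ha
  rw [h2] at h1
  exact h1.symm

variable [J.Boundaryless] [FiniteDimensional ℝ E'] [IsManifold J ∞ (S3Pow ν ⧸ H)]

theorem mem_horizontalSpace_mk (ε : Fin ν → ℤˣ)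
    (hH : IsClosed (H : Set (S3Pow ν)))
    (hmk : ContMDiff (modelS3Pow ν) J ∞ (QuotientGroup.mk : S3Pow ν → S3Pow ν ⧸ H))
    (hsurj : ∀ x, Function.Surjective
      (mfderiv (modelS3Pow ν) J (QuotientGroup.mk : S3Pow ν → S3Pow ν ⧸ H) x))
    (x : S3Pow ν) (v : TangentSpace (modelS3Pow ν) x) :
    v ∈ horizontalSpace J (prodMetric ε) (QuotientGroup.mk : S3Pow ν → S3Pow ν ⧸ H) x ↔
      coframe x v ∈ perpAlg ε H := by
  constructor
  · intro hv d hd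
    have := hv ((coframe x).inverse d) ((mem_verticalSpace_mk hH hmk hsurj x _).2
      (by rwa [coframe_inverse_apply]))
    rwa [prodMetric_apply, coframe_inverse_apply] at this
  · intro hv w hw
    rw [prodMetric_apply]
    exact hv _ ((mem_verticalSpace_mk hH hmk hsurj x w).1 hw)

/-- Right translations have injective, hence surjective derivatives, as they are isometries. -/
theorem surjective_mfderiv_mul_right (a x : S3Pow ν) : Function.Surjective
    (mfderiv (modelS3Pow ν) (modelS3Pow ν) (fun y : S3Pow ν => y * a) x) := by
  let R : (Fin ν → EuclideanSpace ℝ (Fin 3)) →ₗ[ℝ] (Fin ν → EuclideanSpace ℝ (Fin 3)) :=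
    (mfderiv (modelS3Pow ν) (modelS3Pow ν) (fun y : S3Pow ν => y * a) x).toLinearMap
  refine LinearMap.injective_iff_surjective (f := R).1 ?_
  rw [injective_iff_map_eq_zero]
  intro v hv
  refine (isPseudoRiemannianMetric_prodMetric 1).nondegenerate x v fun w => ?_
  refine (prodMetric_mul_right 1 a x v w).symm.trans ?_
  refine (congrArg (fun A : TangentSpace (modelS3Pow ν) (x * a) →L[ℝ] ℝ => A _)
    (congrArg (prodMetric 1 (x * a)) hv)).trans ?_
  exact ContinuousLinearMap.map_zero₂ _ _

/-- The product of the horizontal parts of two tangent vectors depends only on their images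
in the coset space. -/
theorem prodInner_perpProj_congr {ε : Fin ν → ℤˣ} (h : NondegenerateOn ε H)
    (hH : IsClosed (H : Set (S3Pow ν)))
    (hmk : ContMDiff (modelS3Pow ν) J ∞ (QuotientGroup.mk : S3Pow ν → S3Pow ν ⧸ H))
    (hsurj : ∀ x, Function.Surjective
      (mfderiv (modelS3Pow ν) J (QuotientGroup.mk : S3Pow ν → S3Pow ν ⧸ H) x))
    {x y : S3Pow ν} (hxy : (x : S3Pow ν ⧸ H) = y) {v w : TangentSpace (modelS3Pow ν) x}
    {v' w' : TangentSpace (modelS3Pow ν) y}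
    (hv : (mfderiv (modelS3Pow ν) J (QuotientGroup.mk : S3Pow ν → S3Pow ν ⧸ H) x v : E') =
      mfderiv (modelS3Pow ν) J (QuotientGroup.mk : S3Pow ν → S3Pow ν ⧸ H) y v')
    (hw : (mfderiv (modelS3Pow ν) J (QuotientGroup.mk : S3Pow ν → S3Pow ν ⧸ H) x w : E') =
      mfderiv (modelS3Pow ν) J (QuotientGroup.mk : S3Pow ν → S3Pow ν ⧸ H) y w') :
    prodInner ε (perpProj h (coframe x v)) (perpProj h (coframe x w)) =
      prodInner ε (perpProj h (coframe y v')) (perpProj h (coframe y w')) := by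
  obtain ⟨a, ha, rfl⟩ : ∃ a ∈ H, x * a = y := ⟨x⁻¹ * y, QuotientGroup.eq.1 hxy, by group⟩
  let R : TangentSpace (modelS3Pow ν) x → TangentSpace (modelS3Pow ν) (x * a) :=
    mfderiv (modelS3Pow ν) (modelS3Pow ν) (fun y => y * a) x
  -- the translate of the horizontal part of `v` is horizontal and has the same image as `v'`
  have key : ∀ (u : TangentSpace (modelS3Pow ν) x) (u' : TangentSpace (modelS3Pow ν) (x * a)),
      (mfderiv (modelS3Pow ν) J (QuotientGroup.mk : S3Pow ν → S3Pow ν ⧸ H) x u : E') =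
        mfderiv (modelS3Pow ν) J (QuotientGroup.mk : S3Pow ν → S3Pow ν ⧸ H) (x * a) u' →
      perpProj h (coframe (x * a) u') =
        coframe (x * a) (R ((coframe x).inverse (perpProj h (coframe x u)))) := by
    intro u u' hu
    set p := QuotientGroup.mk (s := H) with hp
    set z : TangentSpace (modelS3Pow ν) x := (coframe x).inverse (perpProj h (coframe x u)) with hz
    have hzθ : coframe x z = perpProj h (coframe x u) := coframe_inverse_apply x _
    refine perpProj_eq h (fun d hd => ?_) ?_
    · obtain ⟨w₀, hw₀⟩ := surjective_mfderiv_mul_right a x ((coframe (x * a)).inverse d)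
      have h1 : coframe x w₀ ∈ lieAlgOf H := by
        rw [← mem_verticalSpace_mk hH hmk hsurj]
        refine (mfderiv_mk_mul_right hmk ha x w₀).symm.trans ?_
        rw [hw₀]
        refine (mem_verticalSpace_mk hH hmk hsurj _ _).2 ?_
        rwa [coframe_inverse_apply]
      have h2 : coframe (x * a) (R w₀) = d := by
        refine (congrArg _ hw₀).trans (coframe_inverse_apply _ _)
      rw [← h2, ← prodMetric_apply]
      refine (prodMetric_mul_right ε a x z w₀).trans ?_
      rw [prodMetric_apply, hzθ]
      exact perpProj_mem h _ _ h1
    · rw [← map_sub, ← mem_verticalSpace_mk hH hmk hsurj]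
      have h1 : u - z ∈ verticalSpace (modelS3Pow ν) J p x := by
        rw [mem_verticalSpace_mk hH hmk hsurj, map_sub, hzθ]
        exact sub_perpProj_mem h _
      have h2 : (mfderiv (modelS3Pow ν) J p x u : E') = mfderiv (modelS3Pow ν) J p x z :=
        sub_eq_zero.1 ((map_sub (mfderiv (modelS3Pow ν) J p x) u z).symm.trans h1)
      refine (map_sub (mfderiv (modelS3Pow ν) J p (x * a)) u' (R z)).trans (sub_eq_zero.2 ?_)
      exact hu.symm.trans (h2.trans (mfderiv_mk_mul_right hmk ha x z).symm)
  rw [key v v' hv, key w w' hw, ← prodMetric_apply, prodMetric_mul_right, prodMetric_apply,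
    coframe_inverse_apply, coframe_inverse_apply]

/-- The pull-back of `⟨·,·⟩` under a linear map into `𝔤`. -/
def pullForm (ε : Fin ν → ℤˣ) {V : Type*} [AddCommGroup V] [Module ℝ V] [TopologicalSpace V]
    [IsTopologicalAddGroup V] [ContinuousSMul ℝ V]
    (θ : V →L[ℝ] LieAlg ν) : V →L[ℝ] V →L[ℝ] ℝ :=
  ∑ k, ((ε k : ℤ) : ℝ) • ∑ a,
    (((ContinuousLinearMap.proj a).comp (ContinuousLinearMap.proj k)).comp θ).smulRight
    (((ContinuousLinearMap.proj a).comp (ContinuousLinearMap.proj k)).comp θ)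

theorem pullForm_apply (ε : Fin ν → ℤˣ) {V : Type*} [AddCommGroup V] [Module ℝ V]
    [TopologicalSpace V] [IsTopologicalAddGroup V] [ContinuousSMul ℝ V]
    (θ : V →L[ℝ] LieAlg ν) (v w : V) : pullForm ε θ v w = prodInner ε (θ v) (θ w) := by
  simp [pullForm, prodInner]

theorem pullForm_congr (ε : Fin ν → ℤˣ) {V : Type*} [AddCommGroup V] [Module ℝ V]
    [TopologicalSpace V] [IsTopologicalAddGroup V] [ContinuousSMul ℝ V]
    {θ θ' : V →L[ℝ] LieAlg ν} (h : ∀ v w, prodInner ε (θ v) (θ w) = prodInner ε (θ' v) (θ' w)) :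
    pullForm ε θ = pullForm ε θ' := by
  ext v w
  rw [pullForm_apply, pullForm_apply, h]

/-- The pull-back under a smooth map into `(S³)^ν` of a left-invariant field of bilinear forms is
smooth. -/
theorem contMDiffAt_pullForm_mfderiv {E : Type*} [NormedAddCommGroup E] [NormedSpace ℝ E]
    {H : Type*} [TopologicalSpace H] {I : ModelWithCorners ℝ E H}
    {M : Type*} [TopologicalSpace M] [ChartedSpace H M] [IsManifold I ∞ M] (ε : Fin ν → ℤˣ)
    (P : LieAlg ν →L[ℝ] LieAlg ν) {s : M → S3Pow ν}
    {x : M} (hs : ContMDiffAt I (modelS3Pow ν) ∞ s x) :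
    ContMDiffAt I (I.prod 𝓘(ℝ, E →L[ℝ] E →L[ℝ] ℝ)) ∞
      (fun y => TotalSpace.mk' (E →L[ℝ] E →L[ℝ] ℝ)
        (E := fun y : M => TangentSpace I y →L[ℝ] TangentSpace I y →L[ℝ] ℝ) y
        (pullForm ε (P ∘L coframe (s y) ∘L mfderiv I (modelS3Pow ν) s y))) x :=
  contMDiffAt_prodInner_comp ε
    (hs.coframe_mfderiv.clm_comp_section (Φ := fun _ => P) contMDiffAt_const)

/-- At each point of `G/H` the horizontal lift followed by the left-invariant trivialization is a
linear map into `𝔤`. It depends on the point of the fibre to which one lifts, but the inner products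
of its values do not. -/
theorem exists_quotientForm {ε : Fin ν → ℤˣ} (h : NondegenerateOn ε H)
    (hH : IsClosed (H : Set (S3Pow ν)))
    (hmk : ContMDiff (modelS3Pow ν) J ∞ (QuotientGroup.mk : S3Pow ν → S3Pow ν ⧸ H))
    (hsurj : ∀ x, Function.Surjective
      (mfderiv (modelS3Pow ν) J (QuotientGroup.mk : S3Pow ν → S3Pow ν ⧸ H) x))
    (q : S3Pow ν ⧸ H) : ∃ θ : TangentSpace J q →L[ℝ] LieAlg ν, ∀ (x : S3Pow ν)
      (_ : (x : S3Pow ν ⧸ H) = q) (v w : TangentSpace (modelS3Pow ν) x),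
      prodInner ε
        (θ (mfderiv (modelS3Pow ν) J (QuotientGroup.mk : S3Pow ν → S3Pow ν ⧸ H) x v : E'))
        (θ (mfderiv (modelS3Pow ν) J (QuotientGroup.mk : S3Pow ν → S3Pow ν ⧸ H) x w : E')) =
        prodInner ε (perpProj h (coframe x v)) (perpProj h (coframe x w)) := by
  obtain ⟨y, rfl⟩ := QuotientGroup.mk_surjective q
  let D : (Fin ν → EuclideanSpace ℝ (Fin 3)) →ₗ[ℝ] E' :=
    (mfderiv (modelS3Pow ν) J (QuotientGroup.mk : S3Pow ν → S3Pow ν ⧸ H) y).toLinearMap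
  obtain ⟨R, hR⟩ := D.exists_rightInverse_of_surjective (LinearMap.range_eq_top.2 (hsurj y))
  let R' : E' →L[ℝ] TangentSpace (modelS3Pow ν) y := LinearMap.toContinuousLinearMap R
  refine ⟨(perpProj h ∘L coframe y) ∘L R', fun x hx v w => ?_⟩
  have hR' : ∀ u, (mfderiv (modelS3Pow ν) J (QuotientGroup.mk : S3Pow ν → S3Pow ν ⧸ H) y
    (R' u) : E') = u := fun u => LinearMap.congr_fun hR u
  exact (prodInner_perpProj_congr h hH hmk hsurj hx (hR' _).symm (hR' _).symm).symm

/-- The metric of the coset space: the product of two tangent vectors of `G/H` is that of their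
horizontal lifts. -/
theorem exists_quotientMetric {ε : Fin ν → ℤˣ} (h : NondegenerateOn ε H)
    (hH : IsClosed (H : Set (S3Pow ν)))
    (hmk : ContMDiff (modelS3Pow ν) J ∞ (QuotientGroup.mk : S3Pow ν → S3Pow ν ⧸ H))
    (hsurj : ∀ x, Function.Surjective
      (mfderiv (modelS3Pow ν) J (QuotientGroup.mk : S3Pow ν → S3Pow ν ⧸ H) x)) :
    ∃ g : BilinField J (S3Pow ν ⧸ H), SmoothBilin g ∧
      ∀ (x : S3Pow ν) (v w : TangentSpace (modelS3Pow ν) x), g x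
        (mfderiv (modelS3Pow ν) J (QuotientGroup.mk : S3Pow ν → S3Pow ν ⧸ H) x v)
        (mfderiv (modelS3Pow ν) J (QuotientGroup.mk : S3Pow ν → S3Pow ν ⧸ H) x w) =
        prodInner ε (perpProj h (coframe x v)) (perpProj h (coframe x w)) := by
  choose θ hθ using exists_quotientForm h hH hmk hsurj
  refine ⟨fun q => pullForm ε (θ q), ?_, fun x v w =>
    (pullForm_apply ε (θ (x : S3Pow ν ⧸ H)) _ _).trans (hθ _ x rfl v w)⟩
  intro q
  obtain ⟨x, rfl⟩ := QuotientGroup.mk_surjective q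
  obtain ⟨s, hsx, hs, hps⟩ := (hmk x).exists_localSection (hsurj x)
  have hM : IsManifold J 1 (S3Pow ν ⧸ H) := IsManifold.of_le (n := ∞) (by norm_cast)
  have hs1 : ∀ᶠ q in 𝓝 (x : S3Pow ν ⧸ H), ContMDiffAt J (modelS3Pow ν) 1 s q :=
    (contMDiffAt_iff_contMDiffAt_nhds (by simp)).1 (hs.of_le (by norm_cast))
  refine (contMDiffAt_pullForm_mfderiv ε (perpProj h) hs).congr_of_eventuallyEq ?_
  filter_upwards [hps.eventually_nhds, hs1] with q hq hsq
  have hd : ∀ u : TangentSpace J q, (mfderiv (modelS3Pow ν) J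
      (QuotientGroup.mk : S3Pow ν → S3Pow ν ⧸ H) (s q)
        (mfderiv J (modelS3Pow ν) s q u) : E') = u := by
    intro u
    have h2 := mfderiv_comp_apply q ((hmk (s q)).mdifferentiableAt (by simp))
      (hsq.mdifferentiableAt (by simp)) u
    have hq' : QuotientGroup.mk (s := H) ∘ s =ᶠ[𝓝 q] id := hq
    rw [hq'.mfderiv_eq, mfderiv_id] at h2
    exact h2.symm
  refine congrArg (TotalSpace.mk' _ q) (pullForm_congr ε fun v w => ?_)
  have h3 := hθ q (s q) hq.self_of_nhds (mfderiv J (modelS3Pow ν) s q v)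
    (mfderiv J (modelS3Pow ν) s q w)
  rw [hd, hd] at h3
  exact h3

/-- The coset space of a closed subgroup with non-degenerate Lie algebra. -/
theorem nonempty_cosetGeometry {ε : Fin ν → ℤˣ} (hH : IsClosed (H : Set (S3Pow ν)))
    (h : NondegenerateOn ε H) : Nonempty (CosetGeometry ε H) := by
  obtain ⟨S⟩ := nonempty_cosetSlice hH
  let := S.chartedSpace
  have := S.isManifold
  have hmk := S.contMDiff_mk
  have hsurj := S.surjective_mfderiv_mk
  obtain ⟨g, hg, hgx⟩ := exists_quotientMetric h hH hmk hsurj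
  refine ⟨⟨S.dim, S.chartedSpace, S.isManifold, g, isPseudoRiemannianMetric_prodMetric ε,
    ⟨hg, ?_, ?_⟩, hmk, hsurj, ?_, ?_⟩⟩
  · intro q v w
    obtain ⟨x, rfl⟩ := QuotientGroup.mk_surjective q
    obtain ⟨v, rfl⟩ := hsurj x v
    obtain ⟨w, rfl⟩ := hsurj x w
    rw [hgx, hgx, prodInner_comm]
  · intro q v hv
    obtain ⟨x, rfl⟩ := QuotientGroup.mk_surjective q
    obtain ⟨v, rfl⟩ := hsurj x v
    have h1 : perpProj h (coframe x v) = 0 := by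
      refine eq_zero_of_mem_perpAlg h _ (perpProj_mem h _) fun d hd => ?_
      have := hv (mfderiv (modelS3Pow ν) (𝓡 S.dim)
        (QuotientGroup.mk : S3Pow ν → S3Pow ν ⧸ H) x ((coframe x).inverse d))
      rwa [hgx, coframe_inverse_apply, perpProj_of_mem h hd] at this
    rw [perpProj_eq_zero h, ← mem_verticalSpace_mk hH hmk hsurj] at h1
    exact h1
  · intro x v hv hvw
    rw [mem_verticalSpace_mk hH hmk hsurj] at hv
    refine coframe_injective x ?_
    rw [map_zero]
    refine h _ hv fun d hd => ?_
    have := hvw ((coframe x).inverse d) ((mem_verticalSpace_mk hH hmk hsurj _ _).2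
      (by rwa [coframe_inverse_apply]))
    rwa [prodMetric_apply, coframe_inverse_apply] at this
  · intro x v hv w hw
    rw [mem_horizontalSpace_mk ε hH hmk hsurj] at hv hw
    rw [hgx, perpProj_of_mem h hv, perpProj_of_mem h hw, prodMetric_apply]

end QuotientMetric

/-! ### Left-invariant structures and the projection to `G/H` -/

section InvariantStructures

variable {ν : ℕ} {H : Subgroup (S3Pow ν)} {ε : Fin ν → ℤˣ}

theorem nondegenerateOn_one (hε : ∀ k, ε k = 1) : NondegenerateOn ε H := by
  obtain rfl : ε = fun _ => 1 := funext hε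
  intro c hc h
  by_contra hne
  exact (prodInner_one_pos hne).ne' (h c hc)

theorem prodInner_add_left (c c' d : LieAlg ν) :
    prodInner ε (c + c') d = prodInner ε c d + prodInner ε c' d := by
  rw [← prodInnerL_apply, map_add]; rfl

theorem prodInner_add_right (c d d' : LieAlg ν) :
    prodInner ε c (d + d') = prodInner ε c d + prodInner ε c d' := by
  rw [← prodInnerL_apply, map_add]; rfl

theorem prodInner_smul_left (r : ℝ) (c d : LieAlg ν) :
    prodInner ε (r • c) d = r * prodInner ε c d := by
  rw [← prodInnerL_apply, map_smul]; rfl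

theorem prodInner_smul_right (r : ℝ) (c d : LieAlg ν) :
    prodInner ε c (r • d) = r * prodInner ε c d := by
  rw [← prodInnerL_apply, map_smul]; rfl

namespace CosetGeometry

variable (Q : CosetGeometry ε H)

theorem mem_vertical (hH : IsClosed (H : Set (S3Pow ν))) (x : S3Pow ν)
    (v : TangentSpace (modelS3Pow ν) x) :
    v ∈ verticalSpace (modelS3Pow ν) (𝓡 Q.dim) Q.proj x ↔ coframe x v ∈ lieAlgOf H :=
  mem_verticalSpace_mk hH Q.submersion.smooth Q.submersion.submersion x v

theorem mem_horizontal (hH : IsClosed (H : Set (S3Pow ν))) (x : S3Pow ν)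
    (v : TangentSpace (modelS3Pow ν) x) :
    v ∈ horizontalSpace (𝓡 Q.dim) (prodMetric ε) Q.proj x ↔ coframe x v ∈ perpAlg ε H :=
  mem_horizontalSpace_mk ε hH Q.submersion.smooth Q.submersion.submersion x v

/-- For a positive definite metric on `G` the metric of `G/H` is positive definite: a tangent
vector of `G/H` has the length of its horizontal lift. -/
theorem isRiemannianSubmersion (hH : IsClosed (H : Set (S3Pow ν))) (hε : ∀ k, ε k = 1) :
    IsRiemannianSubmersion (prodMetric ε) Q.metric Q.proj := by
  obtain rfl : ε = fun _ => 1 := funext hε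
  have h := nondegenerateOn_one (H := H) (ε := fun _ => 1) fun _ => rfl
  refine ⟨Q.submersion, isRiemannianMetric_prodMetric, ⟨Q.submersion.metric_target, ?_⟩⟩
  intro q w hw
  obtain ⟨x, rfl⟩ := QuotientGroup.mk_surjective q
  obtain ⟨v, rfl⟩ := Q.submersion.submersion x w
  set u : TangentSpace (modelS3Pow ν) x := (coframe x).inverse (perpProj h (coframe x v)) with hu
  have huθ : coframe x u = perpProj h (coframe x v) := coframe_inverse_apply _ _
  have hvu : v - u ∈ verticalSpace (modelS3Pow ν) (𝓡 Q.dim) Q.proj x := by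
    rw [Q.mem_vertical hH, map_sub, huθ]
    exact sub_perpProj_mem h _
  have h1 : mfderiv (modelS3Pow ν) (𝓡 Q.dim) Q.proj x v =
      mfderiv (modelS3Pow ν) (𝓡 Q.dim) Q.proj x u :=
    sub_eq_zero.1 ((map_sub (mfderiv (modelS3Pow ν) (𝓡 Q.dim) Q.proj x) v u).symm.trans hvu)
  have hhor : u ∈ horizontalSpace (𝓡 Q.dim) (prodMetric fun _ => 1) Q.proj x := by
    rw [Q.mem_horizontal hH, huθ]
    exact perpProj_mem h _
  rw [h1] at hw ⊢
  rw [Q.submersion.isometry x u hhor u hhor]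
  refine isRiemannianMetric_prodMetric.pos x u ?_
  rintro h0
  exact hw (by rw [h0, map_zero])

/-- For a left-invariant endomorphism, anti-invariance is a condition on `𝔥` alone. -/
theorem isAntiInvariant_leftInvEnd (hH : IsClosed (H : Set (S3Pow ν)))
    {j : LieAlg ν →ₗ[ℝ] LieAlg ν}
    (hj : ∀ c ∈ lieAlgOf H, ∀ d ∈ lieAlgOf H, prodInner ε (j c) d = 0) :
    IsAntiInvariant (𝓡 Q.dim) (prodMetric ε) Q.proj (leftInvEnd j) := by
  intro x v hv
  rw [Q.mem_vertical hH] at hv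
  rw [Q.mem_horizontal hH, coframe_leftInvEnd]
  exact fun d hd => hj _ hv d hd

end CosetGeometry

theorem leftInvEnd_leftInvEnd (j j' : LieAlg ν →ₗ[ℝ] LieAlg ν) (x : S3Pow ν)
    (v : TangentSpace (modelS3Pow ν) x) :
    leftInvEnd j x (leftInvEnd j' x v) = leftInvEnd (j ∘ₗ j') x v := by
  rw [leftInvEnd_apply, coframe_leftInvEnd]; rfl

theorem isAlmostHermitian_leftInvEnd {j : LieAlg ν →ₗ[ℝ] LieAlg ν} (hj : ∀ c, j (j c) = -c)
    (hjε : ∀ c d, prodInner ε (j c) (j d) = prodInner ε c d) :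
    IsAlmostHermitian (prodMetric ε) (leftInvEnd j) where
  smooth := smoothEnd_leftInvEnd j
  sq x v := coframe_injective x (by
    rw [coframe_leftInvEnd, coframe_leftInvEnd, hj, map_neg])
  isometry x v w := by
    rw [prodMetric_apply, prodMetric_apply, coframe_leftInvEnd, coframe_leftInvEnd, hjε]

/-- A metric `⊕ ε k g_{S³}` is neutral as soon as some endomorphism of `𝔤` is anti-isometric: it
exchanges positive and negative definite subspaces. -/
theorem isNeutral_prodMetric {j : LieAlg ν →ₗ[ℝ] LieAlg ν}
    (hjε : ∀ c d, prodInner ε (j c) (j d) = -prodInner ε c d) : IsNeutral (prodMetric ε) := by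
  let P : Submodule ℝ (LieAlg ν) := ⨅ k : {k // ε k ≠ 1}, LinearMap.ker (LinearMap.proj k.1)
  let N : Submodule ℝ (LieAlg ν) := ⨅ k : {k // ε k = 1}, LinearMap.ker (LinearMap.proj k.1)
  have hP : ∀ c, c ∈ P ↔ ∀ k, ε k ≠ 1 → c k = 0 := fun c => by simp [P]
  have hN : ∀ c, c ∈ N ↔ ∀ k, ε k = 1 → c k = 0 := fun c => by simp [N]
  have hPN : IsCompl P N := by
    refine ⟨Submodule.disjoint_def.2 fun c hc hd => ?_, Submodule.codisjoint_iff_exists_add_eq.2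
      fun c => ?_⟩
    · funext k
      by_cases hk : ε k = 1
      · exact (hN c).1 hd k hk
      · exact (hP c).1 hc k hk
    · refine ⟨fun k => if ε k = 1 then c k else 0, fun k => if ε k = 1 then 0 else c k,
        (hP _).2 fun k hk => by simp [hk], (hN _).2 fun k hk => by simp [hk], ?_⟩
      funext k
      by_cases hk : ε k = 1 <;> simp [hk]
  have hpos : ∀ c ∈ P, c ≠ 0 → 0 < prodInner ε c c := by
    intro c hc hne
    have : prodInner ε c c = prodInner (fun _ => 1) c c := by
      refine Finset.sum_congr rfl fun k _ => ?_
      by_cases hk : ε k = 1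
      · simp [hk]
      · simp [(hP c).1 hc k hk]
    rw [this]
    exact prodInner_one_pos hne
  have hneg : ∀ c ∈ N, c ≠ 0 → prodInner ε c c < 0 := by
    intro c hc hne
    have : prodInner ε c c = -prodInner (fun _ => 1) c c := by
      rw [prodInner, prodInner, ← Finset.sum_neg_distrib]
      refine Finset.sum_congr rfl fun k _ => ?_
      rcases Int.units_eq_one_or (ε k) with hk | hk
      · simp [(hN c).1 hc k hk]
      · simp [hk]
    rw [this]
    exact neg_neg_of_pos (prodInner_one_pos hne)
  have horth : ∀ c ∈ P, ∀ d ∈ N, prodInner ε c d = 0 := by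
    intro c hc d hd
    refine Finset.sum_eq_zero fun k _ => ?_
    by_cases hk : ε k = 1
    · simp [(hN d).1 hd k hk]
    · simp [(hP c).1 hc k hk]
  have hji : Function.Injective j := by
    rw [injective_iff_map_eq_zero]
    intro c hc
    refine prodInner_nondegenerate ε fun d => ?_
    rw [← neg_eq_zero, ← hjε, hc, ← prodInnerL_apply, map_zero, zero_apply]
  have hdim := Submodule.finrank_add_eq_of_isCompl hPN
  have hle : ∀ W : Submodule ℝ (LieAlg ν), Disjoint W (W.map j) →
      Module.finrank ℝ W + Module.finrank ℝ W ≤ Module.finrank ℝ (LieAlg ν) := by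
    intro W hW
    have h1 := Submodule.finrank_add_finrank_le_of_disjoint hW
    rwa [← LinearEquiv.finrank_eq (Submodule.equivMapOfInjective j hji W)] at h1
  -- `j` maps `P` to a negative definite and `N` to a positive definite subspace
  have h1 := hle P (Submodule.disjoint_def.2 fun c hc hc' => by
    obtain ⟨d, hd, rfl⟩ := hc'
    by_contra hne
    have h2 := hpos _ hc hne
    rw [hjε] at h2
    have h3 := hpos d hd (by rintro rfl; exact hne (map_zero j))
    linarith)
  have h2 := hle N (Submodule.disjoint_def.2 fun c hc hc' => by
    obtain ⟨d, hd, rfl⟩ := hc'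
    by_contra hne
    have h2 := hneg _ hc hne
    rw [hjε] at h2
    have h3 := hneg d hd (by rintro rfl; exact hne (map_zero j))
    linarith)
  intro x
  obtain ⟨e, he⟩ := coframe_isInvertible x
  have hex : ∀ v, e v = coframe x v := fun v => by rw [← he]; rfl
  let e' : TangentSpace (modelS3Pow ν) x ≃ₗ[ℝ] LieAlg ν := e.toLinearEquiv
  have hex' : ∀ v, e' v = coframe x v := hex
  have hne : ∀ v, v ≠ 0 → coframe x v ≠ 0 := fun v hv h0 =>
    hv (coframe_injective x (h0.trans (map_zero _).symm))
  refine ⟨P.comap e'.toLinearMap, N.comap e'.toLinearMap, ?_, ?_, ?_, ?_, ?_⟩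
  · exact (Submodule.orderIsoMapComap e').symm.isCompl hPN
  · rw [Submodule.comap_equiv_eq_map_symm, Submodule.comap_equiv_eq_map_symm,
      LinearEquiv.finrank_map_eq, LinearEquiv.finrank_map_eq]
    omega
  · intro v hv hv0
    rw [prodMetric_apply]
    refine hpos _ ?_ (hne v hv0)
    rw [← hex']; exact hv
  · intro v hv hv0
    rw [prodMetric_apply]
    refine hneg _ ?_ (hne v hv0)
    rw [← hex']; exact hv
  · intro v hv w hw
    rw [prodMetric_apply, ← hex', ← hex']
    exact horth _ hv _ hw

theorem isParaHermitian_leftInvEnd {j : LieAlg ν →ₗ[ℝ] LieAlg ν} (hj : ∀ c, j (j c) = c)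
    (hjε : ∀ c d, prodInner ε (j c) (j d) = -prodInner ε c d) :
    IsParaHermitian (prodMetric ε) (leftInvEnd j) where
  neutral := isNeutral_prodMetric hjε
  smooth := smoothEnd_leftInvEnd j
  sq x v := coframe_injective x (by
    rw [coframe_leftInvEnd, coframe_leftInvEnd, hj])
  antiisometry x v w := by
    rw [prodMetric_apply, prodMetric_apply, coframe_leftInvEnd, coframe_leftInvEnd, hjε]

/-- A left-invariant almost complex structure is integrable if and only if its Nijenhuis tensor
vanishes on `𝔤`. -/
theorem isIntegrable_leftInvEnd_iff {j : LieAlg ν →ₗ[ℝ] LieAlg ν} (hj : ∀ c, j (j c) = -c) :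
    IsIntegrable (leftInvEnd j) ↔
      ∀ a c, j (lieBr a c - lieBr (j a) (j c)) = lieBr a (j c) + lieBr (j a) c := by
  have hjK : ∀ {A B : VectField (modelS3Pow ν) (S3Pow ν)},
      (∀ x, leftInvEnd j x (A x) = -B x ∧ leftInvEnd j x (B x) = A x) →
      (fun y => coframe y (B y)) = fun y => -j (coframe y (A y)) := by
    intro A B h
    funext y
    rw [← coframe_leftInvEnd, (h y).1, map_neg, neg_neg]
  constructor
  · intro h a c
    -- the left-invariant sections of `T^{1,0}` are the fields `d - √-1 j d`
    have hs : ∀ d : LieAlg ν, SmoothVect (I := modelS3Pow ν)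
        (fun x => (coframe x).inverse d) := fun d => smoothVect_inverse_coframe contMDiff_const
    have hK : ∀ (d : LieAlg ν) (x : S3Pow ν),
        leftInvEnd j x ((coframe x).inverse d) = -(coframe x).inverse (-j d) ∧
        leftInvEnd j x ((coframe x).inverse (-j d)) = (coframe x).inverse d := by
      intro d x
      rw [leftInvEnd_apply, leftInvEnd_apply, coframe_inverse_apply, coframe_inverse_apply,
        map_neg, map_neg, hj, neg_neg, neg_neg]
      exact ⟨rfl, rfl⟩
    have h1 := congrArg (coframe 1) (h _ _ _ _ (hs a) (hs (-j a)) (hs c) (hs (-j c)) (hK a)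
      (hK c) 1).1
    have hbr : ∀ d e : LieAlg ν, coframe (1 : S3Pow ν) (VectorField.mlieBracket (modelS3Pow ν)
        (fun x => (coframe x).inverse d) (fun x => (coframe x).inverse e) 1) = lieBr d e := by
      intro d e
      have hc : ∀ d : LieAlg ν, (fun y : S3Pow ν => coframe y ((coframe y).inverse d)) =
          fun _ => d := fun d => funext fun y => coframe_inverse_apply y d
      have h0 : ∀ (d : LieAlg ν) (v : TangentSpace (modelS3Pow ν) (1 : S3Pow ν)),
          mvfderiv (modelS3Pow ν) (fun _ : S3Pow ν => d) 1 v = 0 := by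
        intro d v
        exact congrArg (fun A : (Fin ν → EuclideanSpace ℝ (Fin 3)) →L[ℝ] LieAlg ν => A v)
          (mfderiv_const (I := modelS3Pow ν) (I' := 𝓘(ℝ, LieAlg ν)))
      rw [coframe_mlieBracket (hs d) (hs e), hc, hc, h0, h0, coframe_inverse_apply,
        coframe_inverse_apply, sub_zero, zero_add]
    rw [coframe_leftInvEnd, map_sub, map_neg, map_add, hbr, hbr, hbr, hbr] at h1
    simp only [← lieBrL_apply, map_neg, neg_apply, neg_neg] at h1 ⊢
    rw [h1]
    abel
  · intro h A B C D hA hB hC hD hAB hCD x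
    -- in the Maurer–Cartan equation the derivatives of the components cancel, as `B = -j A`,
    -- `D = -j C`
    set a := coframe x (A x) with ha
    set c := coframe x (C x) with hc
    have hAd := (hA.coframe x).mdifferentiableAt (by simp)
    have hCd := (hC.coframe x).mdifferentiableAt (by simp)
    have hd : ∀ {A : VectField (modelS3Pow ν) (S3Pow ν)}, SmoothVect A →
        ∀ v : TangentSpace (modelS3Pow ν) x,
        mvfderiv (modelS3Pow ν) (fun y => -j (coframe y (A y))) x v =
          -j (mvfderiv (modelS3Pow ν) (fun y => coframe y (A y)) x v) := fun hA v =>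
      mvfderiv_clm_comp (-LinearMap.toContinuousLinearMap j)
        ((hA.coframe x).mdifferentiableAt (by simp)) v
    have key : leftInvEnd j x (VectorField.mlieBracket (modelS3Pow ν) A C x -
          VectorField.mlieBracket (modelS3Pow ν) B D x) =
        -(VectorField.mlieBracket (modelS3Pow ν) A D x +
          VectorField.mlieBracket (modelS3Pow ν) B C x) := by
      refine coframe_injective x ?_
      have hb : coframe x (B x) = -j a := congrFun (hjK hAB) x
      have hd' : coframe x (D x) = -j c := congrFun (hjK hCD) x
      rw [coframe_leftInvEnd, map_sub, map_neg, map_add, coframe_mlieBracket hA hC,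
        coframe_mlieBracket hB hD, coframe_mlieBracket hA hD, coframe_mlieBracket hB hC,
        hjK hAB, hjK hCD, hb, hd', ← ha, ← hc, hd hA, hd hA, hd hC, hd hC]
      have h1 := h a c
      simp only [← lieBrL_apply, map_neg, neg_apply, neg_neg, map_add, map_sub, hj] at h1 ⊢
      linear_combination (exp := 1) h1
    refine ⟨key, ?_⟩
    have h2 := congrArg (leftInvEnd j x) key
    refine coframe_injective x ?_
    have h3 := congrArg (coframe x) h2
    rw [coframe_leftInvEnd, coframe_leftInvEnd, hj, map_neg, map_neg, coframe_leftInvEnd,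
      neg_inj] at h3
    rw [coframe_leftInvEnd, h3]

end InvariantStructures

/-! ### The tori and the first factor of `S³ × S³` -/

section ConnectedSubgroups

variable {ν : ℕ}

/-- Near `1` the elements of `H` are exponentials of elements of its Lie algebra, so `H ∩ K` is open
and closed in `H`. -/
theorem le_of_lieAlgOf_le {H K : Subgroup (S3Pow ν)} (hH : IsClosed (H : Set (S3Pow ν)))
    (hK : IsClosed (K : Set (S3Pow ν))) (hHc : IsConnected (H : Set (S3Pow ν)))
    (h : lieAlgOf H ≤ lieAlgOf K) : H ≤ K := by
  obtain ⟨S⟩ := nonempty_cosetSlice hH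
  have : ConnectedSpace H := isConnected_iff_connectedSpace.1 hHc
  have h1 : ((K.subgroupOf H : Subgroup H) : Set H) ∈ 𝓝 (1 : H) := by
    have h2 : ∀ᶠ x : H in 𝓝 1, (x : S3Pow ν) ∈ H → ∃ c ∈ lieAlgOf H, (x : S3Pow ν) = expS3Pow c :=
      (continuous_subtype_val.tendsto (1 : H)).eventually S.eventually_mem
    filter_upwards [h2] with x hx
    obtain ⟨c, hc, hxc⟩ := hx x.2
    have := (mem_lieAlgOf hK c).1 (h hc) 1
    rw [one_smul, ← hxc] at this
    exact this
  have h2 := Subgroup.isOpen_of_mem_nhds _ h1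
  have h3 := (show IsClopen _ from ⟨Subgroup.isClosed_of_isOpen _ h2, h2⟩).eq_univ ⟨1, one_mem _⟩
  intro x hx
  have : (⟨x, hx⟩ : H) ∈ ((K.subgroupOf H : Subgroup H) : Set H) := h3 ▸ Set.mem_univ _
  exact this

/-- A closed connected subgroup is determined by its Lie algebra. -/
theorem eq_of_lieAlgOf_eq {H K : Subgroup (S3Pow ν)} (hH : IsClosed (H : Set (S3Pow ν)))
    (hK : IsClosed (K : Set (S3Pow ν))) (hHc : IsConnected (H : Set (S3Pow ν)))
    (hKc : IsConnected (K : Set (S3Pow ν))) (h : lieAlgOf H = lieAlgOf K) : H = K :=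
  le_antisymm (le_of_lieAlgOf_le hH hK hHc h.le) (le_of_lieAlgOf_le hK hH hKc h.ge)

end ConnectedSubgroups

section Circles

/-- The imaginary unit `i`, `j` or `k`. -/
def unitQuat (a : Fin 3) : ℍ[ℝ] := imQuat (Pi.single a 1)

theorem unitQuat_mul_self (a : Fin 3) : unitQuat a * unitQuat a = -1 := by
  fin_cases a <;> ext <;> simp [unitQuat, imQuat_re, imQuat_imI, imQuat_imJ, imQuat_imK]

theorem mul_unitQuat_comm_iff (a : Fin 3) (z : ℍ[ℝ]) :
    z * unitQuat a = unitQuat a * z ↔ ∃ r s : ℝ, z = (r : ℍ[ℝ]) + s • unitQuat a := by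
  constructor
  · intro h
    refine ⟨z.re, ![z.imI, z.imJ, z.imK] a, ?_⟩
    rw [Quaternion.ext_iff] at h ⊢
    fin_cases a <;> simp [unitQuat, imQuat_re, imQuat_imI, imQuat_imJ, imQuat_imK] at h ⊢ <;> grind
  · rintro ⟨r, s, rfl⟩
    rw [add_mul, mul_add, smul_mul_assoc, mul_smul_comm, Quaternion.coe_commutes]

theorem imQuat_mul_unitQuat_comm_iff (a : Fin 3) (c : Fin 3 → ℝ) :
    imQuat c * unitQuat a = unitQuat a * imQuat c ↔ ∃ s : ℝ, c = Pi.single a s := by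
  rw [mul_unitQuat_comm_iff]
  constructor
  · rintro ⟨r, s, h⟩
    refine ⟨s, imQuat_injective ?_⟩
    rw [Quaternion.ext_iff] at h ⊢
    fin_cases a <;> simp [unitQuat, imQuat_re, imQuat_imI, imQuat_imJ, imQuat_imK] at h ⊢ <;>
      simp [h]
  · rintro ⟨s, rfl⟩
    refine ⟨0, s, ?_⟩
    fin_cases a <;> ext <;> simp [unitQuat, imQuat_re, imQuat_imI, imQuat_imJ, imQuat_imK]

/-- The torus of the elements of `S³ × S³` whose components commute with `i`, `j` or `k`. -/
def torus (a : Fin 3) : Subgroup (S3Pow 2) where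
  carrier := {x | ∀ k, (x k : ℍ[ℝ]) * unitQuat a = unitQuat a * x k}
  mul_mem' {x y} hx hy k := by
    change (x k : ℍ[ℝ]) * y k * unitQuat a = unitQuat a * ((x k : ℍ[ℝ]) * y k)
    rw [mul_assoc, hy k, ← mul_assoc, hx k, mul_assoc]
  one_mem' k := by
    change (1 : ℍ[ℝ]) * unitQuat a = unitQuat a * 1
    rw [one_mul, mul_one]
  inv_mem' {x} hx k := by
    change ((x k)⁻¹ : S3) * unitQuat a = unitQuat a * ((x k)⁻¹ : S3)
    have h1 : (((x k)⁻¹ : S3) : ℍ[ℝ]) * x k = 1 := congrArg Subtype.val (inv_mul_cancel (x k))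
    have h2 : (x k : ℍ[ℝ]) * ((x k)⁻¹ : S3) = 1 := congrArg Subtype.val (mul_inv_cancel (x k))
    calc (((x k)⁻¹ : S3) : ℍ[ℝ]) * unitQuat a
        = ((x k)⁻¹ : S3) * unitQuat a * ((x k : ℍ[ℝ]) * ((x k)⁻¹ : S3)) := by rw [h2, mul_one]
      _ = ((x k)⁻¹ : S3) * (unitQuat a * x k) * ((x k)⁻¹ : S3) := by noncomm_ring
      _ = (((x k)⁻¹ : S3) * x k) * (unitQuat a * ((x k)⁻¹ : S3)) := by rw [← hx k]; noncomm_ring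
      _ = _ := by rw [h1, one_mul]

theorem isClosed_torus (a : Fin 3) : IsClosed (torus a : Set (S3Pow 2)) := by
  have : (torus a : Set (S3Pow 2)) = ⋂ k, {x | (x k : ℍ[ℝ]) * unitQuat a = unitQuat a * x k} := by
    ext x; simp [torus]
  rw [this]
  exact isClosed_iInter fun k => isClosed_eq (by fun_prop) (by fun_prop)

theorem isConnected_torus (a : Fin 3) : IsConnected (torus a : Set (S3Pow 2)) := by
  let e : ℝ → S3 := fun t => ⟨(Real.cos t : ℍ[ℝ]) + Real.sin t • unitQuat a, by
    rw [mem_sphere_zero_iff_norm, ← sq_eq_sq₀ (norm_nonneg _) zero_le_one, one_pow, sq,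
      ← Quaternion.normSq_eq_norm_mul_self, Quaternion.normSq_def']
    refine Eq.trans ?_ (Real.cos_sq_add_sin_sq t)
    fin_cases a <;> simp [unitQuat, imQuat_re, imQuat_imI, imQuat_imJ, imQuat_imK]⟩
  have he : Continuous e := Continuous.subtype_mk (by
    have := (Quaternion.continuous_coe).comp Real.continuous_cos
    exact this.add (by fun_prop)) _
  have h : (torus a : Set (S3Pow 2)) = Set.range fun (t : Fin 2 → ℝ) k => e (t k) := by
    ext x
    constructor
    · intro hx
      have h1 : ∀ k, ∃ t, e t = x k := by
        intro k
        obtain ⟨r, s, hrs⟩ := (mul_unitQuat_comm_iff a _).1 (hx k)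
        have h2 : r ^ 2 + s ^ 2 = 1 := by
          have h3 := mem_sphere_zero_iff_norm.1 (x k).2
          rw [← sq_eq_sq₀ (norm_nonneg _) zero_le_one, one_pow, sq,
            ← Quaternion.normSq_eq_norm_mul_self, hrs, Quaternion.normSq_def'] at h3
          refine Eq.trans ?_ h3
          fin_cases a <;> simp [unitQuat, imQuat_re, imQuat_imI, imQuat_imJ, imQuat_imK]
        have h3 : ‖(⟨r, s⟩ : ℂ)‖ = 1 := by
          rw [← sq_eq_sq₀ (norm_nonneg _) zero_le_one, Complex.sq_norm, Complex.normSq_mk]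
          linarith
        refine ⟨Complex.arg ⟨r, s⟩, Subtype.ext ?_⟩
        have h4 := Complex.norm_mul_cos_arg ⟨r, s⟩
        have h5 := Complex.norm_mul_sin_arg ⟨r, s⟩
        rw [h3, one_mul] at h4 h5
        simp only [e, h4, h5, hrs]
      choose t ht using h1
      exact ⟨t, funext ht⟩
    · rintro ⟨t, rfl⟩ k
      exact (mul_unitQuat_comm_iff a _).2 ⟨_, _, rfl⟩
  rw [h]
  exact isConnected_range (by fun_prop)

theorem mem_span_eVec_fVec (a : Fin 3) (c : LieAlg 2) :
    c ∈ Submodule.span ℝ {eVec a, fVec a} ↔ ∀ k, ∃ s : ℝ, c k = Pi.single a s := by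
  rw [Submodule.mem_span_pair]
  constructor
  · rintro ⟨s, t, rfl⟩ k
    fin_cases k
    · refine ⟨s, ?_⟩
      ext b; simp [eVec, fVec, Pi.single_apply]
    · refine ⟨t, ?_⟩
      ext b; simp [eVec, fVec, Pi.single_apply]
  · intro h
    obtain ⟨s, hs⟩ := h 0
    obtain ⟨t, ht⟩ := h 1
    refine ⟨s, t, ?_⟩
    funext k
    fin_cases k
    · refine Eq.trans ?_ hs.symm
      ext b; simp [eVec, fVec, Pi.single_apply]
    · refine Eq.trans ?_ ht.symm
      ext b; simp [eVec, fVec, Pi.single_apply]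

theorem hasDerivAt_exp_imQuat (c : Fin 3 → ℝ) :
    HasDerivAt (fun t : ℝ => (NormedSpace.exp (imQuat (t • c)) : ℍ[ℝ])) (imQuat c) 0 := by
  have h := hasDerivAt_exp_smul_const (𝕂 := ℝ) (imQuat c) (0 : ℝ)
  rw [zero_smul, NormedSpace.exp_zero, one_mul] at h
  have e : ∀ t : ℝ, imQuat (t • c) = t • imQuat c := fun t => map_smul imQuatL t c
  simpa only [e] using h

theorem lieAlgOf_torus (a : Fin 3) : lieAlgOf (torus a) = Submodule.span ℝ {eVec a, fVec a} := by
  ext c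
  rw [mem_lieAlgOf (isClosed_torus a), mem_span_eVec_fVec]
  simp only [← imQuat_mul_unitQuat_comm_iff]
  constructor
  · intro h k
    have h1 := (hasDerivAt_exp_imQuat (c k)).mul_const (unitQuat a)
    have h2 := (hasDerivAt_exp_imQuat (c k)).const_mul (unitQuat a)
    have e : (fun t : ℝ => NormedSpace.exp (imQuat (t • c k)) * unitQuat a) =
        fun t => unitQuat a * NormedSpace.exp (imQuat (t • c k)) := funext fun t => h t k
    rw [e] at h1
    exact h1.unique h2
  · intro h t k
    have h1 : Commute (imQuat (t • c k)) (unitQuat a) := by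
      have e : imQuat (t • c k) = t • imQuat (c k) := map_smul imQuatL t (c k)
      rw [e]
      exact (show Commute _ _ from h k).smul_left t
    exact h1.exp_left.eq

/-- The subgroup `S³ × 1` of `S³ × S³`. -/
def firstFactor : Subgroup (S3Pow 2) := (Pi.evalMonoidHom (fun _ : Fin 2 => S3) 1).ker

theorem mem_firstFactor (x : S3Pow 2) : x ∈ firstFactor ↔ x 1 = 1 := Iff.rfl

theorem isClosed_firstFactor : IsClosed (firstFactor : Set (S3Pow 2)) :=
  isClosed_eq (continuous_apply (1 : Fin 2)) continuous_const

theorem isConnected_firstFactor : IsConnected (firstFactor : Set (S3Pow 2)) := by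
  have : ConnectedSpace S3 := isConnected_iff_connectedSpace.1
    (isConnected_sphere (by
      rw [← Module.finrank_eq_rank, Quaternion.finrank_eq_four]; norm_num) 0 zero_le_one)
  have h : (firstFactor : Set (S3Pow 2)) =
      Set.range fun z : S3 => (Pi.mulSingle 0 z : S3Pow 2) := by
    ext x
    constructor
    · intro hx
      refine ⟨x 0, ?_⟩
      funext k
      fin_cases k
      · simp
      · exact (show x 1 = 1 from hx).symm
    · rintro ⟨z, rfl⟩
      exact rfl
  rw [h]
  exact isConnected_range (continuous_mulSingle (A := fun _ : Fin 2 => S3) 0)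

theorem mem_span_eVec (c : LieAlg 2) :
    c ∈ Submodule.span ℝ {eVec 0, eVec 1, eVec 2} ↔ c 1 = 0 := by
  rw [Submodule.mem_span_triple]
  constructor
  · rintro ⟨r, s, t, rfl⟩
    simp [eVec]
  · intro h
    refine ⟨c 0 0, c 0 1, c 0 2, ?_⟩
    funext k
    fin_cases k
    · ext b
      fin_cases b <;> simp [eVec]
    · simp [eVec, h]

theorem lieAlgOf_firstFactor :
    lieAlgOf firstFactor = Submodule.span ℝ {eVec 0, eVec 1, eVec 2} := by
  ext c
  rw [mem_lieAlgOf isClosed_firstFactor, mem_span_eVec]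
  constructor
  · intro h
    have h1 := hasDerivAt_exp_imQuat (c 1)
    have e : (fun t : ℝ => NormedSpace.exp (imQuat (t • c 1))) = fun _ => 1 :=
      funext fun t => congrArg Subtype.val (h t)
    rw [e] at h1
    refine imQuat_injective ?_
    rw [← (hasDerivAt_const (0 : ℝ) (1 : ℍ[ℝ])).unique h1]
    exact (map_zero imQuatL).symm
  · intro h t
    refine Subtype.ext ?_
    change NormedSpace.exp (imQuat (t • c 1)) = 1
    rw [h, smul_zero, ← imQuatL_apply, map_zero, NormedSpace.exp_zero]

end Circles

/-! ### Hopf maps and the quotients `S² × S²` and `S³` -/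

section Hopf

/-- The imaginary part of a quaternion, as a vector of `ℝ³`. -/
def imVec : ℍ[ℝ] →L[ℝ] EuclideanSpace ℝ (Fin 3) :=
  LinearMap.toContinuousLinearMap
    { toFun := fun z => !₂[z.imI, z.imJ, z.imK]
      map_add' := fun z w => by ext a; fin_cases a <;> simp
      map_smul' := fun r z => by ext a; fin_cases a <;> simp }

/-- The imaginary quaternion with given components, as a function on the Euclidean space. -/
def ofVec : EuclideanSpace ℝ (Fin 3) →L[ℝ] ℍ[ℝ] :=
  imQuatL ∘L (EuclideanSpace.equiv (Fin 3) ℝ : EuclideanSpace ℝ (Fin 3) →L[ℝ] Fin 3 → ℝ)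

theorem ofVec_imVec {z : ℍ[ℝ]} (hz : z.re = 0) : ofVec (imVec z) = z := by
  rw [Quaternion.ext_iff]
  exact ⟨hz.symm, rfl, rfl, rfl⟩

theorem imVec_ofVec (w : EuclideanSpace ℝ (Fin 3)) : imVec (ofVec w) = w := by
  ext a
  fin_cases a <;> rfl

theorem norm_ofVec (w : EuclideanSpace ℝ (Fin 3)) : ‖ofVec w‖ = ‖w‖ := by
  rw [← sq_eq_sq₀ (norm_nonneg _) (norm_nonneg _), sq, ← Quaternion.normSq_eq_norm_mul_self,
    Quaternion.normSq_def', EuclideanSpace.norm_sq_eq, Fin.sum_univ_three]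
  simp [ofVec, imQuatL_apply, imQuat_re, imQuat_imI, imQuat_imJ, imQuat_imK]

theorem norm_imVec {z : ℍ[ℝ]} (hz : z.re = 0) : ‖imVec z‖ = ‖z‖ := by
  rw [← norm_ofVec, ofVec_imVec hz]

theorem ofVec_re (w : EuclideanSpace ℝ (Fin 3)) : (ofVec w).re = 0 := rfl

theorem conj_unitQuat_re (a : Fin 3) (z : ℍ[ℝ]) : (z * unitQuat a * star z).re = 0 := by
  fin_cases a <;> simp [unitQuat, imQuat_re, imQuat_imI, imQuat_imJ, imQuat_imK] <;> ring

theorem norm_unitQuat (a : Fin 3) : ‖unitQuat a‖ = 1 := by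
  rw [← sq_eq_sq₀ (norm_nonneg _) zero_le_one, sq, ← Quaternion.normSq_eq_norm_mul_self,
    Quaternion.normSq_def']
  fin_cases a <;> simp [unitQuat, imQuat_re, imQuat_imI, imQuat_imJ, imQuat_imK]

/-- The Hopf map `S³ → S²`, `z ↦ z u z⁻¹` with `u = i`, `j` or `k`. -/
def hopf (a : Fin 3) (z : S3) : S2 :=
  ⟨imVec (z * unitQuat a * star (z : ℍ[ℝ])), by
    rw [mem_sphere_zero_iff_norm, norm_imVec (conj_unitQuat_re a _), norm_mul, norm_mul, norm_star,
      mem_sphere_zero_iff_norm.1 z.2, norm_unitQuat, one_mul, one_mul]⟩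

theorem hopf_eq_iff (a : Fin 3) (z w : S3) :
    hopf a z = hopf a w ↔
      (z : ℍ[ℝ]) * unitQuat a * star (z : ℍ[ℝ]) = w * unitQuat a * star (w : ℍ[ℝ]) := by
  refine ⟨fun h => ?_, fun h => Subtype.ext (congrArg imVec h)⟩
  have h1 := congrArg ofVec (congrArg Subtype.val h)
  rwa [hopf, hopf, ofVec_imVec (conj_unitQuat_re a _), ofVec_imVec (conj_unitQuat_re a _)] at h1

theorem surjective_hopf (a : Fin 3) : Function.Surjective (hopf a) := by
  intro w
  set v : ℍ[ℝ] := ofVec w with hv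
  have hv1 : ‖v‖ = 1 := by rw [hv, norm_ofVec]; exact mem_sphere_zero_iff_norm.1 w.2
  have hvv : v * v = -1 := by
    have h1 : star v = -v := Quaternion.star_eq_neg.2 (ofVec_re _)
    have h2 := Quaternion.self_mul_star v
    rw [h1, mul_neg, Quaternion.normSq_eq_norm_mul_self, hv1] at h2
    rw [← neg_neg (v * v), h2]; norm_num
  -- it suffices to find a nonzero quaternion intertwining `u` and `v`
  suffices h : ∃ z : ℍ[ℝ], z ≠ 0 ∧ z * unitQuat a = v * z by
    obtain ⟨z, hz, hzv⟩ := h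
    have hz' : ‖z‖ ≠ 0 := norm_ne_zero_iff.2 hz
    refine ⟨⟨‖z‖⁻¹ • z, ?_⟩, Subtype.ext ?_⟩
    · rw [mem_sphere_zero_iff_norm, norm_smul, norm_inv, norm_norm, inv_mul_cancel₀ hz']
    · change imVec (‖z‖⁻¹ • z * unitQuat a * star (‖z‖⁻¹ • z)) = w
      rw [smul_mul_assoc, hzv, Quaternion.star_smul, smul_mul_assoc, mul_smul_comm, mul_assoc,
        Quaternion.self_mul_star, Quaternion.normSq_eq_norm_mul_self, smul_smul]
      rw [Quaternion.mul_coe_eq_smul, smul_smul]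
      rw [show ‖z‖⁻¹ * ‖z‖⁻¹ * (‖z‖ * ‖z‖) = 1 by field_simp, one_smul, hv, imVec_ofVec]
  by_cases hva : v = -unitQuat a
  · refine ⟨unitQuat (a + 1), ?_, ?_⟩
    · rw [← norm_ne_zero_iff, norm_unitQuat]; exact one_ne_zero
    · rw [hva]
      fin_cases a <;> ext <;>
        simp [unitQuat, imQuat_re, imQuat_imI, imQuat_imJ, imQuat_imK]
  · refine ⟨unitQuat a + v, ?_, ?_⟩
    · intro h
      exact hva (eq_neg_of_add_eq_zero_right h)
    · rw [add_mul, mul_add, unitQuat_mul_self, hvv, add_comm]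

instance fact_finrank_euclideanSpace_three :
    Fact (Module.finrank ℝ (EuclideanSpace ℝ (Fin 3)) = 2 + 1) := ⟨finrank_euclideanSpace_fin⟩

/-- Quaternionic conjugation as a continuous linear map. -/
def starQuatL : ℍ[ℝ] →L[ℝ] ℍ[ℝ] := LinearMap.toContinuousLinearMap
  { toFun := star, map_add' := star_add, map_smul' := Quaternion.star_smul }

theorem contMDiff_hopf (a : Fin 3) : ContMDiff (𝓡 3) (𝓡 2) ∞ (hopf a) := by
  refine ContMDiff.codRestrict_sphere (n := 2) ?_ fun z => (hopf a z).2
  have h1 : ContMDiff (𝓡 3) 𝓘(ℝ, ℍ[ℝ]) ∞ ((↑) : S3 → ℍ[ℝ]) := contMDiff_coe_sphere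
  have h2 : ContDiff ℝ ∞ fun z : ℍ[ℝ] => imVec (z * unitQuat a * star z) :=
    imVec.contDiff.comp ((contDiff_id.mul contDiff_const).mul
      starQuatL.contDiff)
  exact h2.contMDiff.comp h1

theorem mvfderiv_conj_unitQuat {ν : ℕ} (a : Fin 3) (k : Fin ν) (x : S3Pow ν)
    (v : TangentSpace (modelS3Pow ν) x) :
    mvfderiv (modelS3Pow ν)
      (fun y : S3Pow ν => (y k : ℍ[ℝ]) * unitQuat a * star (y k : ℍ[ℝ])) x v =
    x k * (imQuat (coframe x v k) * unitQuat a - unitQuat a * imQuat (coframe x v k)) *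
      star (x k : ℍ[ℝ]) := by
  have h1 := (contMDiff_coe_eval k x).mdifferentiableAt (n := ∞) (by simp)
  let L₁ : ℍ[ℝ] →L[ℝ] ℍ[ℝ] := (ContinuousLinearMap.mul ℝ ℍ[ℝ]).flip (unitQuat a)
  let L₂ : ℍ[ℝ] →L[ℝ] ℍ[ℝ] := starQuatL
  have h2 : MDifferentiableAt (modelS3Pow ν) 𝓘(ℝ, ℍ[ℝ]) (fun y : S3Pow ν => L₁ (y k)) x :=
    (L₁.contMDiff.contMDiffAt.mdifferentiableAt (n := ∞) (by simp)).comp x h1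
  have h3 : MDifferentiableAt (modelS3Pow ν) 𝓘(ℝ, ℍ[ℝ]) (fun y : S3Pow ν => L₂ (y k)) x :=
    (L₂.contMDiff.contMDiffAt.mdifferentiableAt (n := ∞) (by simp)).comp x h1
  refine (mvfderiv_bilin (ContinuousLinearMap.mul ℝ ℍ[ℝ]) h2 h3 v).trans ?_
  rw [mvfderiv_clm_comp L₁ h1, mvfderiv_clm_comp L₂ h1]
  change dcoe x k v * unitQuat a * star (x k : ℍ[ℝ]) + x k * unitQuat a * star (dcoe x k v) = _
  have h4 : star (imQuat (coframe x v k)) = -imQuat (coframe x v k) :=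
    Quaternion.star_eq_neg.2 (imQuat_re _)
  rw [dcoe_eq, star_mul, h4]
  noncomm_ring

theorem sandwich_eq_zero {z : S3} {w : ℍ[ℝ]} (h : (z : ℍ[ℝ]) * w * star (z : ℍ[ℝ]) = 0) :
    w = 0 := by
  have hz : (z : ℍ[ℝ]) ≠ 0 := fun h0 => by
    have := mem_sphere_zero_iff_norm.1 z.2
    rw [h0, norm_zero] at this
    exact zero_ne_one this
  rcases mul_eq_zero.1 h with h | h
  · exact (mul_eq_zero.1 h).resolve_left hz
  · exact absurd (star_eq_zero.1 h) hz

/-- The product of two Hopf maps. -/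
def hopfProd (a : Fin 3) (x : S3Pow 2) : S2 × S2 := (hopf a (x 0), hopf a (x 1))

theorem contMDiff_hopf_eval {ν : ℕ} (a : Fin 3) (k : Fin ν) :
    ContMDiff (modelS3Pow ν) (𝓡 2) ∞ fun x : S3Pow ν => hopf a (x k) :=
  (contMDiff_hopf a).comp (contMDiff_eval k)

theorem contMDiff_hopfProd (a : Fin 3) :
    ContMDiff (modelS3Pow 2) ((𝓡 2).prod (𝓡 2)) ∞ (hopfProd a) :=
  (contMDiff_hopf_eval a 0).prodMk (contMDiff_hopf_eval a 1)

theorem surjective_hopfProd (a : Fin 3) : Function.Surjective (hopfProd a) := by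
  rintro ⟨p, q⟩
  obtain ⟨z, rfl⟩ := surjective_hopf a p
  obtain ⟨w, rfl⟩ := surjective_hopf a q
  exact ⟨![z, w], rfl⟩

/-- Vectors in the kernel of the derivative of the Hopf map have components commuting with `i`,
`j` or `k`. -/
theorem comm_of_mfderiv_hopf_eq_zero {ν : ℕ} (a : Fin 3) (k : Fin ν) (x : S3Pow ν)
    (v : TangentSpace (modelS3Pow ν) x)
    (h : mfderiv (modelS3Pow ν) (𝓡 2) (fun x : S3Pow ν => hopf a (x k)) x v = 0) :
    imQuat (coframe x v k) * unitQuat a = unitQuat a * imQuat (coframe x v k) := by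
  have h1 : ContMDiff (𝓡 2) 𝓘(ℝ, ℍ[ℝ]) ∞ fun w : S2 => ofVec w :=
    ofVec.contMDiff.comp contMDiff_coe_sphere
  have h2 := mfderiv_comp_apply x ((h1 _).mdifferentiableAt (by simp))
    ((contMDiff_hopf_eval a k x).mdifferentiableAt (by simp)) v
  rw [h, map_zero] at h2
  have h3 : (fun w : S2 => ofVec w) ∘ (fun x : S3Pow ν => hopf a (x k)) =
      fun y : S3Pow ν => (y k : ℍ[ℝ]) * unitQuat a * star (y k : ℍ[ℝ]) :=
    funext fun y => ofVec_imVec (conj_unitQuat_re a _)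
  rw [h3] at h2
  exact sub_eq_zero.1 (sandwich_eq_zero ((mvfderiv_conj_unitQuat a k x v).symm.trans h2))

/-- The derivative of the product of Hopf maps is surjective, since its kernel has dimension at
most two. -/
theorem surjective_mfderiv_hopfProd (a : Fin 3) (x : S3Pow 2) : Function.Surjective
    (mfderiv (modelS3Pow 2) ((𝓡 2).prod (𝓡 2)) (hopfProd a) x) := by
  let D : (Fin 2 → EuclideanSpace ℝ (Fin 3)) →ₗ[ℝ]
      EuclideanSpace ℝ (Fin 2) × EuclideanSpace ℝ (Fin 2) :=
    (mfderiv (modelS3Pow 2) ((𝓡 2).prod (𝓡 2)) (hopfProd a) x).toLinearMap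
  let θ : (Fin 2 → EuclideanSpace ℝ (Fin 3)) →ₗ[ℝ] LieAlg 2 := (coframe x).toLinearMap
  have hker : (LinearMap.ker D).map θ ≤ Submodule.span ℝ {eVec a, fVec a} := by
    rintro _ ⟨v, hv, rfl⟩
    have hv' : mfderiv (modelS3Pow 2) ((𝓡 2).prod (𝓡 2)) (hopfProd a) x v = 0 := hv
    have h1 := mfderiv_prodMk ((contMDiff_hopf_eval a 0 x).mdifferentiableAt (by simp))
      ((contMDiff_hopf_eval a 1 x).mdifferentiableAt (by simp))
    have h2 := (congrArg (fun A : (Fin 2 → EuclideanSpace ℝ (Fin 3)) →L[ℝ]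
      EuclideanSpace ℝ (Fin 2) × EuclideanSpace ℝ (Fin 2) => A v) h1).symm.trans hv'
    rw [mem_span_eVec_fVec]
    intro k
    rw [← imQuat_mul_unitQuat_comm_iff]
    fin_cases k
    · exact comm_of_mfderiv_hopf_eq_zero a 0 x v (congrArg Prod.fst h2)
    · exact comm_of_mfderiv_hopf_eq_zero a 1 x v (congrArg Prod.snd h2)
  have h1 : Module.finrank ℝ (LinearMap.ker D) ≤ 2 := by
    rw [LinearEquiv.finrank_eq (Submodule.equivMapOfInjective θ (coframe_injective x) _)]
    refine (Submodule.finrank_mono hker).trans ?_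
    refine (finrank_span_le_card _).trans ?_
    rw [Set.toFinset_insert, Set.toFinset_singleton]
    exact Finset.card_le_two
  have h2 := D.finrank_range_add_finrank_ker
  have h3 : Module.finrank ℝ (Fin 2 → EuclideanSpace ℝ (Fin 3)) = 6 := by
    rw [Module.finrank_pi_fintype]; simp
  have h4 : Module.finrank ℝ (EuclideanSpace ℝ (Fin 2) × EuclideanSpace ℝ (Fin 2)) = 4 := by
    simp
  have h5 : LinearMap.range D = ⊤ := by
    refine Submodule.eq_top_of_finrank_eq (le_antisymm (Submodule.finrank_le _) ?_)
    omega
  exact LinearMap.range_eq_top.1 h5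

end Hopf

section QuotientDiffeomorphisms

variable {ε : Fin 2 → ℤˣ} {H : Subgroup (S3Pow 2)}

/-- A surjective submersion of `(S³)^ν` whose fibres are the cosets of `H` identifies `G/H` with its
target. -/
theorem CosetGeometry.nonempty_diffeomorph_of_fibres {ν : ℕ} {ε : Fin ν → ℤˣ}
    {H : Subgroup (S3Pow ν)} (Q : CosetGeometry ε H)
    {E' : Type*} [NormedAddCommGroup E'] [NormedSpace ℝ E'] [FiniteDimensional ℝ E']
    {H' : Type*} [TopologicalSpace H'] {J : ModelWithCorners ℝ E' H'} [J.Boundaryless]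
    {P : Type*} [TopologicalSpace P] [ChartedSpace H' P] [IsManifold J ∞ P] {p : S3Pow ν → P}
    (hp : ContMDiff (modelS3Pow ν) J ∞ p) (hps : Function.Surjective p)
    (hs : ∀ x, Function.Surjective (mfderiv (modelS3Pow ν) J p x))
    (hpH : ∀ x y, p x = p y ↔ x⁻¹ * y ∈ H) :
    Nonempty (Diffeomorph (𝓡 Q.dim) J (S3Pow ν ⧸ H) P ∞) :=
  nonempty_diffeomorph_of_submersions Q.submersion.smooth QuotientGroup.mk_surjective
    Q.submersion.submersion hp hps hs fun x y => by rw [hpH]; exact QuotientGroup.eq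

/-- The fibres of the product of two Hopf maps are the cosets of the torus. -/
theorem CosetGeometry.nonempty_diffeomorph_S2 (Q : CosetGeometry ε H) (a : Fin 3)
    (hH : IsClosed (H : Set (S3Pow 2))) (hc : IsConnected (H : Set (S3Pow 2)))
    (h : lieAlgOf H = Submodule.span ℝ {eVec a, fVec a}) :
    Nonempty (Diffeomorph (𝓡 Q.dim) ((𝓡 2).prod (𝓡 2)) (S3Pow 2 ⧸ H) (S2 × S2) ∞) := by
  obtain rfl : H = torus a := eq_of_lieAlgOf_eq hH (isClosed_torus a) hc (isConnected_torus a)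
    (h.trans (lieAlgOf_torus a).symm)
  refine Q.nonempty_diffeomorph_of_fibres (contMDiff_hopfProd a) (surjective_hopfProd a)
    (surjective_mfderiv_hopfProd a) fun x y => ?_
  have key : ∀ z w : S3, hopf a z = hopf a w ↔
      ((z⁻¹ * w : S3) : ℍ[ℝ]) * unitQuat a = unitQuat a * ((z⁻¹ * w : S3) : ℍ[ℝ]) := by
    intro z w
    rw [hopf_eq_iff]
    have e1 : ((z⁻¹ * w : S3) : ℍ[ℝ]) = star (z : ℍ[ℝ]) * w :=
      congrArg (· * (w : ℍ[ℝ])) (eq_inv_of_mul_eq_one_left (star_mul_self_S3 z)).symm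
    rw [e1]
    have hz := star_mul_self_S3 z
    have hz' := self_mul_star_S3 z
    have hw := star_mul_self_S3 w
    have hw' := self_mul_star_S3 w
    generalize (z : ℍ[ℝ]) = z at *
    generalize (w : ℍ[ℝ]) = w at *
    constructor
    · intro h
      calc star z * w * unitQuat a = star z * (w * unitQuat a * star w) * w := by
            simp only [mul_assoc, hw, mul_one]
        _ = (star z * z) * unitQuat a * (star z * w) := by rw [← h]; noncomm_ring
        _ = unitQuat a * (star z * w) := by rw [hz, one_mul]
    · intro h
      calc z * unitQuat a * star z = z * (unitQuat a * (star z * w)) * star w := by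
            simp only [mul_assoc, hw', mul_one]
        _ = (z * star z) * w * unitQuat a * star w := by rw [← h]; noncomm_ring
        _ = w * unitQuat a * star w := by rw [hz', one_mul]
  rw [hopfProd, hopfProd, Prod.mk_inj, key, key]
  exact (Fin.forall_fin_two (p := fun k => (((x⁻¹ * y : S3Pow 2) k : S3) : ℍ[ℝ]) * unitQuat a =
    unitQuat a * ((x⁻¹ * y : S3Pow 2) k : S3))).symm

/-- The fibres of the projection to the second factor are the cosets of the first one. -/
theorem CosetGeometry.nonempty_diffeomorph_S3 (Q : CosetGeometry ε H)
    (hH : IsClosed (H : Set (S3Pow 2))) (hc : IsConnected (H : Set (S3Pow 2)))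
    (h : lieAlgOf H = Submodule.span ℝ {eVec 0, eVec 1, eVec 2}) :
    Nonempty (Diffeomorph (𝓡 Q.dim) (𝓡 3) (S3Pow 2 ⧸ H) S3 ∞) := by
  obtain rfl : H = firstFactor := eq_of_lieAlgOf_eq hH isClosed_firstFactor hc
    isConnected_firstFactor (h.trans lieAlgOf_firstFactor.symm)
  refine Q.nonempty_diffeomorph_of_fibres (contMDiff_eval 1) (fun z => ⟨fun _ => z, rfl⟩)
    (fun x => ?_) fun x y => ?_
  · rw [(hasMFDerivAt_eval x 1).mfderiv]
    exact fun w => ⟨fun _ => w, rfl⟩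
  · rw [mem_firstFactor]
    exact inv_mul_eq_one.symm

end QuotientDiffeomorphisms

/-! ### Hermitian and para-Hermitian structures on `S³ × S³` -/

section DimensionSix

theorem endOfImages_apply (u v : Fin 3 → LieAlg 2) (c : LieAlg 2) :
    endOfImages u v c = ∑ a, (c 0 a • u a + c 1 a • v a) := by
  simp [endOfImages, coordForm]

/-- The endomorphism `e₁ ↦ f₁ ↦ -e₁`, `e₂ ↦ e₃ ↦ -e₂`, `f₂ ↦ f₃ ↦ -f₂`. -/
theorem endOfImages_hermitian (c : LieAlg 2) :
    endOfImages ![fVec 0, eVec 2, -eVec 1] ![-eVec 0, fVec 2, -fVec 1] c =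
      ![![-c 1 0, -c 0 2, c 0 1], ![c 0 0, -c 1 2, c 1 1]] := by
  rw [endOfImages_apply]
  ext k a
  fin_cases k <;> fin_cases a <;> simp [Fin.sum_univ_three, eVec, fVec]

theorem endOfImages_almostHermitian (c : LieAlg 2) :
    endOfImages ![fVec 0, fVec 1, fVec 2] ![-eVec 0, -eVec 1, -eVec 2] c = ![-c 1, c 0] := by
  rw [endOfImages_apply]
  ext k a
  fin_cases k <;> fin_cases a <;> simp [Fin.sum_univ_three, eVec, fVec]

theorem endOfImages_paraHermitian (c : LieAlg 2) :
    endOfImages ![fVec 1, fVec 0, fVec 2] ![eVec 1, eVec 0, eVec 2] c =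
      ![![c 1 1, c 1 0, c 1 2], ![c 0 1, c 0 0, c 0 2]] := by
  rw [endOfImages_apply]
  ext k a
  fin_cases k <;> fin_cases a <;> simp [Fin.sum_univ_three, eVec, fVec]

theorem endOfImages_swap (c : LieAlg 2) :
    endOfImages ![fVec 0, fVec 1, fVec 2] ![eVec 0, eVec 1, eVec 2] c = ![c 1, c 0] := by
  rw [endOfImages_apply]
  ext k a
  fin_cases k <;> fin_cases a <;> simp [Fin.sum_univ_three, eVec, fVec]

theorem prodInner_two (ε : Fin 2 → ℤˣ) (c d : LieAlg 2) : prodInner ε c d =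
    ((ε 0 : ℤ) : ℝ) * (c 0 0 * d 0 0 + c 0 1 * d 0 1 + c 0 2 * d 0 2) +
    ((ε 1 : ℤ) : ℝ) * (c 1 0 * d 1 0 + c 1 1 * d 1 1 + c 1 2 * d 1 2) := by
  simp [prodInner, Fin.sum_univ_three]

variable {H : Subgroup (S3Pow 2)}

theorem isAntiInvariantHermitian_torus (hH : IsClosed (H : Set (S3Pow 2)))
    (h : lieAlgOf H = Submodule.span ℝ {eVec 1, fVec 1}) (Q : CosetGeometry ![1, 1] H) :
    IsAntiInvariantHermitianSubmersion (prodMetric ![1, 1]) Q.metric Q.proj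
      (leftInvEnd (endOfImages ![fVec 0, eVec 2, -eVec 1] ![-eVec 0, fVec 2, -fVec 1])) := by
  set j := endOfImages ![fVec 0, eVec 2, -eVec 1] ![-eVec 0, fVec 2, -fVec 1] with hj
  have hja : ∀ c, j c = ![![-c 1 0, -c 0 2, c 0 1], ![c 0 0, -c 1 2, c 1 1]] :=
    endOfImages_hermitian
  have hsq : ∀ c, j (j c) = -c := by
    intro c
    rw [hja, hja]
    ext k a
    fin_cases k <;> fin_cases a <;> simp
  refine ⟨⟨Q.isRiemannianSubmersion hH (by simp [Fin.forall_fin_two]),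
    isAlmostHermitian_leftInvEnd hsq fun c d => ?_, Q.isAntiInvariant_leftInvEnd hH ?_⟩,
    (isIntegrable_leftInvEnd_iff hsq).2 fun a c => ?_⟩
  · rw [prodInner_two, prodInner_two, hja, hja]
    simp
    ring
  · intro c hc d hd
    rw [h, mem_span_eVec_fVec] at hc hd
    obtain ⟨⟨s, hs⟩, ⟨t, ht⟩⟩ := And.intro (hc 0) (hc 1)
    obtain ⟨⟨s', hs'⟩, ⟨t', ht'⟩⟩ := And.intro (hd 0) (hd 1)
    rw [prodInner_two, hja]
    simp [hs, ht, hs', ht']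
  · rw [hja, hja a, hja c]
    ext k b
    fin_cases k <;> fin_cases b <;> simp [lieBr] <;> ring

theorem endOfImages_almostHermitian_sq (c : LieAlg 2) :
    endOfImages ![fVec 0, fVec 1, fVec 2] ![-eVec 0, -eVec 1, -eVec 2]
      (endOfImages ![fVec 0, fVec 1, fVec 2] ![-eVec 0, -eVec 1, -eVec 2] c) = -c := by
  rw [endOfImages_almostHermitian, endOfImages_almostHermitian]
  ext k a
  fin_cases k <;> simp

theorem not_isIntegrable_almostHermitian : ¬ IsIntegrable (leftInvEnd
    (endOfImages ![fVec 0, fVec 1, fVec 2] ![-eVec 0, -eVec 1, -eVec 2])) := by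
  rw [isIntegrable_leftInvEnd_iff endOfImages_almostHermitian_sq]
  intro h
  -- the Nijenhuis tensor does not vanish on `e₁`, `e₂`
  have h1 := congrFun (congrFun (h (eVec 0) (eVec 1)) 1) 2
  simp only [endOfImages_almostHermitian] at h1
  simp [lieBr, eVec] at h1

theorem isAntiInvariantAlmostHermitian_firstFactor (hH : IsClosed (H : Set (S3Pow 2)))
    (h : lieAlgOf H = Submodule.span ℝ {eVec 0, eVec 1, eVec 2}) (Q : CosetGeometry ![1, 1] H) :
    IsAntiInvariantAlmostHermitianSubmersion (prodMetric ![1, 1]) Q.metric Q.proj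
      (leftInvEnd (endOfImages ![fVec 0, fVec 1, fVec 2] ![-eVec 0, -eVec 1, -eVec 2])) := by
  refine ⟨Q.isRiemannianSubmersion hH (by simp [Fin.forall_fin_two]),
    isAlmostHermitian_leftInvEnd endOfImages_almostHermitian_sq fun c d => ?_,
    Q.isAntiInvariant_leftInvEnd hH ?_⟩
  · rw [prodInner_two, prodInner_two, endOfImages_almostHermitian, endOfImages_almostHermitian]
    simp
    ring
  · intro c hc d hd
    rw [h, mem_span_eVec] at hc hd
    rw [prodInner_two, endOfImages_almostHermitian]
    simp [hc, hd]

theorem isAntiInvariantParaHermitian_torus (hH : IsClosed (H : Set (S3Pow 2)))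
    (h : lieAlgOf H = Submodule.span ℝ {eVec 0, fVec 0}) (Q : CosetGeometry ![1, -1] H) :
    IsAntiInvariantParaHermitianSubmersion (prodMetric ![1, -1]) Q.metric Q.proj
      (leftInvEnd (endOfImages ![fVec 1, fVec 0, fVec 2] ![eVec 1, eVec 0, eVec 2])) := by
  refine ⟨Q.submersion, isParaHermitian_leftInvEnd (fun c => ?_) fun c d => ?_,
    Q.isAntiInvariant_leftInvEnd hH ?_⟩
  · rw [endOfImages_paraHermitian, endOfImages_paraHermitian]
    ext k a
    fin_cases k <;> fin_cases a <;> simp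
  · rw [prodInner_two, prodInner_two, endOfImages_paraHermitian, endOfImages_paraHermitian]
    simp
    ring
  · intro c hc d hd
    rw [h, mem_span_eVec_fVec] at hc hd
    obtain ⟨⟨s, hs⟩, ⟨t, ht⟩⟩ := And.intro (hc 0) (hc 1)
    obtain ⟨⟨s', hs'⟩, ⟨t', ht'⟩⟩ := And.intro (hd 0) (hd 1)
    rw [prodInner_two, endOfImages_paraHermitian]
    simp [hs, ht, hs', ht']

theorem isAntiInvariantParaHermitian_firstFactor (hH : IsClosed (H : Set (S3Pow 2)))
    (h : lieAlgOf H = Submodule.span ℝ {eVec 0, eVec 1, eVec 2}) (Q : CosetGeometry ![1, -1] H) :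
    IsAntiInvariantParaHermitianSubmersion (prodMetric ![1, -1]) Q.metric Q.proj
      (leftInvEnd (endOfImages ![fVec 0, fVec 1, fVec 2] ![eVec 0, eVec 1, eVec 2])) := by
  refine ⟨Q.submersion, isParaHermitian_leftInvEnd (fun c => ?_) fun c d => ?_,
    Q.isAntiInvariant_leftInvEnd hH ?_⟩
  · rw [endOfImages_swap, endOfImages_swap]
    ext k a
    fin_cases k <;> simp
  · rw [prodInner_two, prodInner_two, endOfImages_swap, endOfImages_swap]
    simp
  · intro c hc d hd
    rw [h, mem_span_eVec] at hc hd
    rw [prodInner_two, endOfImages_swap]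
    simp [hc, hd]

theorem nondegenerateOn_torus (h : lieAlgOf H = Submodule.span ℝ {eVec 0, fVec 0}) :
    NondegenerateOn ![1, -1] H := by
  intro c hc hcd
  rw [h] at hc hcd
  have h1 := hcd (eVec 0) (Submodule.subset_span (by simp))
  have h2 := hcd (fVec 0) (Submodule.subset_span (by simp))
  rw [mem_span_eVec_fVec] at hc
  rw [prodInner_two] at h1 h2
  obtain ⟨⟨s, hs⟩, ⟨t, ht⟩⟩ := And.intro (hc 0) (hc 1)
  simp [hs, ht, eVec, fVec] at h1 h2
  funext k
  fin_cases k
  · exact hs.trans (by simp [h1])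
  · exact ht.trans (by simp [h2])

theorem nondegenerateOn_firstFactor
    (h : lieAlgOf H = Submodule.span ℝ {eVec 0, eVec 1, eVec 2}) :
    NondegenerateOn ![1, -1] H := by
  intro c hc hcd
  rw [h] at hc hcd
  have h1 := hcd c hc
  rw [mem_span_eVec] at hc
  rw [prodInner_two, hc] at h1
  simp at h1
  funext k
  fin_cases k
  · ext a
    fin_cases a <;> simp <;> nlinarith [sq_nonneg (c 0 0), sq_nonneg (c 0 1), sq_nonneg (c 0 2)]
  · exact hc

end DimensionSix

/-! ### Isometric identifications of `𝔤` with Euclidean spaces -/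

section IsometricIdentifications

variable {V W : Type*} [NormedAddCommGroup V] [InnerProductSpace ℝ V] [FiniteDimensional ℝ V]
  [NormedAddCommGroup W] [InnerProductSpace ℝ W] [FiniteDimensional ℝ W]

/-- In Euclidean spaces of equal dimension, a subspace can be carried by an isometry into any
subspace of at least its dimension. -/
theorem exists_linearIsometryEquiv_mapsTo (hVW : Module.finrank ℝ W = Module.finrank ℝ V)
    (W₀ : Submodule ℝ W) (h : Submodule ℝ V)
    (hle : Module.finrank ℝ h ≤ Module.finrank ℝ W₀) :
    ∃ φ : W ≃ₗᵢ[ℝ] V, ∀ c ∈ h, φ.symm c ∈ W₀ := by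
  let e : V ≃ₗᵢ[ℝ] W := (stdOrthonormalBasis ℝ V).equiv (stdOrthonormalBasis ℝ W)
    (finCongr hVW.symm)
  let S : Submodule ℝ W := h.map e.toLinearEquiv.toLinearMap
  have hS : Module.finrank ℝ S ≤ Module.finrank ℝ W₀ := by
    rw [LinearEquiv.finrank_map_eq]; exact hle
  let b := stdOrthonormalBasis ℝ S
  let b₀ := stdOrthonormalBasis ℝ W₀
  let f : Fin (Module.finrank ℝ S) → W := fun i => b₀ (Fin.castLE hS i)
  have hf : Orthonormal ℝ f :=
    (b₀.orthonormal.comp_linearIsometry W₀.subtypeₗᵢ).comp _ (Fin.castLE_injective hS)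
  let L₀ : S →ₗ[ℝ] W := b.toBasis.constr ℝ f
  have hL₀ : L₀ ∘ b.toBasis = f := funext fun i => b.toBasis.constr_basis ℝ f i
  let L : S →ₗᵢ[ℝ] W := L₀.isometryOfOrthonormal (v := b.toBasis)
    (by rw [OrthonormalBasis.coe_toBasis]; exact b.orthonormal) (by rw [hL₀]; exact hf)
  have hL : ∀ s, L s ∈ W₀ := by
    intro s
    have h1 : L₀ s = ∑ i, b.toBasis.repr s i • f i := by
      rw [Module.Basis.constr_apply_fintype]
      rfl
    change L₀ s ∈ W₀
    rw [h1]
    exact Submodule.sum_mem _ fun i _ => W₀.smul_mem _ (b₀ _).2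
  let E : W ≃ₗᵢ[ℝ] W := L.extend.toLinearIsometryEquiv rfl
  refine ⟨(e.trans E).symm, fun c hc => ?_⟩
  have h1 : e c ∈ S := ⟨c, hc, rfl⟩
  change L.extend (e c) ∈ W₀
  rw [L.extend_apply ⟨e c, h1⟩]
  exact hL _

/-- `𝔤` with the Euclidean inner product. -/
def lieAlgEquivEuclidean (ν : ℕ) : LieAlg ν ≃ₗ[ℝ] EuclideanSpace ℝ (Fin ν × Fin 3) :=
  (LinearEquiv.curry ℝ ℝ (Fin ν) (Fin 3)).symm ≪≫ₗ (WithLp.linearEquiv 2 ℝ _).symm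

theorem inner_lieAlgEquivEuclidean {ν : ℕ} (c d : LieAlg ν) :
    inner ℝ (lieAlgEquivEuclidean ν c) (lieAlgEquivEuclidean ν d) = prodInner (fun _ => 1) c d := by
  simp only [lieAlgEquivEuclidean, PiLp.inner_apply, Fintype.sum_prod_type, prodInner,
    Units.val_one, Int.cast_one, one_mul]
  refine Finset.sum_congr rfl fun k _ => Finset.sum_congr rfl fun a _ => ?_
  exact mul_comm _ _

theorem finrank_lieAlg (ν : ℕ) : Module.finrank ℝ (LieAlg ν) = ν * 3 := by
  rw [Module.finrank_pi_fintype]; simp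

/-- `𝔤` with its positive definite inner product can be identified with any Euclidean space of the
same dimension in such a way that a given subspace goes into a given one of at least its
dimension. -/
theorem exists_isometric_identification {ν : ℕ} (hW : Module.finrank ℝ W = ν * 3)
    (W₀ : Submodule ℝ W) (h : Submodule ℝ (LieAlg ν))
    (hle : Module.finrank ℝ h ≤ Module.finrank ℝ W₀) :
    ∃ φ : W ≃ₗ[ℝ] LieAlg ν, (∀ p q, prodInner (fun _ => 1) (φ p) (φ q) = inner ℝ p q) ∧
      ∀ c ∈ h, ∃ w ∈ W₀, c = φ w := by
  let ι := lieAlgEquivEuclidean ν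
  obtain ⟨φ, hφ⟩ := exists_linearIsometryEquiv_mapsTo (V := EuclideanSpace ℝ (Fin ν × Fin 3))
    (by rw [hW, finrank_euclideanSpace, Fintype.card_prod, Fintype.card_fin, Fintype.card_fin]) W₀
    (h.map ι.toLinearMap) (by rw [LinearEquiv.finrank_map_eq]; exact hle)
  refine ⟨φ.toLinearEquiv ≪≫ₗ ι.symm, fun p q => ?_,
    fun c hc => ⟨φ.symm (ι c), hφ _ ⟨c, hc, rfl⟩, ?_⟩⟩
  · rw [← inner_lieAlgEquivEuclidean]
    simp [ι]
  · simp

end IsometricIdentifications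

/-! ### Quaternion structures on `(S³)⁴` -/

section Quaternions

variable {ν : ℕ} {H : Subgroup (S3Pow ν)}

theorem exists_isQuatIdentification {H : Subgroup (S3Pow 4)}
    (h : Module.finrank ℝ (lieAlgOf H) ≤ 3) :
    ∃ φ, IsQuatIdentification (fun _ => 1) H φ := by
  let ι : (Fin 3 → ℍ[ℝ]) ≃ₗ[ℝ] PiLp 2 fun _ : Fin 3 => ℍ[ℝ] := (WithLp.linearEquiv 2 ℝ _).symm
  let ρ : (Fin 3 → ℝ) →ₗ[ℝ] Fin 3 → ℍ[ℝ] := (Algebra.linearMap ℝ ℍ[ℝ]).compLeft (Fin 3)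
  have hρ : Function.Injective ρ := fun r s hrs => funext fun a =>
    Quaternion.coe_injective (congrFun hrs a)
  obtain ⟨φ, hφ, hφh⟩ := exists_isometric_identification (ν := 4)
    (W := PiLp 2 fun _ : Fin 3 => ℍ[ℝ])
    (by rw [← ι.finrank_eq, Module.finrank_pi_fintype]; simp [Quaternion.finrank_eq_four])
    (LinearMap.range (ι.toLinearMap ∘ₗ ρ)) (lieAlgOf H) (by
      have hinj : Function.Injective (ι.toLinearMap ∘ₗ ρ) := ι.injective.comp hρ
      rw [LinearMap.finrank_range_of_inj hinj]
      simpa using h)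
  refine ⟨ι ≪≫ₗ φ, fun p q => ?_, fun c hc => ?_⟩
  · exact (hφ _ _).trans (PiLp.inner_apply _ _)
  · obtain ⟨_, ⟨r, rfl⟩, hw⟩ := hφh c hc
    exact ⟨r, hw⟩

theorem leftInvEnd_add (j j' : LieAlg ν →ₗ[ℝ] LieAlg ν) (x : S3Pow ν)
    (v : TangentSpace (modelS3Pow ν) x) :
    leftInvEnd (j + j') x v = leftInvEnd j x v + leftInvEnd j' x v :=
  map_add (coframe x).inverse _ _

theorem leftInvEnd_smul (r : ℝ) (j : LieAlg ν →ₗ[ℝ] LieAlg ν) (x : S3Pow ν)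
    (v : TangentSpace (modelS3Pow ν) x) : leftInvEnd (r • j) x v = r • leftInvEnd j x v :=
  map_smul (coframe x).inverse _ _

theorem leftInvEnd_id (x : S3Pow ν) (v : TangentSpace (modelS3Pow ν) x) :
    leftInvEnd LinearMap.id x v = v := inverse_coframe_apply x v

theorem prodMetric_leftInvEnd (ε : Fin ν → ℤˣ) (j : LieAlg ν →ₗ[ℝ] LieAlg ν) (x : S3Pow ν)
    (v w : TangentSpace (modelS3Pow ν) x) :
    prodMetric ε x (leftInvEnd j x v) (leftInvEnd j x w) =
      prodInner ε (j (coframe x v)) (j (coframe x w)) := by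
  rw [prodMetric_apply, coframe_leftInvEnd, coframe_leftInvEnd]

theorem quatEnd_apply (φ : (Fin 3 → ℍ[ℝ]) ≃ₗ[ℝ] LieAlg ν) (q : ℍ[ℝ]) (p : Fin 3 → ℍ[ℝ]) :
    quatEnd φ q (φ p) = φ fun a => q * p a := by
  rw [quatEnd, LinearEquiv.conj_apply_apply, φ.symm_apply_apply]
  rfl

theorem LinearMap.ext_equiv {V W : Type*} [AddCommGroup V] [Module ℝ V] [AddCommGroup W]
    [Module ℝ W] (φ : W ≃ₗ[ℝ] V) {j j' : V →ₗ[ℝ] V} (h : ∀ w, j (φ w) = j' (φ w)) : j = j' :=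
  LinearMap.ext fun v => by
    obtain ⟨w, rfl⟩ := φ.surjective v
    exact h w

theorem isFlatQuaternion_quatEnd {φ : (Fin 3 → ℍ[ℝ]) ≃ₗ[ℝ] LieAlg ν} {ε : Fin ν → ℤˣ}
    (hφ : ∀ p q, prodInner ε (φ p) (φ q) = ∑ a, inner ℝ (p a) (q a)) :
    IsFlatQuaternion (prodMetric ε) fun q => leftInvEnd (quatEnd φ q) where
  smooth q := smoothEnd_leftInvEnd _
  map_add p q x v := by
    rw [← leftInvEnd_add]
    refine congrArg (fun j => leftInvEnd j x v) ?_
    refine LinearMap.ext_equiv φ fun w => ?_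
    rw [LinearMap.add_apply, quatEnd_apply, quatEnd_apply, quatEnd_apply, ← map_add]
    exact congrArg φ (funext fun a => add_mul _ _ _)
  map_smul r q x v := by
    rw [← leftInvEnd_smul]
    refine congrArg (fun j => leftInvEnd j x v) ?_
    refine LinearMap.ext_equiv φ fun w => ?_
    rw [LinearMap.smul_apply, quatEnd_apply, quatEnd_apply, ← map_smul]
    exact congrArg φ (funext fun a => smul_mul_assoc _ _ _)
  map_one x v := by
    refine Eq.trans ?_ (leftInvEnd_id x v)
    refine congrArg (fun j => leftInvEnd j x v) ?_
    refine LinearMap.ext_equiv φ fun w => ?_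
    rw [quatEnd_apply]
    exact congrArg φ (funext fun a => one_mul _)
  map_mul p q x v := by
    rw [leftInvEnd_leftInvEnd]
    refine congrArg (fun j => leftInvEnd j x v) ?_
    refine LinearMap.ext_equiv φ fun w => ?_
    rw [LinearMap.comp_apply, quatEnd_apply, quatEnd_apply, quatEnd_apply]
    exact congrArg φ (funext fun a => mul_assoc _ _ _)
  norm q x v := by
    rw [prodMetric_leftInvEnd, prodMetric_apply]
    obtain ⟨w, hw⟩ := φ.surjective (coframe x v)
    rw [← hw, quatEnd_apply, hφ, hφ, Finset.mul_sum]
    refine Finset.sum_congr rfl fun a _ => ?_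
    rw [real_inner_self_eq_norm_sq, real_inner_self_eq_norm_sq, norm_mul, mul_pow]

theorem isAntiInvariantQuaternion {ε : Fin ν → ℤˣ} (hε : ∀ k, ε k = 1)
    (hH : IsClosed (H : Set (S3Pow ν)))
    {φ : (Fin 3 → ℍ[ℝ]) ≃ₗ[ℝ] LieAlg ν} (hφ : IsQuatIdentification ε H φ)
    (Q : CosetGeometry ε H) :
    IsAntiInvariantQuaternionSubmersion (prodMetric ε) Q.metric Q.proj
      (fun q => leftInvEnd (quatEnd φ q)) := by
  refine ⟨Q.isRiemannianSubmersion hH hε, isFlatQuaternion_quatEnd hφ.isometry, fun q hq =>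
    Q.isAntiInvariant_leftInvEnd hH fun c hc d hd => ?_⟩
  obtain ⟨r, rfl⟩ := hφ.real c hc
  obtain ⟨s, rfl⟩ := hφ.real d hd
  rw [quatEnd_apply, hφ.isometry]
  refine Finset.sum_eq_zero fun a _ => ?_
  simp [Quaternion.inner_def, hq]

end Quaternions

/-! ### Octonian structures on `(S³)⁸` -/

section Octonions

variable {ν : ℕ} {H : Subgroup (S3Pow ν)}

theorem octMulLeft_add (p q r : Octonian) :
    octMulLeft (p + q) r = octMulLeft p r + octMulLeft q r := by
  ext <;> simp [octMulLeft] <;> ring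

theorem octMulLeft_smul (c : ℝ) (p q : Octonian) :
    octMulLeft (c • p) q = c • octMulLeft p q := by
  ext <;> simp [octMulLeft] <;> ring

theorem octMulLeft_one (p : Octonian) : octMulLeft (1, 0) p = p := by
  simp [octMulLeft]

/-- The left alternative law. -/
theorem octMulLeft_octMulLeft (p q : Octonian) :
    octMulLeft p (octMulLeft p q) = octMulLeft (octMulLeft p p) q := by
  obtain ⟨a, b⟩ := p
  obtain ⟨c, d⟩ := q
  refine Prod.ext (Quaternion.ext _ _ ?_ ?_ ?_ ?_) (Quaternion.ext _ _ ?_ ?_ ?_ ?_) <;>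
  simp only [octMulLeft, LinearMap.coe_mk, AddHom.coe_mk, Quaternion.re_mul, Quaternion.imI_mul,
    Quaternion.imJ_mul, Quaternion.imK_mul, Quaternion.re_add, Quaternion.imI_add,
    Quaternion.imJ_add, Quaternion.imK_add, Quaternion.re_sub, Quaternion.imI_sub,
    Quaternion.imJ_sub, Quaternion.imK_sub, Quaternion.re_star, Quaternion.imI_star,
    Quaternion.imJ_star, Quaternion.imK_star] <;> ring

theorem octInner_eq (p q : Octonian) : octInner p q =
    p.1.re * q.1.re + p.1.imI * q.1.imI + p.1.imJ * q.1.imJ + p.1.imK * q.1.imK +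
    (p.2.re * q.2.re + p.2.imI * q.2.imI + p.2.imJ * q.2.imJ + p.2.imK * q.2.imK) := by
  simp only [octInner, Quaternion.inner_def, Quaternion.re_mul, Quaternion.re_star,
    Quaternion.imI_star, Quaternion.imJ_star, Quaternion.imK_star]
  ring

/-- The norm of the octonians is multiplicative. -/
theorem octInner_octMulLeft (p q : Octonian) :
    octInner (octMulLeft p q) (octMulLeft p q) = octInner p p * octInner q q := by
  obtain ⟨a, b⟩ := p
  obtain ⟨c, d⟩ := q
  simp only [octInner_eq, octMulLeft, LinearMap.coe_mk, AddHom.coe_mk, Quaternion.re_mul,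
    Quaternion.imI_mul, Quaternion.imJ_mul, Quaternion.imK_mul, Quaternion.re_add,
    Quaternion.imI_add, Quaternion.imJ_add, Quaternion.imK_add, Quaternion.re_sub,
    Quaternion.imI_sub, Quaternion.imJ_sub, Quaternion.imK_sub, Quaternion.re_star,
    Quaternion.imI_star, Quaternion.imJ_star, Quaternion.imK_star]
  ring

/-- The octonian conjugation. -/
def octConj : Octonian →ₗ[ℝ] Octonian where
  toFun o := (star o.1, -o.2)
  map_add' p q := by ext <;> simp <;> ring
  map_smul' c q := by ext <;> simp

theorem octConj_octMulLeft_self (o : Octonian) :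
    octConj (octMulLeft o o) = octMulLeft (octConj o) (octConj o) := by
  ext <;> simp [octMulLeft, octConj] <;> ring

/-- Unital real-linear self-maps of `𝕆` that preserve squares and norms: through such a map `𝕆`
still acts alternatively and conformally on itself. -/
structure IsOctTwist (τ : Octonian →ₗ[ℝ] Octonian) : Prop where
  map_one : τ (1, 0) = (1, 0)
  map_sq : ∀ o, τ (octMulLeft o o) = octMulLeft (τ o) (τ o)
  norm : ∀ o, octInner (τ o) (τ o) = octInner o o

theorem isOctTwist_id : IsOctTwist LinearMap.id := ⟨rfl, fun _ => rfl, fun _ => rfl⟩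

theorem isOctTwist_octConj : IsOctTwist octConj where
  map_one := by ext <;> simp [octConj]
  map_sq := octConj_octMulLeft_self
  norm o := by simp [octInner, octConj]

/-- The endomorphism of `𝔤` that corresponds under `φ` to the multiplication of the `a`-th
component of `𝕆³` by `τ a o`. -/
def twistedOctEnd (φ : (Fin 3 → Octonian) ≃ₗ[ℝ] LieAlg ν)
    (τ : Fin 3 → Octonian →ₗ[ℝ] Octonian) (o : Octonian) : LieAlg ν →ₗ[ℝ] LieAlg ν :=
  φ.conj (LinearMap.pi fun a => octMulLeft (τ a o) ∘ₗ LinearMap.proj a)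

theorem twistedOctEnd_apply (φ : (Fin 3 → Octonian) ≃ₗ[ℝ] LieAlg ν)
    (τ : Fin 3 → Octonian →ₗ[ℝ] Octonian) (o : Octonian) (p : Fin 3 → Octonian) :
    twistedOctEnd φ τ o (φ p) = φ fun a => octMulLeft (τ a o) (p a) := by
  rw [twistedOctEnd, LinearEquiv.conj_apply_apply, φ.symm_apply_apply]
  rfl

theorem octEnd_eq_twistedOctEnd (φ : (Fin 3 → Octonian) ≃ₗ[ℝ] LieAlg ν) :
    octEnd φ = twistedOctEnd φ fun _ => LinearMap.id := rfl

theorem isFlatOctonian_twistedOctEnd {φ : (Fin 3 → Octonian) ≃ₗ[ℝ] LieAlg ν} {ε : Fin ν → ℤˣ}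
    (hφ : ∀ p q, prodInner ε (φ p) (φ q) = ∑ a, octInner (p a) (q a))
    {τ : Fin 3 → Octonian →ₗ[ℝ] Octonian} (hτ : ∀ a, IsOctTwist (τ a)) :
    IsFlatOctonian (prodMetric ε) fun o => leftInvEnd (twistedOctEnd φ τ o) where
  smooth o := smoothEnd_leftInvEnd _
  map_add p q x v := by
    rw [← leftInvEnd_add]
    refine congrArg (fun j => leftInvEnd j x v) (LinearMap.ext_equiv φ fun w => ?_)
    rw [LinearMap.add_apply, twistedOctEnd_apply, twistedOctEnd_apply, twistedOctEnd_apply,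
      ← map_add]
    refine congrArg φ (funext fun a => ?_)
    rw [map_add, octMulLeft_add, Pi.add_apply]
  map_smul r q x v := by
    rw [← leftInvEnd_smul]
    refine congrArg (fun j => leftInvEnd j x v) (LinearMap.ext_equiv φ fun w => ?_)
    rw [LinearMap.smul_apply, twistedOctEnd_apply, twistedOctEnd_apply, ← map_smul]
    refine congrArg φ (funext fun a => ?_)
    rw [map_smul, octMulLeft_smul, Pi.smul_apply]
  map_one x v := by
    refine Eq.trans ?_ (leftInvEnd_id x v)
    refine congrArg (fun j => leftInvEnd j x v) (LinearMap.ext_equiv φ fun w => ?_)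
    rw [twistedOctEnd_apply]
    refine congrArg φ (funext fun a => ?_)
    rw [(hτ a).map_one, octMulLeft_one]
  alternative o x v := by
    rw [leftInvEnd_leftInvEnd]
    refine congrArg (fun j => leftInvEnd j x v) (LinearMap.ext_equiv φ fun w => ?_)
    rw [LinearMap.comp_apply, twistedOctEnd_apply, twistedOctEnd_apply, twistedOctEnd_apply]
    refine congrArg φ (funext fun a => ?_)
    rw [(hτ a).map_sq, octMulLeft_octMulLeft]
  norm q x v := by
    rw [prodMetric_leftInvEnd, prodMetric_apply]
    obtain ⟨w, hw⟩ := φ.surjective (coframe x v)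
    rw [← hw, twistedOctEnd_apply, hφ, hφ, Finset.mul_sum]
    refine Finset.sum_congr rfl fun a _ => ?_
    rw [octInner_octMulLeft, (hτ a).norm]

theorem isAntiInvariantOctonian {ε : Fin ν → ℤˣ} (hε : ∀ k, ε k = 1)
    (hH : IsClosed (H : Set (S3Pow ν)))
    {φ : (Fin 3 → Octonian) ≃ₗ[ℝ] LieAlg ν} (hφ : IsOctIdentification ε H φ)
    (Q : CosetGeometry ε H) :
    IsAntiInvariantOctonianSubmersion (prodMetric ε) Q.metric Q.proj
      (fun o => leftInvEnd (octEnd φ o)) := by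
  rw [octEnd_eq_twistedOctEnd]
  refine ⟨Q.isRiemannianSubmersion hH hε,
    isFlatOctonian_twistedOctEnd hφ.isometry fun _ => isOctTwist_id, fun o ho =>
    Q.isAntiInvariant_leftInvEnd hH fun c hc d hd => ?_⟩
  obtain ⟨r, rfl⟩ := hφ.real c hc
  obtain ⟨s, rfl⟩ := hφ.real d hd
  rw [twistedOctEnd_apply, hφ.isometry]
  refine Finset.sum_eq_zero fun a _ => ?_
  simp [octInner_eq, octMulLeft, ho]

/-- `𝕆³` with its Euclidean norm. -/
abbrev EuclideanOctonian3 : Type := PiLp 2 fun _ : Fin 3 => WithLp 2 (ℍ[ℝ] × ℍ[ℝ])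

/-- `𝕆³` and its Euclidean copy. -/
def octonian3Equiv : (Fin 3 → Octonian) ≃ₗ[ℝ] EuclideanOctonian3 :=
  (LinearEquiv.piCongrRight fun _ => (WithLp.linearEquiv 2 ℝ (ℍ[ℝ] × ℍ[ℝ])).symm) ≪≫ₗ
    (WithLp.linearEquiv 2 ℝ _).symm

theorem inner_octonian3Equiv (p q : Fin 3 → Octonian) :
    inner ℝ (octonian3Equiv p) (octonian3Equiv q) = ∑ a, octInner (p a) (q a) := by
  rw [PiLp.inner_apply]
  exact Finset.sum_congr rfl fun a _ => WithLp.prod_inner_apply _ _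

/-- The linear map `ρ` parametrizes the subspace of `𝕆³` that is to contain `𝔥`. -/
theorem exists_octonian_identification {V₀ : Type*} [AddCommGroup V₀] [Module ℝ V₀]
    (ρ : V₀ →ₗ[ℝ] Fin 3 → Octonian) (hρ : Function.Injective ρ) (h : Submodule ℝ (LieAlg 8))
    (hle : Module.finrank ℝ h ≤ Module.finrank ℝ V₀) :
    ∃ φ : (Fin 3 → Octonian) ≃ₗ[ℝ] LieAlg 8,
      (∀ p q, prodInner (fun _ => 1) (φ p) (φ q) = ∑ a, octInner (p a) (q a)) ∧
      ∀ c ∈ h, ∃ v, c = φ (ρ v) := by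
  have hinj : Function.Injective (octonian3Equiv.toLinearMap ∘ₗ ρ) :=
    octonian3Equiv.injective.comp hρ
  obtain ⟨φ, hφ, hφh⟩ := exists_isometric_identification (ν := 8) (W := EuclideanOctonian3)
    (by
      rw [← octonian3Equiv.finrank_eq, Module.finrank_pi_fintype]
      simp [Octonian, Quaternion.finrank_eq_four])
    (LinearMap.range (octonian3Equiv.toLinearMap ∘ₗ ρ)) h
    (by rw [LinearMap.finrank_range_of_inj hinj]; exact hle)
  refine ⟨octonian3Equiv ≪≫ₗ φ, fun p q => ?_, fun c hc => ?_⟩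
  · exact (hφ _ _).trans (inner_octonian3Equiv p q)
  · obtain ⟨_, ⟨v, rfl⟩, hw⟩ := hφh c hc
    exact ⟨v, hw⟩

theorem exists_isOctIdentification {H : Subgroup (S3Pow 8)}
    (h : Module.finrank ℝ (lieAlgOf H) ≤ 3) :
    ∃ φ, IsOctIdentification (fun _ => 1) H φ := by
  let ρ : (Fin 3 → ℝ) →ₗ[ℝ] Fin 3 → Octonian :=
    (LinearMap.inl ℝ ℍ[ℝ] ℍ[ℝ] ∘ₗ Algebra.linearMap ℝ ℍ[ℝ]).compLeft (Fin 3)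
  obtain ⟨φ, hφ, hφh⟩ := exists_octonian_identification ρ
    (fun r s hrs => funext fun a => Quaternion.coe_injective (congrArg Prod.fst (congrFun hrs a)))
    (lieAlgOf H) (by simpa using h)
  exact ⟨φ, hφ, hφh⟩

/-- For imaginary `o` the operator `(u, v, w) ↦ (o u, ō v, o w)` of `𝕆³` maps the diagonal
`{(s, s, 0)}` of dimension 8 to its orthogonal complement, so it suffices to move `𝔥` into this
diagonal. -/
theorem exists_isAntiInvariantOctonian {H : Subgroup (S3Pow 8)}
    (hH : IsClosed (H : Set (S3Pow 8))) (h : Module.finrank ℝ (lieAlgOf H) ≤ 7) :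
    ∃ A : Octonian → LieAlg 8 →ₗ[ℝ] LieAlg 8, ∀ Q : CosetGeometry (fun _ => 1) H,
      IsAntiInvariantOctonianSubmersion (prodMetric fun _ => 1) Q.metric Q.proj
        (fun o => leftInvEnd (A o)) := by
  let ρ : Octonian →ₗ[ℝ] Fin 3 → Octonian := LinearMap.pi ![LinearMap.id, LinearMap.id, 0]
  obtain ⟨φ, hφ, hφh⟩ := exists_octonian_identification ρ (fun r s hrs => congrFun hrs 0)
    (lieAlgOf H) (h.trans (by simp [Octonian, Quaternion.finrank_eq_four]))
  refine ⟨twistedOctEnd φ ![LinearMap.id, octConj, LinearMap.id], fun Q =>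
    ⟨Q.isRiemannianSubmersion hH fun _ => rfl, isFlatOctonian_twistedOctEnd hφ ?_, fun o ho =>
      Q.isAntiInvariant_leftInvEnd hH fun c hc d hd => ?_⟩⟩
  · intro a
    fin_cases a
    exacts [isOctTwist_id, isOctTwist_octConj, isOctTwist_id]
  · obtain ⟨r, rfl⟩ := hφh c hc
    obtain ⟨s, rfl⟩ := hφh d hd
    rw [twistedOctEnd_apply, hφ, Fin.sum_univ_three]
    simp [ρ, octInner_eq, octMulLeft, octConj, ho]
    ring

end Octonions

/-! ### Orthonormal bases of indefinite inner products -/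

section SignedBases

variable {ν : ℕ} {ε : Fin ν → ℤˣ}

/-- The family `w` is orthogonal with `⟨w i, w i⟩ = s i`. -/
def IsSignedOrthonormal (ε : Fin ν → ℤˣ) {ι : Type*} [DecidableEq ι] (w : ι → LieAlg ν)
    (s : ι → ℤˣ) : Prop :=
  ∀ i j, prodInner ε (w i) (w j) = if i = j then ((s i : ℤ) : ℝ) else 0

namespace IsSignedOrthonormal

variable {ι : Type*} [DecidableEq ι] {w : ι → LieAlg ν} {s : ι → ℤˣ}

theorem prodInner_sum_left [Fintype ι] (hw : IsSignedOrthonormal ε w s) (x : ι → ℝ) (j : ι) :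
    prodInner ε (∑ i, x i • w i) (w j) = x j * ((s j : ℤ) : ℝ) := by
  rw [← prodInnerL_apply, map_sum, sum_apply, Finset.sum_eq_single j]
  · rw [prodInnerL_apply, prodInner_smul_left, hw, if_pos rfl]
  · intro i _ hij
    rw [prodInnerL_apply, prodInner_smul_left, hw, if_neg hij, mul_zero]
  · simp

theorem prodInner_sum_sum [Fintype ι] (hw : IsSignedOrthonormal ε w s) (x y : ι → ℝ) :
    prodInner ε (∑ i, x i • w i) (∑ i, y i • w i) = ∑ i, ((s i : ℤ) : ℝ) * (x i * y i) := by
  rw [← prodInnerL_apply, map_sum]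
  refine Finset.sum_congr rfl fun j _ => ?_
  rw [prodInnerL_apply, prodInner_smul_right, hw.prodInner_sum_left]
  ring

theorem linearIndependent [Fintype ι] (hw : IsSignedOrthonormal ε w s) :
    LinearIndependent ℝ w := by
  rw [Fintype.linearIndependent_iff]
  intro x hx j
  have h := hw.prodInner_sum_left x j
  rw [hx, ← zero_smul ℝ (0 : LieAlg ν), prodInner_smul_left, zero_mul] at h
  have h1 := units_mul_self (s j)
  calc x j = x j * ((s j : ℤ) : ℝ) * ((s j : ℤ) : ℝ) := by rw [mul_assoc, h1, mul_one]
    _ = 0 := by rw [← h, zero_mul]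

/-- A definite subspace injects into the sum of the factors of its sign. -/
theorem card_le [Fintype ι] (hw : IsSignedOrthonormal ε w s) (t : ℤˣ) :
    Fintype.card {i // s i = t} ≤ 3 * Fintype.card {k // ε k = t} := by
  let P : ({i // s i = t} → ℝ) →ₗ[ℝ] LieAlg ν :=
    Fintype.linearCombination ℝ fun i : {i // s i = t} => w i
  let R : LieAlg ν →ₗ[ℝ] {k // ε k = t} → Fin 3 → ℝ := LinearMap.funLeft ℝ _ Subtype.val
  have hw' : IsSignedOrthonormal ε (fun i : {i // s i = t} => w i) fun i => s i := by
    intro i j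
    rw [hw]
    simp only [Subtype.ext_iff]
  have hinj : Function.Injective (R ∘ₗ P) := by
    rw [← LinearMap.ker_eq_bot, LinearMap.ker_eq_bot']
    intro x hx
    have h1 : prodInner ε (P x) (P x) = ((t : ℤ) : ℝ) * ∑ i, x i * x i := by
      refine (hw'.prodInner_sum_sum x x).trans ?_
      rw [Finset.mul_sum]
      exact Finset.sum_congr rfl fun i _ => by rw [i.2]
    have h2 : 0 ≤ ((t : ℤ) : ℝ) * -prodInner ε (P x) (P x) := by
      rw [prodInner, ← Finset.sum_neg_distrib, Finset.mul_sum]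
      refine Finset.sum_nonneg fun k _ => ?_
      by_cases hk : ε k = t
      · have h3 : P x k = 0 := congrFun hx ⟨k, hk⟩
        simp [h3]
      · have h3 : ((t : ℤ) : ℝ) * ((ε k : ℤ) : ℝ) = -1 := by
          rcases Int.units_eq_one_or t with rfl | rfl <;>
          rcases Int.units_eq_one_or (ε k) with h | h <;> simp_all
        have h4 : 0 ≤ ∑ a, P x k a * P x k a := Finset.sum_nonneg fun a _ => mul_self_nonneg _
        calc 0 ≤ -(((t : ℤ) : ℝ) * ((ε k : ℤ) : ℝ)) * ∑ a, P x k a * P x k a := by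
              rw [h3, neg_neg, one_mul]; exact h4
          _ = _ := by ring
    rw [h1, mul_neg, ← mul_assoc, units_mul_self, one_mul, Left.nonneg_neg_iff] at h2
    have h5 := (Finset.sum_eq_zero_iff_of_nonneg fun i _ => mul_self_nonneg (x i)).1
      (h2.antisymm (Finset.sum_nonneg fun i _ => mul_self_nonneg _))
    exact funext fun i => mul_self_eq_zero.1 (h5 i (Finset.mem_univ _))
  have := LinearMap.finrank_le_finrank_of_injective hinj
  simpa [Module.finrank_pi_fintype, mul_comm] using this

end IsSignedOrthonormal

theorem exists_signedOrthonormal_basis (W : Submodule ℝ (LieAlg ν))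
    (hW : ∀ c ∈ W, (∀ d ∈ W, prodInner ε c d = 0) → c = 0) :
    ∃ (b : Module.Basis (Fin (Module.finrank ℝ W)) ℝ W) (s : Fin (Module.finrank ℝ W) → ℤˣ),
      IsSignedOrthonormal ε (fun i => (b i : LieAlg ν)) s := by
  let B : LinearMap.BilinForm ℝ W := LinearMap.mk₂ ℝ (fun c d : W => prodInner ε c d)
    (fun _ _ _ => prodInner_add_left _ _ _) (fun _ _ _ => prodInner_smul_left _ _ _)
    (fun _ _ _ => prodInner_add_right _ _ _) (fun _ _ _ => prodInner_smul_right _ _ _)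
  have hB : B.IsSymm := ⟨fun c d => prodInner_comm ε (c : LieAlg ν) d⟩
  obtain ⟨v, hv⟩ := LinearMap.BilinForm.exists_orthogonal_basis (B := B)
    (LinearMap.BilinForm.isSymm_iff.1 hB)
  have hv0 : ∀ i j, i ≠ j → prodInner ε (v i : LieAlg ν) (v j) = 0 := fun i j hij => hv hij
  have hne : ∀ i, prodInner ε (v i : LieAlg ν) (v i) ≠ 0 := by
    intro i hi
    refine v.ne_zero i (Subtype.ext (hW _ (v i).2 fun d hd => ?_))
    have h1 : B (v i) = 0 := v.ext fun j => by
      rcases eq_or_ne i j with rfl | hij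
      exacts [hi, hv0 i j hij]
    exact LinearMap.congr_fun h1 ⟨d, hd⟩
  let r : Fin (Module.finrank ℝ W) → ℝ := fun i =>
    (Real.sqrt |prodInner ε (v i : LieAlg ν) (v i)|)⁻¹
  have hr : ∀ i, r i ≠ 0 := fun i =>
    inv_ne_zero (Real.sqrt_ne_zero'.2 (abs_pos.2 (hne i)))
  -- the vectors of an orthogonal basis are not null; they are scaled to length `±1`
  refine ⟨v.unitsSMul fun i => Units.mk0 (r i) (hr i),
    fun i => if 0 < prodInner ε (v i : LieAlg ν) (v i) then 1 else -1, fun i j => ?_⟩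
  have h1 : ∀ i, ((v.unitsSMul fun i => Units.mk0 (r i) (hr i)) i : LieAlg ν) =
      r i • (v i : LieAlg ν) :=
    fun i => by rw [Module.Basis.unitsSMul_apply]; rfl
  beta_reduce
  rw [h1, h1, prodInner_smul_left, prodInner_smul_right]
  rcases eq_or_ne i j with rfl | hij
  · rw [if_pos rfl, ← mul_assoc]
    have h2 : r i * r i = |prodInner ε (v i : LieAlg ν) (v i)|⁻¹ := by
      rw [← mul_inv, Real.mul_self_sqrt (abs_nonneg _)]
    rw [h2]
    rcases lt_or_gt_of_ne (hne i) with h | h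
    · rw [abs_of_neg h, if_neg h.not_gt, inv_neg, neg_mul, inv_mul_cancel₀ (hne i)]
      simp
    · rw [abs_of_pos h, if_pos h, inv_mul_cancel₀ (hne i)]
      simp
  · rw [if_neg hij, hv0 i j hij, mul_zero, mul_zero]

/-- A signed orthonormal basis of `𝔤` adapted to `𝔥`. -/
theorem exists_adapted_signedOrthonormal {H : Subgroup (S3Pow ν)} (h : NondegenerateOn ε H) :
    ∃ (n : ℕ) (b : Module.Basis (Fin (Module.finrank ℝ (lieAlgOf H))) ℝ (lieAlgOf H))
      (w : Fin (Module.finrank ℝ (lieAlgOf H)) ⊕ Fin n → LieAlg ν)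
      (s : Fin (Module.finrank ℝ (lieAlgOf H)) ⊕ Fin n → ℤˣ),
      Module.finrank ℝ (lieAlgOf H) + n = ν * 3 ∧ IsSignedOrthonormal ε w s ∧
      ∀ i, w (Sum.inl i) = b i := by
  obtain ⟨b, s, hb⟩ := exists_signedOrthonormal_basis (lieAlgOf H) h
  obtain ⟨b', s', hb'⟩ := exists_signedOrthonormal_basis (perpAlg ε H) (eq_zero_of_mem_perpAlg h)
  refine ⟨_, b, Sum.elim (fun i => b i) fun i => b' i, Sum.elim s s', ?_, ?_, fun i => rfl⟩
  · rw [Submodule.finrank_add_eq_of_isCompl (isCompl_perpAlg h).symm, finrank_lieAlg]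
  · rintro (i | i) (j | j)
    · simpa using hb i j
    · rw [if_neg Sum.inl_ne_inr, prodInner_comm]
      exact (b' j).2 _ (b i).2
    · rw [if_neg Sum.inr_ne_inl]
      exact (b' i).2 _ (b j).2
    · simpa using hb' i j

end SignedBases

/-! ### Para-quaternion structures on `(S³)⁴` -/

section ParaQuaternions

/-- If two maps have fibres of equal cardinality, an injection on a subset of the source that is
compatible with them extends to a compatible bijection. -/
theorem exists_equiv_of_card_fiber {α β γ : Type*} [Fintype α] [Fintype β] [DecidableEq γ]
    [DecidableEq β] (s : α → γ) (σ : β → γ)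
    (hc : ∀ t, Fintype.card {i // s i = t} = Fintype.card {j // σ j = t}) (S : Set α) (f : α → β)
    (hf : Set.InjOn f S) (hs : ∀ i ∈ S, σ (f i) = s i) :
    ∃ e : α ≃ β, (∀ i, σ (e i) = s i) ∧ ∀ i ∈ S, e i = f i := by
  have h : ∀ t, ∃ e : {i // s i = t} ≃ {j // σ j = t},
      ∀ i : {i // s i = t}, i.1 ∈ S → (e i : β) = f i := by
    intro t
    obtain ⟨e, he⟩ := Set.MapsTo.exists_equiv_extend_of_card_eq (α := {i // s i = t})
      (t := Finset.univ.filter fun j => σ j = t) (s := {i | i.1 ∈ S}) (f := fun i => f i)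
      (by rw [hc, Fintype.card_subtype])
      (fun i hi => by simpa using (hs _ hi).trans i.2)
      (fun i hi j hj hij => Subtype.ext (hf hi hj hij))
    exact ⟨e.trans (Equiv.subtypeEquivRight fun j => by simp), he⟩
  choose e he using h
  refine ⟨Equiv.ofFiberEquiv e, fun i => Equiv.ofFiberEquiv_map e i, fun i hi => ?_⟩
  exact he (s i) ⟨i, rfl⟩ hi

/-- The signs of the basis `e₀, …, e₃` of each factor of `ℚ̃³`. -/
def paraSign (η : Fin 3 → ℤˣ) (j : Fin 3 × Fin 4) : ℤˣ := η j.1 * ![1, 1, -1, -1] j.2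

theorem card_paraSign : ∀ (η : Fin 3 → ℤˣ) (t : ℤˣ),
    Fintype.card {j // paraSign η j = t} = 6 := by decide

theorem card_sign_of_sum_eq_zero : ∀ ε : Fin 4 → ℤˣ, ∑ k, (ε k : ℤ) = 0 → ∀ t : ℤˣ,
    Fintype.card {k // ε k = t} = 2 := by decide

/-- Sylvester's law of inertia for a metric on `(S³)⁴` with two positive and two negative signs: an
orthonormal basis of the 12-dimensional `𝔤` has six vectors of each sign. -/
theorem IsSignedOrthonormal.card_eq_six {ε : Fin 4 → ℤˣ} (hε : ∑ k, (ε k : ℤ) = 0) {ι : Type*}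
    [DecidableEq ι] [Fintype ι] {w : ι → LieAlg 4} {s : ι → ℤˣ} (hw : IsSignedOrthonormal ε w s)
    (hι : Fintype.card ι = 12) (t : ℤˣ) : Fintype.card {i // s i = t} = 6 := by
  have h1 : ∀ t, Fintype.card {i // s i = t} ≤ 6 := fun t => by
    have := hw.card_le t
    rwa [card_sign_of_sum_eq_zero ε hε] at this
  have h2 : ∑ t : ℤˣ, Fintype.card {i // s i = t} = 12 := by
    rw [← hι, ← Fintype.card_sigma, Fintype.card_congr (Equiv.sigmaFiberEquiv s)]
  have h3 : (Finset.univ : Finset ℤˣ) = {1, -1} := rfl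
  rw [h3, Finset.sum_pair (by decide)] at h2
  have h4 := h1 1
  have h5 := h1 (-1)
  rcases Int.units_eq_one_or t with rfl | rfl <;> omega

/-- The coordinates on `ℚ̃³`. -/
def paraCoord : (Fin 3 → ParaQuaternion) ≃ₗ[ℝ] (Fin 3 × Fin 4 → ℝ) :=
  (LinearEquiv.piCongrRight fun _ => QuaternionAlgebra.linearEquivTuple (-1 : ℝ) 0 1) ≪≫ₗ
    (LinearEquiv.curry ℝ ℝ (Fin 3) (Fin 4)).symm

theorem paraCoord_apply (p : Fin 3 → ParaQuaternion) (j : Fin 3 × Fin 4) :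
    paraCoord p j = ![(p j.1).re, (p j.1).imI, (p j.1).imJ, (p j.1).imK] j.2 := rfl

theorem sum_paraSign (η : Fin 3 → ℤˣ) (p q : Fin 3 → ParaQuaternion) :
    ∑ j, ((paraSign η j : ℤ) : ℝ) * (paraCoord p j * paraCoord q j) =
      ∑ a, ((η a : ℤ) : ℝ) * paraQuatInner (p a) (q a) := by
  rw [Fintype.sum_prod_type]
  refine Finset.sum_congr rfl fun a _ => ?_
  rw [Fin.sum_univ_four]
  simp [paraSign, paraCoord_apply, paraQuatInner]
  ring

/-- An orthonormal basis of `𝔥` consists of at most three vectors, which become the units of the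
first factors of `ℚ̃³`. Each factor has two vectors of each sign whatever `η` is, so the signs of
the remaining vectors of an adapted basis of `𝔤` can be matched as well. -/
theorem exists_isParaQuatIdentification {ε : Fin 4 → ℤˣ} (hε : ∑ k, (ε k : ℤ) = 0)
    {H : Subgroup (S3Pow 4)} (h : NondegenerateOn ε H)
    (hd : Module.finrank ℝ (lieAlgOf H) ≤ 3) :
    ∃ η φ, IsParaQuatIdentification ε H η φ := by
  obtain ⟨n, b, w, s, hn, hw, hb⟩ := exists_adapted_signedOrthonormal h
  -- the basis vectors of `𝔥` are to become the real units of the first `dim 𝔥` factors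
  let η : Fin 3 → ℤˣ := fun a => if ha : a.1 < Module.finrank ℝ (lieAlgOf H) then
    s (Sum.inl ⟨a, ha⟩) else 1
  have hcard : Fintype.card (Fin (Module.finrank ℝ (lieAlgOf H)) ⊕ Fin n) = 12 := by
    rw [Fintype.card_sum, Fintype.card_fin, Fintype.card_fin, hn]
  obtain ⟨e, he, hef⟩ := exists_equiv_of_card_fiber s (paraSign η)
    (fun t => (hw.card_eq_six hε hcard t).trans (card_paraSign η t).symm) (Set.range Sum.inl)
    (Sum.elim (fun i => (Fin.castLE hd i, 0)) fun _ => (0, 0))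
    (by
      rintro _ ⟨i, rfl⟩ _ ⟨j, rfl⟩ hij
      exact congrArg _ (Fin.castLE_injective hd (congrArg Prod.fst hij)))
    (by
      rintro _ ⟨i, rfl⟩
      simp [paraSign, η])
  let B : Module.Basis (Fin (Module.finrank ℝ (lieAlgOf H)) ⊕ Fin n) ℝ (LieAlg 4) :=
    basisOfLinearIndependentOfCardEqFinrank' w hw.linearIndependent
      (by rw [hcard, finrank_lieAlg])
  have hB : ∀ i, B i = w i := fun i => by simp [B]
  let φ : (Fin 3 → ParaQuaternion) ≃ₗ[ℝ] LieAlg 4 := paraCoord ≪≫ₗ (B.reindex e).equivFun.symm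
  have hφ : ∀ p, φ p = ∑ i, paraCoord p (e i) • w i := by
    intro p
    refine ((B.reindex e).equivFun_symm_apply _).trans ?_
    rw [← e.sum_comp]
    refine Finset.sum_congr rfl fun i _ => ?_
    rw [Module.Basis.reindex_apply, e.symm_apply_apply, hB]
    rfl
  refine ⟨η, φ, fun p q => ?_, ?_⟩
  · rw [hφ, hφ, hw.prodInner_sum_sum, ← sum_paraSign, ← e.sum_comp]
    exact Finset.sum_congr rfl fun i _ => by rw [he]
  · let ρ : (Fin 3 → ℝ) →ₗ[ℝ] Fin 3 → ParaQuaternion :=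
      (Algebra.linearMap ℝ ParaQuaternion).compLeft (Fin 3)
    have hle : lieAlgOf H ≤ LinearMap.range (φ.toLinearMap ∘ₗ ρ) := by
      have h1 : Submodule.map (lieAlgOf H).subtype ⊤ ≤ LinearMap.range (φ.toLinearMap ∘ₗ ρ) := by
        rw [← b.span_eq, Submodule.map_span, Submodule.span_le]
        rintro _ ⟨_, ⟨i, rfl⟩, rfl⟩
        refine ⟨Pi.single (Fin.castLE hd i) 1, ?_⟩
        refine (hφ _).trans ((Finset.sum_eq_single (Sum.inl i) ?_ ?_).trans ?_)
        · intro j _ hj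
          have h2 : e j ≠ (Fin.castLE hd i, 0) := fun h3 =>
            hj (e.injective (h3.trans (hef _ ⟨i, rfl⟩).symm))
          generalize e j = a at h2
          obtain ⟨a, c⟩ := a
          rw [paraCoord_apply]
          by_cases ha : a = Fin.castLE hd i
          · subst ha
            have hc : c ≠ 0 := fun hc => h2 (by rw [hc])
            fin_cases c
            · exact absurd rfl hc
            all_goals simp [ρ]
          · fin_cases c <;> simp [ρ, Pi.single_eq_of_ne ha]
        · simp
        · rw [hef _ ⟨i, rfl⟩, hb, paraCoord_apply]
          simp [ρ]
      simpa using h1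
    intro c hc
    obtain ⟨r, hr⟩ := hle hc
    exact ⟨r, hr.symm⟩

variable {ν : ℕ} {H : Subgroup (S3Pow ν)}

theorem paraQuatEnd_apply (φ : (Fin 3 → ParaQuaternion) ≃ₗ[ℝ] LieAlg ν) (q : ParaQuaternion)
    (p : Fin 3 → ParaQuaternion) : paraQuatEnd φ q (φ p) = φ fun a => q * p a := by
  rw [paraQuatEnd, LinearEquiv.conj_apply_apply, φ.symm_apply_apply]
  rfl

theorem paraQuatEnd_paraQuatEnd (φ : (Fin 3 → ParaQuaternion) ≃ₗ[ℝ] LieAlg ν)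
    (p q : ParaQuaternion) (c : LieAlg ν) :
    paraQuatEnd φ p (paraQuatEnd φ q c) = paraQuatEnd φ (p * q) c := by
  obtain ⟨w, rfl⟩ := φ.surjective c
  rw [paraQuatEnd_apply, paraQuatEnd_apply, paraQuatEnd_apply]
  exact congrArg φ (funext fun a => (mul_assoc _ _ _).symm)

theorem paraQuatEnd_one (φ : (Fin 3 → ParaQuaternion) ≃ₗ[ℝ] LieAlg ν) (c : LieAlg ν) :
    paraQuatEnd φ 1 c = c := by
  obtain ⟨w, rfl⟩ := φ.surjective c
  rw [paraQuatEnd_apply]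
  exact congrArg φ (funext fun a => one_mul _)

theorem paraQuatEnd_add (φ : (Fin 3 → ParaQuaternion) ≃ₗ[ℝ] LieAlg ν) (p q : ParaQuaternion) :
    paraQuatEnd φ (p + q) = paraQuatEnd φ p + paraQuatEnd φ q :=
  LinearMap.ext_equiv φ fun w => by
    rw [LinearMap.add_apply, paraQuatEnd_apply, paraQuatEnd_apply, paraQuatEnd_apply, ← map_add]
    exact congrArg φ (funext fun a => add_mul _ _ _)

theorem paraQuatEnd_smul (φ : (Fin 3 → ParaQuaternion) ≃ₗ[ℝ] LieAlg ν) (r : ℝ)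
    (q : ParaQuaternion) : paraQuatEnd φ (r • q) = r • paraQuatEnd φ q :=
  LinearMap.ext_equiv φ fun w => by
    rw [LinearMap.smul_apply, paraQuatEnd_apply, paraQuatEnd_apply, ← map_smul]
    exact congrArg φ (funext fun a => smul_mul_assoc _ _ _)

theorem prodInner_paraQuatEnd {ε : Fin ν → ℤˣ} {η : Fin 3 → ℤˣ}
    {φ : (Fin 3 → ParaQuaternion) ≃ₗ[ℝ] LieAlg ν}
    (hφ : ∀ p q, prodInner ε (φ p) (φ q) = ∑ a, ((η a : ℤ) : ℝ) * paraQuatInner (p a) (q a))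
    {u : ParaQuaternion} {r : ℝ}
    (hu : ∀ p q, paraQuatInner (u * p) (u * q) = r * paraQuatInner p q) (c d : LieAlg ν) :
    prodInner ε (paraQuatEnd φ u c) (paraQuatEnd φ u d) = r * prodInner ε c d := by
  obtain ⟨p, rfl⟩ := φ.surjective c
  obtain ⟨q, rfl⟩ := φ.surjective d
  rw [paraQuatEnd_apply, paraQuatEnd_apply, hφ, hφ, Finset.mul_sum]
  exact Finset.sum_congr rfl fun a _ => by rw [hu, mul_left_comm]

theorem isParaHermitian_paraQuatEnd {ε : Fin ν → ℤˣ} {η : Fin 3 → ℤˣ}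
    {φ : (Fin 3 → ParaQuaternion) ≃ₗ[ℝ] LieAlg ν}
    (hφ : ∀ p q, prodInner ε (φ p) (φ q) = ∑ a, ((η a : ℤ) : ℝ) * paraQuatInner (p a) (q a))
    {u : ParaQuaternion} (hu1 : u * u = 1)
    (hu : ∀ p q, paraQuatInner (u * p) (u * q) = -1 * paraQuatInner p q) :
    IsParaHermitian (prodMetric ε) (leftInvEnd (paraQuatEnd φ u)) :=
  isParaHermitian_leftInvEnd (fun c => by rw [paraQuatEnd_paraQuatEnd, hu1, paraQuatEnd_one])
    fun c d => by rw [prodInner_paraQuatEnd hφ hu, neg_one_mul]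

theorem isParaQuaternion_paraQuatEnd {ε : Fin ν → ℤˣ} {η : Fin 3 → ℤˣ}
    {φ : (Fin 3 → ParaQuaternion) ≃ₗ[ℝ] LieAlg ν}
    (hφ : ∀ p q, prodInner ε (φ p) (φ q) = ∑ a, ((η a : ℤ) : ℝ) * paraQuatInner (p a) (q a)) :
    IsParaQuaternion (prodMetric ε) fun q => leftInvEnd (paraQuatEnd φ q) where
  smooth q := smoothEnd_leftInvEnd _
  map_add p q x v := by rw [← leftInvEnd_add, paraQuatEnd_add]
  map_smul r q x v := by rw [← leftInvEnd_smul, paraQuatEnd_smul]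
  map_one x v := (congrArg (fun j => leftInvEnd j x v)
    (LinearMap.ext (paraQuatEnd_one φ) : _ = LinearMap.id)).trans (leftInvEnd_id x v)
  map_mul p q x v := by
    rw [leftInvEnd_leftInvEnd]
    exact congrArg (fun j => leftInvEnd j x v)
      (LinearMap.ext fun c => (paraQuatEnd_paraQuatEnd φ p q c).symm)
  hermitian := by
    refine isAlmostHermitian_leftInvEnd (fun c => ?_) fun c d => ?_
    · have h1 : (⟨0, 1, 0, 0⟩ * ⟨0, 1, 0, 0⟩ : ParaQuaternion) = (-1 : ℝ) • 1 := by
        ext <;> simp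
      rw [paraQuatEnd_paraQuatEnd, h1, paraQuatEnd_smul, LinearMap.smul_apply, paraQuatEnd_one,
        neg_one_smul]
    · rw [prodInner_paraQuatEnd hφ (r := 1) fun p q => by simp [paraQuatInner]; ring, one_mul]
  paraHermitian₂ := isParaHermitian_paraQuatEnd hφ (by ext <;> simp) fun p q => by
    simp [paraQuatInner]; ring
  paraHermitian₃ := isParaHermitian_paraQuatEnd hφ (by ext <;> simp) fun p q => by
    simp [paraQuatInner]; ring

theorem isAntiInvariantParaQuaternion {ε : Fin ν → ℤˣ} (hH : IsClosed (H : Set (S3Pow ν)))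
    {η : Fin 3 → ℤˣ} {φ : (Fin 3 → ParaQuaternion) ≃ₗ[ℝ] LieAlg ν}
    (hφ : IsParaQuatIdentification ε H η φ) (Q : CosetGeometry ε H) :
    IsAntiInvariantParaQuaternionSubmersion (prodMetric ε) Q.metric Q.proj
      (fun q => leftInvEnd (paraQuatEnd φ q)) := by
  refine ⟨Q.submersion, isParaQuaternion_paraQuatEnd hφ.isometry, fun q hq =>
    Q.isAntiInvariant_leftInvEnd hH fun c hc d hd => ?_⟩
  obtain ⟨r, rfl⟩ := hφ.real c hc
  obtain ⟨s, rfl⟩ := hφ.real d hd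
  rw [paraQuatEnd_apply, hφ.isometry]
  refine Finset.sum_eq_zero fun a _ => ?_
  simp [paraQuatInner, hq]

end ParaQuaternions

/-! ### Anti-invariant submersions of products of three-spheres -/

theorem mainTheorem2 :
    -- the metrics on `(S³)^ν` and the submersions onto the coset manifolds
    (∀ (ν : ℕ) (ε : Fin ν → ℤˣ),
      CompactSpace (S3Pow ν) ∧
      IsPseudoRiemannianMetric (prodMetric ε) ∧
      IsBiInvariant (prodMetric ε) ∧
      HasRicci (prodMetric ε) (fun x => (2 : ℝ) • prodMetric (fun _ => 1) x) ∧
      (∀ s : ℤˣ, (∀ k, ε k = s) → IsEinstein (prodMetric ε) (2 * ((s : ℤ) : ℝ))) ∧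
      (∀ H : Subgroup (S3Pow ν), IsClosed (H : Set (S3Pow ν)) → NondegenerateOn ε H →
        Nonempty (CosetGeometry ε H))) ∧
    -- `S³ × S³ → S² × S²`, Hermitian
    ((∃ H : Subgroup (S3Pow 2), IsClosed (H : Set (S3Pow 2)) ∧ IsConnected (H : Set (S3Pow 2)) ∧
        lieAlgOf H = Submodule.span ℝ {eVec 1, fVec 1}) ∧
      ∀ H : Subgroup (S3Pow 2), IsClosed (H : Set (S3Pow 2)) →
        lieAlgOf H = Submodule.span ℝ {eVec 1, fVec 1} →
        Nonempty (CosetGeometry ![1, 1] H) ∧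
        ∀ Q : CosetGeometry ![1, 1] H,
          IsAntiInvariantHermitianSubmersion (prodMetric ![1, 1]) Q.metric Q.proj
            (leftInvEnd (endOfImages ![fVec 0, eVec 2, -eVec 1] ![-eVec 0, fVec 2, -fVec 1])) ∧
          (IsConnected (H : Set (S3Pow 2)) →
            Nonempty (Diffeomorph (𝓡 Q.dim) ((𝓡 2).prod (𝓡 2)) (S3Pow 2 ⧸ H) (S2 × S2) ∞))) ∧
    -- `S³ × S³ → S³`, almost Hermitian and not integrable
    ((∃ H : Subgroup (S3Pow 2), IsClosed (H : Set (S3Pow 2)) ∧ IsConnected (H : Set (S3Pow 2)) ∧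
        lieAlgOf H = Submodule.span ℝ {eVec 0, eVec 1, eVec 2}) ∧
      ¬ IsIntegrable (leftInvEnd
          (endOfImages ![fVec 0, fVec 1, fVec 2] ![-eVec 0, -eVec 1, -eVec 2])) ∧
      ∀ H : Subgroup (S3Pow 2), IsClosed (H : Set (S3Pow 2)) →
        lieAlgOf H = Submodule.span ℝ {eVec 0, eVec 1, eVec 2} →
        Nonempty (CosetGeometry ![1, 1] H) ∧
        ∀ Q : CosetGeometry ![1, 1] H,
          IsAntiInvariantAlmostHermitianSubmersion (prodMetric ![1, 1]) Q.metric Q.proj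
            (leftInvEnd
              (endOfImages ![fVec 0, fVec 1, fVec 2] ![-eVec 0, -eVec 1, -eVec 2])) ∧
          (IsConnected (H : Set (S3Pow 2)) →
            Nonempty (Diffeomorph (𝓡 Q.dim) (𝓡 3) (S3Pow 2 ⧸ H) S3 ∞))) ∧
    -- `S³ × S³ → S² × S²`, para-Hermitian
    ((∃ H : Subgroup (S3Pow 2), IsClosed (H : Set (S3Pow 2)) ∧ IsConnected (H : Set (S3Pow 2)) ∧
        lieAlgOf H = Submodule.span ℝ {eVec 0, fVec 0}) ∧
      ∀ H : Subgroup (S3Pow 2), IsClosed (H : Set (S3Pow 2)) →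
        lieAlgOf H = Submodule.span ℝ {eVec 0, fVec 0} →
        Nonempty (CosetGeometry ![1, -1] H) ∧
        ∀ Q : CosetGeometry ![1, -1] H,
          IsAntiInvariantParaHermitianSubmersion (prodMetric ![1, -1]) Q.metric Q.proj
            (leftInvEnd (endOfImages ![fVec 1, fVec 0, fVec 2] ![eVec 1, eVec 0, eVec 2])) ∧
          (IsConnected (H : Set (S3Pow 2)) →
            Nonempty (Diffeomorph (𝓡 Q.dim) ((𝓡 2).prod (𝓡 2)) (S3Pow 2 ⧸ H) (S2 × S2) ∞))) ∧
    -- `S³ × S³ → S³`, para-Hermitian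
    ((∃ H : Subgroup (S3Pow 2), IsClosed (H : Set (S3Pow 2)) ∧ IsConnected (H : Set (S3Pow 2)) ∧
        lieAlgOf H = Submodule.span ℝ {eVec 0, eVec 1, eVec 2}) ∧
      ∀ H : Subgroup (S3Pow 2), IsClosed (H : Set (S3Pow 2)) →
        lieAlgOf H = Submodule.span ℝ {eVec 0, eVec 1, eVec 2} →
        Nonempty (CosetGeometry ![1, -1] H) ∧
        ∀ Q : CosetGeometry ![1, -1] H,
          IsAntiInvariantParaHermitianSubmersion (prodMetric ![1, -1]) Q.metric Q.proj
            (leftInvEnd (endOfImages ![fVec 0, fVec 1, fVec 2] ![eVec 0, eVec 1, eVec 2])) ∧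
          (IsConnected (H : Set (S3Pow 2)) →
            Nonempty (Diffeomorph (𝓡 Q.dim) (𝓡 3) (S3Pow 2 ⧸ H) S3 ∞))) ∧
    -- `(S³)^4`, quaternion
    (∀ H : Subgroup (S3Pow 4), IsClosed (H : Set (S3Pow 4)) →
      Module.finrank ℝ (lieAlgOf H) ≤ 3 →
      Nonempty (CosetGeometry (fun _ => 1) H) ∧
      (∃ φ, IsQuatIdentification (fun _ => 1) H φ) ∧
      ∀ φ, IsQuatIdentification (fun _ => 1) H φ → ∀ Q : CosetGeometry (fun _ => 1) H,
        IsAntiInvariantQuaternionSubmersion (prodMetric fun _ => 1) Q.metric Q.proj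
          (fun q => leftInvEnd (quatEnd φ q))) ∧
    -- `(S³)^4`, para-quaternion
    (∀ (ε : Fin 4 → ℤˣ), ∑ k, (ε k : ℤ) = 0 →
      ∀ H : Subgroup (S3Pow 4), IsClosed (H : Set (S3Pow 4)) → NondegenerateOn ε H →
      Module.finrank ℝ (lieAlgOf H) ≤ 3 →
      Nonempty (CosetGeometry ε H) ∧
      (∃ η φ, IsParaQuatIdentification ε H η φ) ∧
      ∀ η φ, IsParaQuatIdentification ε H η φ → ∀ Q : CosetGeometry ε H,
        IsAntiInvariantParaQuaternionSubmersion (prodMetric ε) Q.metric Q.proj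
          (fun q => leftInvEnd (paraQuatEnd φ q))) ∧
    -- `(S³)^8`, octonian
    (∀ H : Subgroup (S3Pow 8), IsClosed (H : Set (S3Pow 8)) →
      Module.finrank ℝ (lieAlgOf H) ≤ 7 →
      Nonempty (CosetGeometry (fun _ => 1) H) ∧
      (Module.finrank ℝ (lieAlgOf H) ≤ 3 → ∃ φ, IsOctIdentification (fun _ => 1) H φ) ∧
      (∀ φ, IsOctIdentification (fun _ => 1) H φ → ∀ Q : CosetGeometry (fun _ => 1) H,
        IsAntiInvariantOctonianSubmersion (prodMetric fun _ => 1) Q.metric Q.proj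
          (fun o => leftInvEnd (octEnd φ o))) ∧
      (∃ A : Octonian → LieAlg 8 →ₗ[ℝ] LieAlg 8, ∀ Q : CosetGeometry (fun _ => 1) H,
        IsAntiInvariantOctonianSubmersion (prodMetric fun _ => 1) Q.metric Q.proj
          (fun o => leftInvEnd (A o)))) := by
  have hone : ∀ k, (![1, 1] : Fin 2 → ℤˣ) k = 1 := by simp [Fin.forall_fin_two]
  refine ⟨fun ν ε => ⟨inferInstance, isPseudoRiemannianMetric_prodMetric ε,
    isBiInvariant_prodMetric ε, hasRicci_prodMetric ε, fun s h => isEinstein_prodMetric h,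
    fun H hH h => nonempty_cosetGeometry hH h⟩, ⟨?_, ?_⟩, ⟨?_, ?_, ?_⟩, ⟨?_, ?_⟩, ⟨?_, ?_⟩,
    ?_, ?_, ?_⟩
  · exact ⟨torus 1, isClosed_torus 1, isConnected_torus 1, lieAlgOf_torus 1⟩
  · exact fun H hH h => ⟨nonempty_cosetGeometry hH (nondegenerateOn_one hone), fun Q =>
      ⟨isAntiInvariantHermitian_torus hH h Q, fun hc => Q.nonempty_diffeomorph_S2 1 hH hc h⟩⟩
  · exact ⟨firstFactor, isClosed_firstFactor, isConnected_firstFactor, lieAlgOf_firstFactor⟩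
  · exact not_isIntegrable_almostHermitian
  · exact fun H hH h => ⟨nonempty_cosetGeometry hH (nondegenerateOn_one hone), fun Q =>
      ⟨isAntiInvariantAlmostHermitian_firstFactor hH h Q,
        fun hc => Q.nonempty_diffeomorph_S3 hH hc h⟩⟩
  · exact ⟨torus 0, isClosed_torus 0, isConnected_torus 0, lieAlgOf_torus 0⟩
  · exact fun H hH h => ⟨nonempty_cosetGeometry hH (nondegenerateOn_torus h), fun Q =>
      ⟨isAntiInvariantParaHermitian_torus hH h Q,
        fun hc => Q.nonempty_diffeomorph_S2 0 hH hc h⟩⟩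
  · exact ⟨firstFactor, isClosed_firstFactor, isConnected_firstFactor, lieAlgOf_firstFactor⟩
  · exact fun H hH h => ⟨nonempty_cosetGeometry hH (nondegenerateOn_firstFactor h), fun Q =>
      ⟨isAntiInvariantParaHermitian_firstFactor hH h Q,
        fun hc => Q.nonempty_diffeomorph_S3 hH hc h⟩⟩
  · exact fun H hH h => ⟨nonempty_cosetGeometry hH (nondegenerateOn_one fun _ => rfl),
      exists_isQuatIdentification h, fun φ hφ Q => isAntiInvariantQuaternion (fun _ => rfl) hH hφ Q⟩
  · exact fun ε hε H hH hn h => ⟨nonempty_cosetGeometry hH hn,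
      exists_isParaQuatIdentification hε hn h,
      fun η φ hφ Q => isAntiInvariantParaQuaternion hH hφ Q⟩
  · exact fun H hH h => ⟨nonempty_cosetGeometry hH (nondegenerateOn_one fun _ => rfl),
      exists_isOctIdentification, fun φ hφ Q => isAntiInvariantOctonian (fun _ => rfl) hH hφ Q,
      exists_isAntiInvariantOctonian hH h⟩

end
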